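/- Let $n,s>0$ and let $M$ be a smooth manifold of dimension $2n+s$ with a Riemannian metric $g$ and Levi-Civita connection $\nabla$. A \emph{weak metric $f$-structure} $(f,Q,\xi_1,\dots,\xi_s,\eta^1,\dots,\eta^s,g)$ on $M$ consists of a smooth skew-symmetric $(1,1)$-tensor $f$ of rank $2n$, a smooth self-adjoint nonsingular $(1,1)$-tensor $Q$, smooth orthonormal vector fields $\xi_i$ and smooth dual $1$-forms $\eta^i$ such that $$f^2=-Q+\sum_i\eta^i\otimes\xi_i,\quad \eta^i(\xi_j)=\delta^i_j,\quad Q\xi_i=\xi_i,\quad g(fX,fY)=g(X,QY)-\sum_i\eta^i(X)\eta^i(Y).$$ Put $\mathcal D=\bigcap_i\ker\eta^i$ and $\widetilde Q=Q-\mathrm{id}$. Assume that the structure is \emph{weak nearly $\mathcal C$}, i.e. $(\nabla_Xf)Y+(\nabla_Yf)X=0$ for all vector fields $X,Y$, and that 1. $[\xi_i,\xi_j]=0$ for all $i,j$; 2. $g(\nabla_X\xi_i,\xi_j)=0$ for all $i,j$ and all $X$; 3. $(\nabla_XQ)Y=0$ for all $X$ and all $Y\in\mathcal D$; 4. $R_{\widetilde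 QX,Y}Z\in\mathcal D$ for all $X,Y,Z\in\mathcal D$, where $R_{X,Y}=[\nabla_X,\nabla_Y]-\nabla_{[X,Y]}$. Let $h_i=\nabla\xi_i$. Let $\mathcal D_{i,1},\dots,\mathcal D_{i,r_i}$ be the eigen-distributions of $h_i^2$ for its nonzero eigenvalues, and let $\mathcal D_{i,0}$ be the part of $\ker h_i^2$ orthogonal to $\ker f$. Call a smooth distribution integrable if an integral manifold passes through every point. Then: (i) each $\ker f\oplus\mathcal D_{i,j}$ $(1\le i\le s,\ 1\le j\le r_i)$ is a smooth integrable distribution with totally geodesic leaves. If moreover $\dim\ker d\eta^i>s$ at every point for all $i$ (where $\ker d\eta^i=\{X: d\eta^i(X,\cdot)=0\}$), then: (ii) $\mathcal D_{i,0}\neq0$ at every point and $\ker f\oplus\mathcal D_{i,0}$ is a smooth integrable distribution with totally geodesic leaves, for every $i$; (iii) if $\ker d\eta^i=\ker d\eta^j$ at every point for all $i,j$, then the distributions $\mathcal D_{i,0}$ coincide, are smooth and integrable with totally geodesic leaves, and on each leaf the metric $\bar g$ and the tensor $\bar f$ induced by $g$ and $f$ form a weak nearly Kähler structure with $\bar\nabla(\bar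 f^{\,2})=0$, where $\bar\nabla$ is the Levi-Civita connection of $\bar g$. (Weak nearly Kähler: the dimension is even, $\bar f$ is skew-symmetric, $\bar f^{\,2}$ is negative definite, and $(\bar\nabla_X\bar f)Y+(\bar\nabla_Y\bar f)X=0$.) (iv) $\ker f\oplus\mathcal D_{i,1}\oplus\dots\oplus\mathcal D_{i,r_i}$ is a smooth integrable distribution with totally geodesic leaves, for every $i$. -/

import Mathlib

open Bundle Module VectorField
open scoped Manifold ContDiff Topology

universe u w

set_option linter.unusedSectionVars false

noncomputable section

namespace WeakNearlyC

section Riemannian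

variable {E : Type*} [NormedAddCommGroup E] [NormedSpace ℝ E]
  {H : Type*} [TopologicalSpace H] {I : ModelWithCorners ℝ E H}
  {M : Type*} [TopologicalSpace M] [ChartedSpace H M] [IsManifold I ∞ M]

/-- Smooth (`C^∞`) Riemannian metrics on `M`. -/
abbrev Metric (I : ModelWithCorners ℝ E H) (M : Type*) [TopologicalSpace M] [ChartedSpace H M]
    [IsManifold I ∞ M] :=
  ContMDiffRiemannianMetric I ∞ E (fun x : M => TangentSpace I x)

variable (g : Metric I M)

theorem metric_mdiffAt {Y Z : Π x : M, TangentSpace I x} {x : M}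
    (hY : MDiffAt (T% Y) x) (hZ : MDiffAt (T% Z) x) :
    MDiffAt (fun y => g.inner y (Y y) (Z y)) x := by
  have : MDifferentiableAt I (I.prod 𝓘(ℝ))
      (fun m ↦ TotalSpace.mk' ℝ (E := Bundle.Trivial M ℝ) m (g.inner m (Y m) (Z m))) x := by
    apply MDifferentiableAt.clm_bundle_apply₂ (F₁ := E) (F₂ := E)
    · exact g.contMDiff.mdifferentiableAt (by simp)
    · exact hY
    · exact hZ
  simp only [mdifferentiableAt_totalSpace] at this
  exact this.2

/-- The right-hand side of Koszul's formula for `2 g(∇_X Y, Z)`. -/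
def koszul (X Y Z : Π x : M, TangentSpace I x) (x : M) : ℝ :=
  d% (fun y => g.inner y (Y y) (Z y)) x (X x) + d% (fun y => g.inner y (X y) (Z y)) x (Y x)
    - d% (fun y => g.inner y (X y) (Y y)) x (Z x)
    + g.inner x (mlieBracket I X Y x) (Z x) - g.inner x (mlieBracket I X Z x) (Y x)
    - g.inner x (mlieBracket I Y Z x) (X x)

theorem d_smul_left {f : M → ℝ} {Y Z : Π x : M, TangentSpace I x} {x : M} (hf : MDiffAt f x)
    (hY : MDiffAt (T% Y) x) (hZ : MDiffAt (T% Z) x) :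
    d% (fun y => g.inner y ((f • Y) y) (Z y)) x =
      f x • d% (fun y => g.inner y (Y y) (Z y)) x + g.inner x (Y x) (Z x) • d% f x := by
  have := mvfderiv_fun_mul hf (metric_mdiffAt g hY hZ)
  simpa using this

theorem d_smul_right {f : M → ℝ} {Y Z : Π x : M, TangentSpace I x} {x : M} (hf : MDiffAt f x)
    (hY : MDiffAt (T% Y) x) (hZ : MDiffAt (T% Z) x) :
    d% (fun y => g.inner y (Y y) ((f • Z) y)) x =
      f x • d% (fun y => g.inner y (Y y) (Z y)) x + g.inner x (Y x) (Z x) • d% f x := by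
  have := mvfderiv_fun_mul hf (metric_mdiffAt g hY hZ)
  simpa using this

theorem d_add_left {Y Y' Z : Π x : M, TangentSpace I x} {x : M}
    (hY : MDiffAt (T% Y) x) (hY' : MDiffAt (T% Y') x) (hZ : MDiffAt (T% Z) x) :
    d% (fun y => g.inner y ((Y + Y') y) (Z y)) x =
      d% (fun y => g.inner y (Y y) (Z y)) x + d% (fun y => g.inner y (Y' y) (Z y)) x := by
  have := mvfderiv_fun_add (metric_mdiffAt g hY hZ) (metric_mdiffAt g hY' hZ)
  simpa using this

theorem d_add_right {Y Z Z' : Π x : M, TangentSpace I x} {x : M}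
    (hY : MDiffAt (T% Y) x) (hZ : MDiffAt (T% Z) x) (hZ' : MDiffAt (T% Z') x) :
    d% (fun y => g.inner y (Y y) ((Z + Z') y)) x =
      d% (fun y => g.inner y (Y y) (Z y)) x + d% (fun y => g.inner y (Y y) (Z' y)) x := by
  have := mvfderiv_fun_add (metric_mdiffAt g hY hZ) (metric_mdiffAt g hY hZ')
  simpa using this

variable [FiniteDimensional ℝ E]

theorem koszul_tensorial_left (x : M) {Y Z : Π x : M, TangentSpace I x}
    (hY : MDiffAt (T% Y) x) (hZ : MDiffAt (T% Z) x) :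
    TensorialAt I E (fun X => koszul g X Y Z x) x where
  smul {f X} hf hX := by
    simp only [koszul, d_smul_left g hf hX hZ, d_smul_left g hf hX hY,
      mlieBracket_smul_left hf hX]
    simp [g.symm x (X x)]
    ring
  add {X X'} hX hX' := by
    simp only [koszul, d_add_left g hX hX' hZ, d_add_left g hX hX' hY,
      mlieBracket_add_left hX hX']
    simp
    ring

theorem koszul_tensorial_right (x : M) {X Y : Π x : M, TangentSpace I x}
    (hX : MDiffAt (T% X) x) (hY : MDiffAt (T% Y) x) :
    TensorialAt I E (fun Z => koszul g X Y Z x) x where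
  smul {f Z} hf hZ := by
    simp only [koszul, d_smul_right g hf hX hZ, d_smul_right g hf hY hZ,
      mlieBracket_smul_right hf hZ]
    simp [g.symm x (Z x)]
    ring
  add {Z Z'} hZ hZ' := by
    simp only [koszul, d_add_right g hX hZ hZ', d_add_right g hY hZ hZ',
      mlieBracket_add_right hZ hZ']
    simp
    ring

theorem koszul_add {X Y Y' Z : Π x : M, TangentSpace I x} {x : M}
    (hX : MDiffAt (T% X) x) (hY : MDiffAt (T% Y) x) (hY' : MDiffAt (T% Y') x)
    (hZ : MDiffAt (T% Z) x) :
    koszul g X (Y + Y') Z x = koszul g X Y Z x + koszul g X Y' Z x := by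
  simp only [koszul, d_add_right g hX hY hY', d_add_left g hY hY' hZ,
      mlieBracket_add_right hY hY', mlieBracket_add_left hY hY']
  simp
  ring

theorem koszul_smul {f : M → ℝ} {X Y Z : Π x : M, TangentSpace I x} {x : M} (hf : MDiffAt f x)
    (hX : MDiffAt (T% X) x) (hY : MDiffAt (T% Y) x) (hZ : MDiffAt (T% Z) x) :
    koszul g X (f • Y) Z x =
      f x * koszul g X Y Z x + 2 * (d% f x (X x) * g.inner x (Y x) (Z x)) := by
  simp only [koszul, d_smul_right g hf hX hY, d_smul_left g hf hY hZ,
      mlieBracket_smul_right hf hY, mlieBracket_smul_left hf hY]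
  simp [g.symm x (Y x)]
  ring

/-- The isomorphism `v ↦ g(v, ·)` from `T_x M` to its dual. -/
def flat (x : M) : TangentSpace I x ≃ₗ[ℝ] (TangentSpace I x →L[ℝ] ℝ) :=
  have : FiniteDimensional ℝ (TangentSpace I x) := inferInstanceAs (FiniteDimensional ℝ E)
  have : T2Space (TangentSpace I x) := inferInstanceAs (T2Space E)
  have : FiniteDimensional ℝ (TangentSpace I x →L[ℝ] ℝ) :=
    (LinearMap.toContinuousLinearMap (𝕜 := ℝ) (E := TangentSpace I x)
      (F' := ℝ)).finiteDimensional
  LinearEquiv.ofInjectiveOfFinrankEq (g.inner x).toLinearMap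
    (by
      refine (injective_iff_map_eq_zero _).2 fun v hv => ?_
      by_contra h
      have h1 := g.pos x v h
      have h2 : g.inner x v = 0 := hv
      rw [h2] at h1
      simp at h1)
    (by
      rw [← (LinearMap.toContinuousLinearMap (𝕜 := ℝ) (E := TangentSpace I x)
        (F' := ℝ)).finrank_eq]
      exact (Subspace.dual_finrank_eq (K := ℝ) (V := TangentSpace I x)).symm)

theorem flat_apply (x : M) (v w : TangentSpace I x) : flat g x v w = g.inner x v w := rfl

open Classical in
/-- The vector `∇_v Y ∈ T_x M`, obtained from Koszul's formula
(and zero where `Y` is not differentiable). -/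
def leviCivitaFun (Y : Π x : M, TangentSpace I x) (x : M) :
    TangentSpace I x →L[ℝ] TangentSpace I x :=
  have : FiniteDimensional ℝ (TangentSpace I x) := inferInstanceAs (FiniteDimensional ℝ E)
  have : T2Space (TangentSpace I x) := inferInstanceAs (T2Space E)
  if hY : MDiffAt (T% Y) x then
    LinearMap.toContinuousLinearMap ((1 / 2 : ℝ) • (flat g x).symm.toLinearMap ∘ₗ
      (TensorialAt.mkHom₂ (fun X Z => koszul g X Y Z x) x
        (fun _ hZ => koszul_tensorial_left g x hY hZ)
        (fun _ hX => koszul_tensorial_right g x hX hY)).toLinearMap)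
  else 0

theorem leviCivitaFun_spec {X Y Z : Π x : M, TangentSpace I x} {x : M}
    (hX : MDiffAt (T% X) x) (hY : MDiffAt (T% Y) x) (hZ : MDiffAt (T% Z) x) :
    2 * g.inner x (leviCivitaFun g Y x (X x)) (Z x) = koszul g X Y Z x := by
  rw [← TensorialAt.mkHom₂_apply (Φ := fun X Z => koszul g X Y Z x)
    (fun _ hZ => koszul_tensorial_left g x hY hZ)
    (fun _ hX => koszul_tensorial_right g x hX hY) hX hZ, ← flat_apply]
  simp [leviCivitaFun, hY]

theorem leviCivitaFun_ext {x : M} {A B : TangentSpace I x →L[ℝ] TangentSpace I x}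
    (h : ∀ X Z : Π x : M, TangentSpace I x, MDiffAt (T% X) x → MDiffAt (T% Z) x →
      2 * g.inner x (A (X x)) (Z x) = 2 * g.inner x (B (X x)) (Z x)) : A = B := by
  ext1 v
  apply (flat g x).injective
  ext1 w
  have := h (FiberBundle.extend E v) (FiberBundle.extend E w)
    (FiberBundle.mdifferentiableAt_extend ..) (FiberBundle.mdifferentiableAt_extend ..)
  simp only [FiberBundle.extend_apply_self] at this
  simp only [flat_apply]
  linarith

/-- The Levi-Civita connection of `g`; `leviCivita g Y x (X x)` is `(∇_X Y)(x)`. -/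
def leviCivita : CovariantDerivative I E (fun x : M => TangentSpace I x) where
  toFun := leviCivitaFun g
  isCovariantDerivativeOnUniv :=
    { add := fun {Y Y' x} hY hY' _ => by
        refine leviCivitaFun_ext g fun X Z hX hZ => ?_
        rw [leviCivitaFun_spec g hX (mdifferentiableAt_add_section hY hY') hZ,
          koszul_add g hX hY hY' hZ, ← leviCivitaFun_spec g hX hY hZ,
          ← leviCivitaFun_spec g hX hY' hZ]
        simp
        ring
      leibniz := fun {Y f x} hY hf _ => by
        refine leviCivitaFun_ext g fun X Z hX hZ => ?_
        rw [leviCivitaFun_spec g hX (hf.smul_section hY) hZ, koszul_smul g hf hX hY hZ,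
          ← leviCivitaFun_spec g hX hY hZ]
        simp
        ring }

theorem leviCivita_koszul {X Y Z : Π x : M, TangentSpace I x} {x : M}
    (hX : MDiffAt (T% X) x) (hY : MDiffAt (T% Y) x) (hZ : MDiffAt (T% Z) x) :
    2 * g.inner x (leviCivita g Y x (X x)) (Z x) = koszul g X Y Z x :=
  leviCivitaFun_spec g hX hY hZ

/-- The Levi-Civita connection is torsion free. -/
theorem leviCivita_torsion : (leviCivita g).torsion = 0 := by
  rw [CovariantDerivative.torsion_eq_zero_iff]
  intro X Y x hX hY
  apply (flat g x).injective
  ext1 w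
  have hw := FiberBundle.mdifferentiableAt_extend I E w
  have h1 := leviCivita_koszul g hX hY hw
  have h2 := leviCivita_koszul g hY hX hw
  simp only [FiberBundle.extend_apply_self] at h1 h2
  have h3 : (fun y => g.inner y (X y) (Y y)) = fun y => g.inner y (Y y) (X y) := by
    ext y; exact g.symm y _ _
  simp only [map_sub, flat_apply, sub_apply]
  simp only [koszul, FiberBundle.extend_apply_self, h3, mlieBracket_swap_apply (V := Y) (W := X)] at h1 h2
  simp at h1 h2
  linarith

/-- The Levi-Civita connection is metric. -/
theorem leviCivita_metric {X Y Z : Π x : M, TangentSpace I x} {x : M}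
    (hX : MDiffAt (T% X) x) (hY : MDiffAt (T% Y) x) (hZ : MDiffAt (T% Z) x) :
    d% (fun y => g.inner y (Y y) (Z y)) x (X x) =
      g.inner x (leviCivita g Y x (X x)) (Z x) + g.inner x (Y x) (leviCivita g Z x (X x)) := by
  have h1 := leviCivita_koszul g hX hY hZ
  have h2 := leviCivita_koszul g hX hZ hY
  have h3 : (fun y => g.inner y (Z y) (Y y)) = fun y => g.inner y (Y y) (Z y) := by
    ext y; exact g.symm y _ _
  have h4 := g.symm x (Y x) (leviCivita g Z x (X x))
  simp only [koszul, h3, mlieBracket_swap_apply (V := Z) (W := Y)] at h1 h2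
  simp at h1 h2
  linarith

/-- The covariant derivative `(∇_X A) Y = ∇_X (A Y) - A (∇_X Y)` of a `(1,1)`-tensor `A`. -/
def covEnd (A : Π x : M, TangentSpace I x →L[ℝ] TangentSpace I x)
    (X Y : Π x : M, TangentSpace I x) (x : M) : TangentSpace I x :=
  leviCivita g (fun y => A y (Y y)) x (X x) - A x (leviCivita g Y x (X x))

/-- The curvature `R_{X,Y} Z = ∇_X ∇_Y Z - ∇_Y ∇_X Z - ∇_{[X,Y]} Z`. -/
def curvature (X Y Z : Π x : M, TangentSpace I x) (x : M) : TangentSpace I x :=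
  leviCivita g (fun y => leviCivita g Z y (Y y)) x (X x)
    - leviCivita g (fun y => leviCivita g Z y (X y)) x (Y x)
    - leviCivita g Z x (mlieBracket I X Y x)

/-- Smooth vector fields. -/
def SmoothField (X : Π x : M, TangentSpace I x) : Prop := CMDiff ∞ (T% X)

/-- Smooth `(1,1)`-tensor fields. -/
def SmoothEnd (A : Π x : M, TangentSpace I x →L[ℝ] TangentSpace I x) : Prop :=
  ContMDiff I (I.prod 𝓘(ℝ, E →L[ℝ] E)) ∞ (fun x => TotalSpace.mk' (E →L[ℝ] E) x (A x))

/-- Smooth `1`-forms. -/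
def SmoothForm (η : Π x : M, TangentSpace I x →L[ℝ] ℝ) : Prop :=
  ContMDiff I (I.prod 𝓘(ℝ, E →L[ℝ] ℝ)) ∞
    (fun x => TotalSpace.mk' (E →L[ℝ] ℝ) (E := fun x : M => TangentSpace I x →L[ℝ] ℝ) x (η x))

/-- `dη(X, Y) = X(η(Y)) - Y(η(X)) - η([X, Y])`. -/
def extDerivAux (η : Π x : M, TangentSpace I x →L[ℝ] ℝ) (X Y : Π x : M, TangentSpace I x)
    (x : M) : ℝ :=
  d% (fun y => η y (Y y)) x (X x) - d% (fun y => η y (X y)) x (Y x) - η x (mlieBracket I X Y x)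

theorem SmoothForm.mdiffAt {η : Π x : M, TangentSpace I x →L[ℝ] ℝ} (hη : SmoothForm η)
    {Y : Π x : M, TangentSpace I x} {x : M} (hY : MDiffAt (T% Y) x) :
    MDiffAt (fun y => η y (Y y)) x := by
  have : MDifferentiableAt I (I.prod 𝓘(ℝ))
      (fun m ↦ TotalSpace.mk' ℝ (E := Bundle.Trivial M ℝ) m (η m (Y m))) x := by
    apply MDifferentiableAt.clm_bundle_apply (F₁ := E)
    · exact ContMDiff.mdifferentiableAt hη (by simp)
    · exact hY
  simp only [mdifferentiableAt_totalSpace] at this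
  exact this.2

theorem extDerivAux_swap (η : Π x : M, TangentSpace I x →L[ℝ] ℝ)
    (X Y : Π x : M, TangentSpace I x) (x : M) : extDerivAux η X Y x = - extDerivAux η Y X x := by
  simp only [extDerivAux, mlieBracket_swap_apply (V := X) (W := Y), map_neg]
  ring

theorem extDerivAux_tensorial_right {η : Π x : M, TangentSpace I x →L[ℝ] ℝ} (hη : SmoothForm η)
    (X : Π x : M, TangentSpace I x) (x : M) :
    TensorialAt I E (fun Y => extDerivAux η X Y x) x where
  smul {f Y} hf hY := by
    have := mvfderiv_fun_mul hf (hη.mdiffAt hY)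
    simp only [extDerivAux, mlieBracket_smul_right hf hY, Pi.smul_apply', map_smul, smul_eq_mul,
      this]
    simp
    ring
  add {Y Y'} hY hY' := by
    have := mvfderiv_fun_add (hη.mdiffAt hY) (hη.mdiffAt hY')
    simp only [extDerivAux, mlieBracket_add_right hY hY', Pi.add_apply, map_add, this]
    simp
    ring

theorem extDerivAux_tensorial_left {η : Π x : M, TangentSpace I x →L[ℝ] ℝ} (hη : SmoothForm η)
    (Y : Π x : M, TangentSpace I x) (x : M) :
    TensorialAt I E (fun X => extDerivAux η X Y x) x where
  smul hf hX := by
    simp only [extDerivAux_swap η _ Y, (extDerivAux_tensorial_right hη Y x).smul hf hX, smul_neg]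
  add hX hX' := by
    simp only [extDerivAux_swap η _ Y, (extDerivAux_tensorial_right hη Y x).add hX hX', neg_add]

/-- The exterior derivative of a smooth `1`-form, as a bilinear form on each tangent space. -/
def extDerivForm (η : Π x : M, TangentSpace I x →L[ℝ] ℝ) (hη : SmoothForm η) (x : M) :
    TangentSpace I x →L[ℝ] TangentSpace I x →L[ℝ] ℝ :=
  TensorialAt.mkHom₂ (fun X Y => extDerivAux η X Y x) x
    (fun Y _ => extDerivAux_tensorial_left hη Y x) (fun X _ => extDerivAux_tensorial_right hη X x)

theorem extDerivForm_apply {η : Π x : M, TangentSpace I x →L[ℝ] ℝ} (hη : SmoothForm η)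
    {X Y : Π x : M, TangentSpace I x} {x : M} (hX : MDiffAt (T% X) x) (hY : MDiffAt (T% Y) x) :
    extDerivForm η hη x (X x) (Y x) = extDerivAux η X Y x :=
  TensorialAt.mkHom₂_apply _ _ hX hY

end Riemannian

section Foliations

variable {E : Type*} [NormedAddCommGroup E] [NormedSpace ℝ E] [FiniteDimensional ℝ E]
  {H : Type*} [TopologicalSpace H] {I : ModelWithCorners ℝ E H}
  {M : Type u} [TopologicalSpace M] [ChartedSpace H M] [IsManifold I ∞ M]

/-- A smooth distribution: near each point it is spanned by a smooth frame. -/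
def IsSmoothDistribution (Δ : Π x : M, Submodule ℝ (TangentSpace I x)) : Prop :=
  ∀ p : M, ∃ (k : ℕ) (e : Fin k → Π x : M, TangentSpace I x),
    (∀ j, SmoothField (e j)) ∧
    ∀ᶠ x in 𝓝 p, LinearIndependent ℝ (fun j => e j x) ∧
      Submodule.span ℝ (Set.range fun j => e j x) = Δ x

/-- `ι : L → M` is an integral manifold of `Δ`: an injective smooth immersion of a connected
manifold (without boundary) with `dι(T_x L) = Δ (ι x)`. Leaves are the maximal ones. -/
structure IsIntegralManifold (Δ : Π x : M, Submodule ℝ (TangentSpace I x)) {k : ℕ}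
    {L : Type w} [TopologicalSpace L] [ChartedSpace (EuclideanSpace ℝ (Fin k)) L]
    (ι : L → M) : Prop where
  connected : ConnectedSpace L
  contMDiff : ContMDiff (𝓡 k) I ∞ ι
  injective : Function.Injective ι
  injective_mfderiv : ∀ x, Function.Injective (mfderiv (𝓡 k) I ι x)
  range_mfderiv : ∀ x, (mfderiv (𝓡 k) I ι x).range = Δ (ι x)

/-- The immersed submanifold `ι : L → M` is totally geodesic: `∇_X Y` is tangent to `L` whenever
`X` and `Y` are tangent to `L` (it suffices that they are so locally along `L`). -/
def IsTotallyGeodesic (g : Metric I M) {k : ℕ}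
    {L : Type w} [TopologicalSpace L] [ChartedSpace (EuclideanSpace ℝ (Fin k)) L]
    (ι : L → M) : Prop :=
  ∀ X Y : Π x : M, TangentSpace I x, SmoothField X → SmoothField Y → ∀ x : L,
    (∀ᶠ y in 𝓝 x, X (ι y) ∈ (mfderiv (𝓡 k) I ι y).range ∧
      Y (ι y) ∈ (mfderiv (𝓡 k) I ι y).range) →
    leviCivita g Y (ι x) (X (ι x)) ∈ (mfderiv (𝓡 k) I ι x).range

/-- The smooth distribution `Δ` is integrable (there is an integral manifold through each point)
and its leaves, indeed all its integral manifolds, are totally geodesic. -/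
structure IsTotallyGeodesicFoliation (g : Metric I M)
    (Δ : Π x : M, Submodule ℝ (TangentSpace I x)) : Prop where
  smooth : IsSmoothDistribution Δ
  integrable : ∀ p : M, ∃ (k : ℕ) (ι : EuclideanSpace ℝ (Fin k) → M),
    IsIntegralManifold (k := k) Δ ι ∧ p ∈ Set.range ι
  totallyGeodesic : ∀ (k : ℕ) (L : Type u) [TopologicalSpace L]
    [ChartedSpace (EuclideanSpace ℝ (Fin k)) L] [IsManifold (𝓡 k) ∞ L] (ι : L → M),
    IsIntegralManifold (k := k) Δ ι → IsTotallyGeodesic (k := k) g ι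

/-- `(M, f, g)` is a weak nearly Kähler manifold. -/
structure IsWeakNearlyKahler (g : Metric I M)
    (f : Π x : M, TangentSpace I x →L[ℝ] TangentSpace I x) : Prop where
  even_dim : Even (finrank ℝ E)
  smooth : SmoothEnd f
  skew : ∀ (x : M) (v w : TangentSpace I x), g.inner x (f x v) w = - g.inner x v (f x w)
  neg_def : ∀ (x : M) (v : TangentSpace I x), v ≠ 0 → g.inner x (f x (f x v)) v < 0
  nearly : ∀ X Y : Π x : M, TangentSpace I x, SmoothField X → SmoothField Y → ∀ x,
    covEnd g f X Y x + covEnd g f Y X x = 0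

/-- The structure `(f, g)` of `M` restricts along `ι : L → M` to a weak nearly Kähler structure
`(f', g')` on `L` such that `∇'(f' ^ 2) = 0`, where `∇'` is the Levi-Civita connection of `g'`. -/
def InducesWeakNearlyKahler (g : Metric I M)
    (f : Π x : M, TangentSpace I x →L[ℝ] TangentSpace I x) {k : ℕ}
    {L : Type w} [TopologicalSpace L] [ChartedSpace (EuclideanSpace ℝ (Fin k)) L]
    [IsManifold (𝓡 k) ∞ L] (ι : L → M) : Prop :=
  ∃ (g' : Metric (𝓡 k) L)
    (f' : Π x : L, TangentSpace (𝓡 k) x →L[ℝ] TangentSpace (𝓡 k) x),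
    (∀ (x : L) (v w : TangentSpace (𝓡 k) x), g'.inner x v w =
      g.inner (ι x) (mfderiv (𝓡 k) I ι x v) (mfderiv (𝓡 k) I ι x w)) ∧
    (∀ (x : L) (v : TangentSpace (𝓡 k) x),
      mfderiv (𝓡 k) I ι x (f' x v) = f (ι x) (mfderiv (𝓡 k) I ι x v)) ∧
    IsWeakNearlyKahler g' f' ∧
    ∀ X Y : Π x : L, TangentSpace (𝓡 k) x, SmoothField X → SmoothField Y → ∀ x,
      covEnd g' (fun y => f' y ∘L f' y) X Y x = 0

end Foliations

section Structures

variable {E : Type*} [NormedAddCommGroup E] [NormedSpace ℝ E] [FiniteDimensional ℝ E]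
  {H : Type*} [TopologicalSpace H] {I : ModelWithCorners ℝ E H}
  {M : Type u} [TopologicalSpace M] [ChartedSpace H M] [IsManifold I ∞ M]

/-- A weak metric `f`-structure `(f, Q, ξ, η, g)` on a manifold of dimension `2n + s`. -/
structure WeakMetricFStructure (g : Metric I M) (n s : ℕ) where
  f : Π x : M, TangentSpace I x →L[ℝ] TangentSpace I x
  Q : Π x : M, TangentSpace I x →L[ℝ] TangentSpace I x
  ξ : Fin s → Π x : M, TangentSpace I x
  η : Fin s → Π x : M, TangentSpace I x →L[ℝ] ℝ
  n_pos : 0 < n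
  s_pos : 0 < s
  dim_eq : finrank ℝ E = 2 * n + s
  f_smooth : SmoothEnd f
  Q_smooth : SmoothEnd Q
  ξ_smooth : ∀ i, SmoothField (ξ i)
  η_smooth : ∀ i, SmoothForm (η i)
  f_skew : ∀ (x : M) (v w : TangentSpace I x), g.inner x (f x v) w = - g.inner x v (f x w)
  f_rank : ∀ x, finrank ℝ (f x).range = 2 * n
  Q_selfAdjoint : ∀ (x : M) (v w : TangentSpace I x), g.inner x (Q x v) w = g.inner x v (Q x w)
  Q_nonsingular : ∀ x, Function.Bijective (Q x)
  ξ_orthonormal : ∀ i j x, g.inner x (ξ i x) (ξ j x) = if i = j then 1 else 0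
  f_sq : ∀ (x : M) (v : TangentSpace I x), f x (f x v) = - Q x v + ∑ i, η i x v • ξ i x
  η_ξ : ∀ i j x, η i x (ξ j x) = if i = j then 1 else 0
  Q_ξ : ∀ i x, Q x (ξ i x) = ξ i x
  compat : ∀ (x : M) (v w : TangentSpace I x),
    g.inner x (f x v) (f x w) = g.inner x v (Q x w) - ∑ i, η i x v * η i x w

namespace WeakMetricFStructure

variable {g : Metric I M} {n s : ℕ} (S : WeakMetricFStructure g n s)

/-- The contact distribution `⋂ ker η^i`. -/
def contactDist (x : M) : Submodule ℝ (TangentSpace I x) := ⨅ i, (S.η i x).ker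

/-- The Reeb distribution `ker f`. -/
def reebDist (x : M) : Submodule ℝ (TangentSpace I x) := (S.f x).ker

/-- `Q - id`. -/
def Qt (x : M) : TangentSpace I x →L[ℝ] TangentSpace I x :=
  S.Q x - ContinuousLinearMap.id ℝ (TangentSpace I x)

/-- Weak nearly `C`-structures: the symmetric part of `∇f` vanishes. -/
def IsWeakNearlyC : Prop :=
  ∀ X Y : Π x : M, TangentSpace I x, SmoothField X → SmoothField Y → ∀ x,
    covEnd g S.f X Y x + covEnd g S.f Y X x = 0

/-- `[ξ_i, ξ_j] = 0`. -/
def ReebCommute : Prop := ∀ i j x, mlieBracket I (S.ξ i) (S.ξ j) x = 0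

/-- `g(∇_X ξ_i, ξ_j) = 0`. -/
def ReebConnectionFlat : Prop :=
  ∀ X : Π x : M, TangentSpace I x, SmoothField X → ∀ i j x,
    g.inner x (leviCivita g (S.ξ i) x (X x)) (S.ξ j x) = 0

/-- `(∇_X Q) Y = 0` for `Y` in the contact distribution. -/
def QParallelOnContact : Prop :=
  ∀ X Y : Π x : M, TangentSpace I x, SmoothField X → SmoothField Y →
    (∀ x, Y x ∈ S.contactDist x) → ∀ x, covEnd g S.Q X Y x = 0

/-- `R_{(Q - id) X, Y} Z` is in the contact distribution for `X, Y, Z` in the contact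
distribution. -/
def CurvatureCondition : Prop :=
  ∀ X Y Z : Π x : M, TangentSpace I x, SmoothField X → SmoothField Y → SmoothField Z →
    (∀ x, X x ∈ S.contactDist x) → (∀ x, Y x ∈ S.contactDist x) →
    (∀ x, Z x ∈ S.contactDist x) →
    ∀ x, curvature g (fun y => S.Qt y (X y)) Y Z x ∈ S.contactDist x

/-- The tensor `h_i = ∇ξ_i`. -/
def h (i : Fin s) (x : M) : TangentSpace I x →L[ℝ] TangentSpace I x := leviCivita g (S.ξ i) x

/-- `h_i ^ 2`. -/
def hSq (i : Fin s) (x : M) : Module.End ℝ (TangentSpace I x) :=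
  (S.h i x).toLinearMap ∘ₗ (S.h i x).toLinearMap

/-- `D_{i,j}`: the eigenvectors of `h_i ^ 2` with eigenvalue `μ = -λ_{i,j} ^ 2`. -/
def eigenDist (i : Fin s) (μ : ℝ) (x : M) : Submodule ℝ (TangentSpace I x) :=
  (S.hSq i x).eigenspace μ

/-- `D_{i,0}`: the eigenvectors of `h_i ^ 2` with eigenvalue `0` that are orthogonal to `ker f`. -/
def nullDist (i : Fin s) (x : M) : Submodule ℝ (TangentSpace I x) :=
  (S.hSq i x).eigenspace 0 ⊓ ⨅ w : S.reebDist x, (g.inner x w).ker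

/-- `ker dη^i`. -/
def kerDEta (i : Fin s) (x : M) : Submodule ℝ (TangentSpace I x) :=
  (extDerivForm (S.η i) (S.η_smooth i) x).ker

end WeakMetricFStructure

end Structures

end WeakNearlyC

end

open WeakNearlyC

/-! The first step is tensor algebra for $h_i=\nabla\xi_i$. Condition 3 gives $Qh_i=h_i$ and then
$\nabla Q=0$, so $f^2=-1$ on the image of every $h_i$. The nearly $\mathcal C$ identity gives
$\nabla_{\xi_i}f=fh_i$. Hence $h_i\xi_j=0$, $fh_i=-h_if$ and $h_i$ is skew.

A skew $f$ with $(\nabla_Xf)Y$ skew in $X,Y$ annihilates the curvature when it acts on it as a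
derivation (`RiemannianModule.curv_derivation`). Together with condition 4 this makes $R_{X,Y}Z$
orthogonal to the $\xi_i$ for $X,Y,Z\in\mathcal D$ (`WeakNearlyModule.curv_ξ`). The symmetries of
the curvature then yield $[h_i,h_j]=0$ and
$$(\nabla_Xh_i)Y=\sum_j\bigl(g(Y,h_ih_jX)\,\xi_j-g(Y,\xi_j)\,h_ih_jX\bigr)$$
(`WeakNearlyModule.h_comm`, `WeakNearlyModule.covDer_h`).

This formula says that $h_i$ is parallel for the metric connection $\nabla+\tau$, where
$$\tau_vw=\sum_j\bigl(g(w,h_jv)\,\xi_j-g(w,\xi_j)\,h_jv\bigr).$$ The orthogonal projection $P$ onto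
$\ker f=\mathrm{span}(\xi_j)$ is parallel too. Every distribution of the theorem is, near a given
point, the kernel of a self-adjoint tensor that is polynomial in $h_i^2$ and $P$, hence parallel.

A parallel tensor that vanishes at a point vanishes nearby. So if $A\,r(A)=0$ at $p$ for a
polynomial $r$ with $r(0)=1$, then near $p$ the tensor $r(A)$ is a parallel projection onto
$\Delta=\ker A$ (`IsParallel.exists_polynomial`). This gives smoothness and constant rank near $p$.
Moreover, for $X,Y$ tangent to $\Delta$, $$\nabla_XY=r(A)(\nabla_XY+\tau_XY)-\tau_XY,$$ which lies
in $\Delta$ once $\tau_\Delta\Delta\subset\Delta$. Thus $\Delta$ is involutive, Frobenius' theorem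
supplies integral manifolds, and they are totally geodesic. The invariance under $\tau$ holds
because the $h_j$ commute, provided $\ker f\subset\Delta$. For $\mathcal D_{i,0}$ alone, equality of
the kernels of the $d\eta^j$ makes $\tau$ vanish on it.

Finally $d\eta^i(v,w)=2g(h_iv,w)$, so $\ker d\eta^i=\ker h_i=\ker f\oplus\mathcal D_{i,0}$, and a
dimension count gives $\mathcal D_{i,0}\ne0$. On an integral manifold of $\mathcal D_{i,0}$ the
Gauss formula has no second fundamental form, so the nearly identity is inherited. There $f^2=-Q$,
and $\nabla Q=0$ yields $\bar\nabla(\bar f^{\,2})=0$. -/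

namespace WeakNearlyC

/-! ### Global extensions, orthonormal frames and tests for smoothness. -/

section SmoothTools

variable {E : Type*} [NormedAddCommGroup E] [NormedSpace ℝ E] [FiniteDimensional ℝ E]
  {M : Type*} [TopologicalSpace M] [ChartedSpace E M] [IsManifold 𝓘(ℝ, E) ∞ M]

section Extension

variable [T2Space M]

/-- A local vector field that is smooth near `p` agrees near `p` with a global smooth one. -/
theorem exists_smoothField_eventuallyEq {V : Π x : M, TangentSpace 𝓘(ℝ, E) x} {p : M}
    (hV : ∀ᶠ x in 𝓝 p, CMDiffAt ∞ (T% V) x) :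
    ∃ V' : Π x : M, TangentSpace 𝓘(ℝ, E) x, SmoothField V' ∧ ∀ᶠ x in 𝓝 p, V' x = V x := by
  -- Cut off by a bump function whose closed support lies in the set where $V$ is smooth.
  obtain ⟨f, -, hf⟩ := (SmoothBumpFunction.nhds_basis_tsupport (I := 𝓘(ℝ, E)) p).mem_iff.1 hV
  refine ⟨fun x => f x • V x, fun x => ?_, ?_⟩
  · by_cases hx : x ∈ tsupport f
    · have h1 : CMDiffAt ∞ (T% V) x := hf hx
      exact ContMDiffAt.smul_section f.contMDiffAt h1
    · have h0 : CMDiff ∞ (T% (fun x : M => (0 : TangentSpace 𝓘(ℝ, E) x))) :=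
        contMDiff_zeroSection ℝ (TangentSpace 𝓘(ℝ, E))
      refine (h0 x).congr_of_eventuallyEq ?_
      filter_upwards [(isClosed_tsupport f).isOpen_compl.mem_nhds hx] with y hy
      simp [image_eq_zero_of_notMem_tsupport hy]
  · filter_upwards [f.eventuallyEq_one] with x hx
    simp [hx]

/-- A function that is smooth near `p` agrees near `p` with a global smooth one. -/
theorem exists_contMDiff_eventuallyEq {F : Type*} [NormedAddCommGroup F] [NormedSpace ℝ F]
    {c : M → F} {p : M} (hc : ∀ᶠ x in 𝓝 p, CMDiffAt ∞ c x) :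
    ∃ c' : M → F, CMDiff ∞ c' ∧ ∀ᶠ x in 𝓝 p, c' x = c x := by
  obtain ⟨f, -, hf⟩ := (SmoothBumpFunction.nhds_basis_tsupport (I := 𝓘(ℝ, E)) p).mem_iff.1 hc
  refine ⟨fun x => f x • c x, fun x => ?_, ?_⟩
  · by_cases hx : x ∈ tsupport f
    · exact (f.contMDiff x).smul (hf hx)
    · refine (contMDiff_const (c := (0 : F)) x).congr_of_eventuallyEq ?_
      filter_upwards [(isClosed_tsupport f).isOpen_compl.mem_nhds hx] with y hy
      simp [image_eq_zero_of_notMem_tsupport hy]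
  · filter_upwards [f.eventuallyEq_one] with x hx
    simp [hx]

/-- Every tangent vector is the value of a global smooth vector field. -/
theorem exists_smooth_extension {p : M} (v : TangentSpace 𝓘(ℝ, E) p) :
    ∃ V : Π x : M, TangentSpace 𝓘(ℝ, E) x, SmoothField V ∧ V p = v := by
  obtain ⟨V, hV, h⟩ := exists_smoothField_eventuallyEq (V := FiberBundle.extend E v) (p := p) (by
    obtain ⟨U, hU, h⟩ := FiberBundle.exists_contMDiffOn_extend (I := 𝓘(ℝ, E)) (k := ∞) E v
    filter_upwards [eventually_mem_nhds_iff.2 hU] with x hx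
    exact h.contMDiffAt hx)
  exact ⟨V, hV, by rw [h.self_of_nhds, FiberBundle.extend_apply_self]⟩

end Extension

theorem metric_contMDiffAt (g : Metric 𝓘(ℝ, E) M) {Y Z : Π x : M, TangentSpace 𝓘(ℝ, E) x} {x : M}
    (hY : CMDiffAt ∞ (T% Y) x) (hZ : CMDiffAt ∞ (T% Z) x) :
    CMDiffAt ∞ (fun y => g.inner y (Y y) (Z y)) x := by
  have : ContMDiffAt 𝓘(ℝ, E) (𝓘(ℝ, E).prod 𝓘(ℝ)) ∞
      (fun m ↦ TotalSpace.mk' ℝ (E := Bundle.Trivial M ℝ) m (g.inner m (Y m) (Z m))) x := by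
    apply ContMDiffAt.clm_bundle_apply₂ (F₁ := E) (F₂ := E)
    · exact g.contMDiff.contMDiffAt
    · exact hY
    · exact hZ
  rw [contMDiffAt_totalSpace] at this
  exact this.2

theorem SmoothField.mdiffAt {X : Π x : M, TangentSpace 𝓘(ℝ, E) x} (hX : SmoothField X) {x : M} :
    MDiffAt (T% X) x := ContMDiff.mdifferentiableAt hX (by simp)

theorem SmoothField.inner (g : Metric 𝓘(ℝ, E) M) {Y Z : Π x : M, TangentSpace 𝓘(ℝ, E) x}
    (hY : SmoothField Y) (hZ : SmoothField Z) : CMDiff ∞ (fun y => g.inner y (Y y) (Z y)) :=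
  fun x => metric_contMDiffAt g (hY x) (hZ x)

theorem SmoothField.add {Y Z : Π x : M, TangentSpace 𝓘(ℝ, E) x}
    (hY : SmoothField Y) (hZ : SmoothField Z) : SmoothField (fun x => Y x + Z x) :=
  ContMDiff.add_section hY hZ

theorem SmoothField.sub {Y Z : Π x : M, TangentSpace 𝓘(ℝ, E) x}
    (hY : SmoothField Y) (hZ : SmoothField Z) : SmoothField (fun x => Y x - Z x) :=
  ContMDiff.sub_section hY hZ

theorem SmoothField.smul {c : M → ℝ} {Y : Π x : M, TangentSpace 𝓘(ℝ, E) x}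
    (hc : CMDiff ∞ c) (hY : SmoothField Y) : SmoothField (fun x => c x • Y x) :=
  ContMDiff.smul_section hc hY

theorem SmoothField.sum {ι : Type*} {s : Finset ι} {Y : ι → Π x : M, TangentSpace 𝓘(ℝ, E) x}
    (hY : ∀ i, SmoothField (Y i)) : SmoothField (fun x => ∑ i ∈ s, Y i x) :=
  ContMDiff.sum_section fun i _ => hY i

theorem metric_self_pos (g : Metric 𝓘(ℝ, E) M) {x : M} {v : TangentSpace 𝓘(ℝ, E) x} (hv : v ≠ 0) :
    0 < g.inner x v v := g.pos x v hv

theorem metric_ext (g : Metric 𝓘(ℝ, E) M) {x : M} {v w : TangentSpace 𝓘(ℝ, E) x}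
    (h : ∀ z, g.inner x v z = g.inner x w z) : v = w := by
  by_contra hne
  have h1 := g.pos x (v - w) (sub_ne_zero.2 hne)
  have h2 := h (v - w)
  simp only [map_sub, sub_apply] at h1 h2
  linarith

/-- The fields `e` are orthonormal at `x`. -/
def OrthonormalAt (g : Metric 𝓘(ℝ, E) M) {k : ℕ} (e : Fin k → Π x : M, TangentSpace 𝓘(ℝ, E) x)
    (x : M) : Prop := ∀ a b, g.inner x (e a x) (e b x) = if a = b then 1 else 0

theorem OrthonormalAt.inner_sum {g : Metric 𝓘(ℝ, E) M} {k : ℕ}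
    {e : Fin k → Π x : M, TangentSpace 𝓘(ℝ, E) x} {x : M} (he : OrthonormalAt g e x)
    (c : Fin k → ℝ) (b : Fin k) : g.inner x (∑ a, c a • e a x) (e b x) = c b := by
  simp [map_sum, he _ b]

theorem OrthonormalAt.linearIndependent {g : Metric 𝓘(ℝ, E) M} {k : ℕ}
    {e : Fin k → Π x : M, TangentSpace 𝓘(ℝ, E) x} {x : M} (he : OrthonormalAt g e x) :
    LinearIndependent ℝ (fun a => e a x) := by
  rw [Fintype.linearIndependent_iff]
  intro c hc b
  rw [← he.inner_sum c b, hc]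
  simp

theorem OrthonormalAt.span_eq_top {g : Metric 𝓘(ℝ, E) M}
    {e : Fin (finrank ℝ E) → Π x : M, TangentSpace 𝓘(ℝ, E) x} {x : M} (he : OrthonormalAt g e x) :
    Submodule.span ℝ (Set.range fun a => e a x) = ⊤ := by
  have : FiniteDimensional ℝ (TangentSpace 𝓘(ℝ, E) x) := inferInstanceAs (FiniteDimensional ℝ E)
  refine he.linearIndependent.span_eq_top_of_card_eq_finrank' ?_
  rw [Fintype.card_fin]
  rfl

theorem OrthonormalAt.sum_eq {g : Metric 𝓘(ℝ, E) M}
    {e : Fin (finrank ℝ E) → Π x : M, TangentSpace 𝓘(ℝ, E) x} {x : M} (he : OrthonormalAt g e x)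
    (v : TangentSpace 𝓘(ℝ, E) x) : v = ∑ a, g.inner x v (e a x) • e a x := by
  have hv : v ∈ Submodule.span ℝ (Set.range fun a => e a x) := by rw [he.span_eq_top]; trivial
  obtain ⟨c, rfl⟩ := (Submodule.mem_span_range_iff_exists_fun ℝ).1 hv
  exact Finset.sum_congr rfl fun a _ => by rw [he.inner_sum]

/-- Local smooth orthonormal frames exist. -/
theorem exists_orthonormal_fields [T2Space M] (g : Metric 𝓘(ℝ, E) M) (p : M) :
    ∀ k ≤ finrank ℝ E, ∃ e : Fin k → Π x : M, TangentSpace 𝓘(ℝ, E) x,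
      (∀ a, SmoothField (e a)) ∧ ∀ᶠ x in 𝓝 p, OrthonormalAt g e x := by
  have : FiniteDimensional ℝ (TangentSpace 𝓘(ℝ, E) p) := inferInstanceAs (FiniteDimensional ℝ E)
  intro k
  induction k with
  | zero => exact fun _ => ⟨fun a => a.elim0, fun a => a.elim0, .of_forall fun x a => a.elim0⟩
  | succ k ih =>
    intro hk
    obtain ⟨e, he, ho⟩ := ih (by omega)
    obtain ⟨w, hw⟩ : ∃ w, w ∉ Submodule.span ℝ (Set.range fun a => e a p) := by
      by_contra! h
      have h1 : Submodule.span ℝ (Set.range fun a => e a p) = ⊤ := by ext; simp [h]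
      have h2 := finrank_range_le_card (R := ℝ) (fun a => e a p)
      rw [Set.finrank, h1, finrank_top, Fintype.card_fin] at h2
      change finrank ℝ E ≤ k at h2
      omega
    obtain ⟨W, hW, rfl⟩ := exists_smooth_extension w
    -- Gram–Schmidt step; $V(p)\ne0$ because $W(p)$ lies outside the span of the fields already
    -- found.
    set V : Π x : M, TangentSpace 𝓘(ℝ, E) x :=
      fun x => W x - ∑ a, g.inner x (W x) (e a x) • e a x with hVdef
    have hV : SmoothField V := hW.sub (SmoothField.sum fun a => .smul (hW.inner g (he a)) (he a))
    have hVp : V p ≠ 0 := by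
      intro h
      refine hw ?_
      rw [hVdef, sub_eq_zero] at h
      rw [h]
      exact Submodule.sum_mem _ fun a _ => Submodule.smul_mem _ _
        (Submodule.subset_span ⟨a, rfl⟩)
    have hpos : ∀ᶠ x in 𝓝 p, 0 < g.inner x (V x) (V x) :=
      (hV.inner g hV).continuous.continuousAt.eventually (lt_mem_nhds (g.pos p _ hVp))
    -- The normalization is smooth only where $V\ne0$, so it is replaced by a global field with the
    -- same germ at $p$.
    obtain ⟨U, hU, hUV⟩ := exists_smoothField_eventuallyEq (p := p)
      (V := fun x => (Real.sqrt (g.inner x (V x) (V x)))⁻¹ • V x) (by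
        filter_upwards [hpos] with x hx
        have h1 : CMDiffAt ∞ (fun x => (Real.sqrt (g.inner x (V x) (V x)))⁻¹) x := by
          have h2 : ContDiffAt ℝ ∞ (fun t => (Real.sqrt t)⁻¹) (g.inner x (V x) (V x)) :=
            (Real.contDiffAt_sqrt hx.ne').inv (Real.sqrt_pos.2 hx).ne'
          exact ContMDiffAt.comp (g := fun t => (Real.sqrt t)⁻¹) x h2.contMDiffAt
            (hV.inner g hV x)
        exact ContMDiffAt.smul_section h1 (hV x))
    refine ⟨Fin.snoc (α := fun _ => Π x : M, TangentSpace 𝓘(ℝ, E) x) e U, fun a => ?_, ?_⟩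
    · refine Fin.lastCases ?_ (fun a => ?_) a
      · simpa using hU
      · simpa using he a
    · filter_upwards [ho, hpos, hUV] with x hx hxp hxU
      have h1 : ∀ b, g.inner x (U x) (e b x) = 0 := by
        intro b
        have h3 : g.inner x (V x) (e b x) = 0 := by
          simp only [hVdef, map_sub, sub_apply, hx.inner_sum, sub_self]
        rw [hxU, map_smul, smul_apply, h3, smul_zero]
      have h2 : g.inner x (U x) (U x) = 1 := by
        rw [hxU]
        simp only [map_smul, smul_apply, smul_eq_mul]
        have := Real.mul_self_sqrt hxp.le
        have h3 := (Real.sqrt_pos.2 hxp).ne'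
        field_simp
        linarith
      intro a b
      refine Fin.lastCases ?_ (fun a => ?_) a <;> refine Fin.lastCases ?_ (fun b => ?_) b
      · simp [h2]
      · simp [h1, (Fin.castSucc_lt_last b).ne']
      · simp [g.symm x _ (U x), h1, (Fin.castSucc_lt_last a).ne]
      · simpa using hx a b

theorem exists_orthonormal_frame [T2Space M] (g : Metric 𝓘(ℝ, E) M) (p : M) :
    ∃ e : Fin (finrank ℝ E) → Π x : M, TangentSpace 𝓘(ℝ, E) x,
      (∀ a, SmoothField (e a)) ∧ ∀ᶠ x in 𝓝 p, OrthonormalAt g e x :=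
  exists_orthonormal_fields g p _ le_rfl

/-- A vector field is smooth if its inner products with smooth fields are smooth. -/
theorem SmoothField.of_inner [T2Space M] (g : Metric 𝓘(ℝ, E) M) {V : Π x : M, TangentSpace 𝓘(ℝ, E) x}
    (h : ∀ Z : Π x : M, TangentSpace 𝓘(ℝ, E) x, SmoothField Z →
      CMDiff ∞ (fun y => g.inner y (V y) (Z y))) : SmoothField V := by
  intro p
  obtain ⟨e, he, ho⟩ := exists_orthonormal_frame g p
  have h1 : SmoothField (fun x => ∑ a, g.inner x (V x) (e a x) • e a x) :=
    SmoothField.sum fun a => .smul (h _ (he a)) (he a)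
  refine (h1 p).congr_of_eventuallyEq ?_
  filter_upwards [ho] with x hx
  rw [← hx.sum_eq]

/-- A section of a bundle of homomorphisms out of the tangent bundle is smooth if it maps smooth
vector fields to smooth sections. -/
theorem contMDiff_hom_of_apply [T2Space M] {F : Type*} [NormedAddCommGroup F] [NormedSpace ℝ F]
    {V : M → Type*} [TopologicalSpace (TotalSpace F V)] [∀ x, AddCommGroup (V x)]
    [∀ x, Module ℝ (V x)] [∀ x, TopologicalSpace (V x)] [∀ x, IsTopologicalAddGroup (V x)]
    [∀ x, ContinuousSMul ℝ (V x)] [FiberBundle F V] [VectorBundle ℝ F V]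
    [ContMDiffVectorBundle ∞ F V 𝓘(ℝ, E)]
    (A : Π x : M, TangentSpace 𝓘(ℝ, E) x →L[ℝ] V x)
    (h : ∀ X : Π x : M, TangentSpace 𝓘(ℝ, E) x, SmoothField X →
      ContMDiff 𝓘(ℝ, E) (𝓘(ℝ, E).prod 𝓘(ℝ, F)) ∞ (fun x => TotalSpace.mk' F x (A x (X x)))) :
    ContMDiff 𝓘(ℝ, E) (𝓘(ℝ, E).prod 𝓘(ℝ, E →L[ℝ] F)) ∞
      (fun x => TotalSpace.mk' (E →L[ℝ] F) (E := fun x : M => TangentSpace 𝓘(ℝ, E) x →L[ℝ] V x)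
        x (A x)) := by
  intro p
  rw [contMDiffAt_hom_bundle]
  refine ⟨contMDiffAt_id, ?_⟩
  set t := trivializationAt E (TangentSpace 𝓘(ℝ, E)) p
  set t' := trivializationAt F V p
  have hb : ∀ v : E, ContMDiffAt 𝓘(ℝ, E) 𝓘(ℝ, F) ∞ (fun x =>
      ContinuousLinearMap.inCoordinates E (TangentSpace 𝓘(ℝ, E)) F V p x p x (A x) v) p := by
    intro v
    -- The field with constant coordinates $v$ in the trivialization at $p$, made global so that the
    -- hypothesis applies to it.
    obtain ⟨X, hX, hXe⟩ := exists_smoothField_eventuallyEq (p := p)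
      (V := fun x => t.symm x v) (by
        filter_upwards [t.open_baseSet.mem_nhds (FiberBundle.mem_baseSet_trivializationAt' p)]
          with x hx
        rw [Trivialization.contMDiffAt_section_iff _ hx]
        refine (contMDiffAt_const (c := v)).congr_of_eventuallyEq ?_
        filter_upwards [t.open_baseSet.mem_nhds hx] with y hy
        simp [Trivialization.apply_mk_symm _ hy])
    have h1 := (contMDiffAt_totalSpace.1 (h X hX p)).2
    refine h1.congr_of_eventuallyEq ?_
    filter_upwards [hXe, t.open_baseSet.mem_nhds (FiberBundle.mem_baseSet_trivializationAt' p),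
      t'.open_baseSet.mem_nhds (FiberBundle.mem_baseSet_trivializationAt' p)] with x hx hx1 hx2
    rw [ContinuousLinearMap.inCoordinates_eq hx1 hx2]
    simp [hx, t, t']
  -- In finite dimension an operator-valued map is smooth as soon as its values on a basis are.
  let b := Module.finBasis ℝ E
  have h2 : ∀ x, ContinuousLinearMap.inCoordinates E (TangentSpace 𝓘(ℝ, E)) F V p x p x (A x) =
      ∑ i, ContinuousLinearMap.smulRightL ℝ E F (LinearMap.toContinuousLinearMap (b.coord i))
        (ContinuousLinearMap.inCoordinates E (TangentSpace 𝓘(ℝ, E)) F V p x p x (A x) (b i)) := by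
    intro x
    ext v
    conv_lhs => rw [← b.sum_repr v, map_sum]
    simp [-Basis.sum_repr]
  refine ContMDiffAt.congr_of_eventuallyEq (f := fun x => ∑ i, ContinuousLinearMap.smulRightL ℝ E F
    (LinearMap.toContinuousLinearMap (b.coord i))
      (ContinuousLinearMap.inCoordinates E (TangentSpace 𝓘(ℝ, E)) F V p x p x (A x) (b i))) ?_
    (.of_forall h2)
  exact ContMDiffAt.sum fun i _ => ContMDiffAt.comp (g := ContinuousLinearMap.smulRightL ℝ E F
    (LinearMap.toContinuousLinearMap (b.coord i))) p
    (ContinuousLinearMap.contMDiff _).contMDiffAt (hb (b i))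

end SmoothTools

/-! ### Brackets as commutators and smoothness of the Levi-Civita connection. -/

section SmoothTools

variable {E : Type*} [NormedAddCommGroup E] [NormedSpace ℝ E] [FiniteDimensional ℝ E]
  {M : Type*} [TopologicalSpace M] [ChartedSpace E M] [IsManifold 𝓘(ℝ, E) ∞ M]

/-- Vector fields act on functions by derivations, and their bracket by the commutator. -/
theorem mvfderiv_mlieBracket {F : Type*} [NormedAddCommGroup F] [NormedSpace ℝ F]
    {φ : M → F} {X Y : Π x : M, TangentSpace 𝓘(ℝ, E) x} {x : M}
    (hφ : CMDiffAt 2 φ x) (hX : MDiffAt (T% X) x) (hY : MDiffAt (T% Y) x) :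
    d% φ x (mlieBracket 𝓘(ℝ, E) X Y x) =
      d% (fun y => d% φ y (Y y)) x (X x) - d% (fun y => d% φ y (X y)) x (Y x) := by
  set c := extChartAt 𝓘(ℝ, E) x with hc
  set ψ : E → F := φ ∘ c.symm with hψ
  set pb : (Π x : M, TangentSpace 𝓘(ℝ, E) x) → E → E :=
    fun Z => mpullbackWithin 𝓘(ℝ, E) 𝓘(ℝ, E) c.symm Z (Set.range 𝓘(ℝ, E)) with hpb
  have hψ2 : ContDiffAt ℝ 2 ψ (c x) := by
    have h1 := ((contMDiffAt_iff_source (I := 𝓘(ℝ, E)) (I' := 𝓘(ℝ, F)) (f := φ) (x := x)).1 hφ)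
    rw [modelWithCornersSelf_coe, Set.range_id, contMDiffWithinAt_univ] at h1
    exact ContMDiffAt.contDiffAt h1
  have hφe : ∀ᶠ y in 𝓝 x, CMDiffAt 2 φ y := (contMDiffAt_iff_contMDiffAt_nhds (by simp)).1 hφ
  have hcont : ContinuousAt c.symm (c x) := continuousAt_extChartAt_symm x
  have hev : ∀ᶠ z in 𝓝 (c x), z ∈ c.target ∧ CMDiffAt 2 φ (c.symm z) := by
    refine Filter.Eventually.and (extChartAt_target_mem_nhds x) ?_
    rw [ContinuousAt, hc, extChartAt_to_inv x] at hcont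
    exact hcont.eventually hφe
  -- Deriving $\varphi$ along $Z$ is, in the chart, deriving $\psi$ along the pulled-back field; the
  -- claim thus reduces to its version in the vector space $E$.
  have key : ∀ Z : Π x : M, TangentSpace 𝓘(ℝ, E) x, ∀ z ∈ c.target, CMDiffAt 2 φ (c.symm z) →
      d% φ (c.symm z) (Z (c.symm z)) = fderiv ℝ ψ z (pb Z z) := by
    intro Z z hz hφz
    have hinv := isInvertible_mfderivWithin_extChartAt_symm (I := 𝓘(ℝ, E)) hz
    have h1 : fderiv ℝ ψ z = (d% φ (c.symm z)).comp
        (mfderivWithin 𝓘(ℝ, E) 𝓘(ℝ, E) c.symm (Set.range 𝓘(ℝ, E)) z) := by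
      have h2 := mfderiv_comp_mfderivWithin (I := 𝓘(ℝ, E)) (I' := 𝓘(ℝ, E)) (I'' := 𝓘(ℝ, F)) z
        (hφz.mdifferentiableAt two_ne_zero)
        (mdifferentiableWithinAt_extChartAt_symm hz) (by simp [UniqueMDiffWithinAt])
      simp only [modelWithCornersSelf_coe, Set.range_id, mfderivWithin_univ, mfderiv_eq_fderiv] at h2 ⊢
      exact h2
    rw [h1]
    exact congrArg (d% φ (c.symm z)) (hinv.self_apply_inverse (Z (c.symm z))).symm
  have hsymm : c.symm (c x) = x := extChartAt_to_inv x
  have hpbd : ∀ Z : Π x : M, TangentSpace 𝓘(ℝ, E) x, MDiffAt (T% Z) x →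
      DifferentiableAt ℝ (pb Z) (c x) := by
    intro Z hZ
    have h1 : DifferentiableWithinAt ℝ (pb Z) (c.symm ⁻¹' Set.univ ∩ Set.range 𝓘(ℝ, E)) (c x) :=
      MDifferentiableWithinAt.differentiableWithinAt_mpullbackWithin_vectorField
      (V := Z) (s := Set.univ) (x := x) (mdifferentiableWithinAt_univ.2 hZ)
    rw [Set.preimage_univ, Set.univ_inter, modelWithCornersSelf_coe, Set.range_id,
      differentiableWithinAt_univ] at h1
    exact h1
  have hψd : DifferentiableAt ℝ (fderiv ℝ ψ) (c x) :=
    (hψ2.fderiv_right (m := 1) (by norm_num)).differentiableAt one_ne_zero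
  have hcd : MDiffAt c x := mdifferentiableAt_extChartAt (mem_chart_source E x)
  have hd : ∀ Z : Π x : M, TangentSpace 𝓘(ℝ, E) x, MDiffAt (T% Z) x → ∀ v,
      d% (fun y => d% φ y (Z y)) x v =
        fderiv ℝ (fun z => fderiv ℝ ψ z (pb Z z)) (c x) (mfderiv 𝓘(ℝ, E) 𝓘(ℝ, E) c x v) := by
    intro Z hZ v
    have hG : DifferentiableAt ℝ (fun z => fderiv ℝ ψ z (pb Z z)) (c x) :=
      hψd.clm_apply (hpbd Z hZ)
    have h1 : (fun y => d% φ y (Z y)) =ᶠ[𝓝 x] (fun z => fderiv ℝ ψ z (pb Z z)) ∘ c := by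
      have h2 := (continuousAt_extChartAt (I := 𝓘(ℝ, E)) x).eventually hev
      filter_upwards [h2, extChartAt_source_mem_nhds (I := 𝓘(ℝ, E)) x] with y hy hys
      have h3 := key Z (c y) hy.1 hy.2
      rw [c.left_inv hys] at h3
      exact h3
    rw [mvfderiv, h1.mfderiv_eq]
    have h2 := mfderiv_comp_apply (I := 𝓘(ℝ, E)) (I' := 𝓘(ℝ, E)) (I'' := 𝓘(ℝ, F)) x
      hG.mdifferentiableAt hcd v
    rw [mfderiv_eq_fderiv] at h2
    exact h2
  have hd1 : ∀ v, d% φ x v = fderiv ℝ ψ (c x) (mfderiv 𝓘(ℝ, E) 𝓘(ℝ, E) c x v) := by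
    intro v
    have h1 : φ =ᶠ[𝓝 x] ψ ∘ c := by
      filter_upwards [extChartAt_source_mem_nhds (I := 𝓘(ℝ, E)) x] with y hys
      exact congrArg φ (c.left_inv hys).symm
    rw [mvfderiv, h1.mfderiv_eq]
    have h2 := mfderiv_comp_apply (I := 𝓘(ℝ, E)) (I' := 𝓘(ℝ, E)) (I'' := 𝓘(ℝ, F)) x
      (hψ2.differentiableAt two_ne_zero).mdifferentiableAt hcd v
    rw [mfderiv_eq_fderiv] at h2
    exact h2
  have hinv := isInvertible_mfderiv_extChartAt (I := 𝓘(ℝ, E)) (mem_extChartAt_source (I := 𝓘(ℝ, E)) x)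
  have hpbx : ∀ Z : Π x : M, TangentSpace 𝓘(ℝ, E) x,
      mfderiv 𝓘(ℝ, E) 𝓘(ℝ, E) c x (Z x) = pb Z (c x) := by
    intro Z
    have h1 : (mfderiv 𝓘(ℝ, E) 𝓘(ℝ, E) c x).inverse (pb Z (c x)) = Z x :=
      (mfderiv_extChartAt_inverse_comp_mfderivWithin_extChartAT_symm (I := 𝓘(ℝ, E)) (x := x)
        (Z (c.symm (c x)))).trans (by rw [hsymm])
    rw [← h1]
    exact hinv.self_apply_inverse _
  have hbr : mfderiv 𝓘(ℝ, E) 𝓘(ℝ, E) c x (mlieBracket 𝓘(ℝ, E) X Y x) =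
      lieBracket ℝ (pb X) (pb Y) (c x) := by
    refine (hinv.self_apply_inverse _).trans ?_
    change lieBracketWithin ℝ (pb X) (pb Y) (c.symm ⁻¹' Set.univ ∩ Set.range 𝓘(ℝ, E)) (c x) = _
    rw [Set.preimage_univ, Set.univ_inter, modelWithCornersSelf_coe, Set.range_id,
      lieBracketWithin_univ]
  rw [hd1, hbr, hd Y hY, hd X hX, hpbx, hpbx]
  exact fderiv_apply_lieBracket hψ2 (by simp) (hpbd Y hY) (hpbd X hX)

section LeviCivita

variable (g : Metric 𝓘(ℝ, E) M)

theorem contMDiff_mvfderiv_apply {F : Type*} [NormedAddCommGroup F] [NormedSpace ℝ F]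
    {φ : M → F} {X : Π x : M, TangentSpace 𝓘(ℝ, E) x}
    (hφ : CMDiff ∞ φ) (hX : SmoothField X) : CMDiff ∞ (fun y => d% φ y (X y)) := by
  have h1 := ((hφ.contMDiff_tangentMap (m := ∞) (by simp)).comp hX)
  exact (contMDiff_snd_tangentBundle_modelSpace F 𝓘(ℝ, F)).comp h1

theorem SmoothField.mlieBracket {X Y : Π x : M, TangentSpace 𝓘(ℝ, E) x}
    (hX : SmoothField X) (hY : SmoothField Y) : SmoothField (mlieBracket 𝓘(ℝ, E) X Y) := by
  have : IsManifold 𝓘(ℝ, E) (minSmoothness ℝ 2) M := by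
    rw [minSmoothness_of_isRCLikeNormedField]; infer_instance
  have : IsManifold 𝓘(ℝ, E) (∞ + 1) M := inferInstanceAs (IsManifold 𝓘(ℝ, E) ∞ M)
  intro x
  exact ContMDiffAt.mlieBracket_vectorField (n := ⊤) (m := ⊤) (hX x) (hY x) (by simp)

/-- By Koszul's formula the inner products of $\nabla_XY$ with smooth fields are smooth functions.
-/
theorem SmoothField.leviCivita [T2Space M] {X Y : Π x : M, TangentSpace 𝓘(ℝ, E) x}
    (hX : SmoothField X) (hY : SmoothField Y) :
    SmoothField (fun x => leviCivita g Y x (X x)) := by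
  refine .of_inner g fun Z hZ => ?_
  have h : (fun y => g.inner y (WeakNearlyC.leviCivita g Y y (X y)) (Z y)) =
      fun y => (1 / 2 : ℝ) * koszul g X Y Z y := by
    ext y
    rw [← leviCivita_koszul g hX.mdiffAt hY.mdiffAt hZ.mdiffAt]
    ring
  rw [h]
  refine contMDiff_const.mul ?_
  change CMDiff ∞ (fun y => koszul g X Y Z y)
  simp only [koszul]
  exact (((((contMDiff_mvfderiv_apply (hY.inner g hZ) hX).add
    (contMDiff_mvfderiv_apply (hX.inner g hZ) hY)).sub
    (contMDiff_mvfderiv_apply (hX.inner g hY) hZ)).add ((hX.mlieBracket hY).inner g hZ)).sub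
    ((hX.mlieBracket hZ).inner g hY)).sub ((hY.mlieBracket hZ).inner g hX)

end LeviCivita

end SmoothTools

/-! ### Riemannian geometry as algebra over the ring of functions. -/

/-- The module of vector fields over the ring of functions, with a metric and its Levi-Civita
connection, seen algebraically. -/
structure RiemannianModule (C Γ : Type*) [CommRing C] [Algebra ℝ C] [AddCommGroup Γ]
    [Module C Γ] where
  nab : Γ → Γ → Γ
  G : Γ → Γ → C
  D : Γ → C → C
  nab_add_left : ∀ X X' Y, nab (X + X') Y = nab X Y + nab X' Y
  nab_smul_left : ∀ (c : C) X Y, nab (c • X) Y = c • nab X Y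
  nab_add_right : ∀ X Y Y', nab X (Y + Y') = nab X Y + nab X Y'
  nab_smul_right : ∀ X (c : C) Y, nab X (c • Y) = c • nab X Y + D X c • Y
  G_symm : ∀ X Y, G X Y = G Y X
  G_add_left : ∀ X X' Y, G (X + X') Y = G X Y + G X' Y
  G_smul_left : ∀ (c : C) X Y, G (c • X) Y = c * G X Y
  G_self : ∀ X, G X X = 0 → X = 0
  D_add : ∀ X c c', D X (c + c') = D X c + D X c'
  D_metric : ∀ X Y Z, D X (G Y Z) = G (nab X Y) Z + G Y (nab X Z)
  D_bracket : ∀ X Y c, D (nab X Y - nab Y X) c = D X (D Y c) - D Y (D X c)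
  jacobi : ∀ X Y Z, nab X (nab Y Z - nab Z Y) - nab (nab Y Z - nab Z Y) X =
    nab (nab X Y - nab Y X) Z - nab Z (nab X Y - nab Y X) +
      (nab Y (nab X Z - nab Z X) - nab (nab X Z - nab Z X) Y)

namespace RiemannianModule

variable {C Γ : Type*} [CommRing C] [Algebra ℝ C] [AddCommGroup Γ] [Module C Γ]
  (R : RiemannianModule C Γ)

/-- The ring of functions is an $\mathbb R$-algebra, so 2 and 3 can be cancelled although it has
zero divisors. -/
theorem eq_zero_of_two_mul {c : C} (h : 2 * c = 0) : c = 0 := by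
  have h2 : algebraMap ℝ C 2 = 2 := map_ofNat _ 2
  have h1 : c = algebraMap ℝ C (1 / 2) * (2 * c) := by
    rw [← h2, ← mul_assoc, ← map_mul]; norm_num
  rw [h1, h, mul_zero]

theorem eq_zero_of_three_mul {c : C} (h : 3 * c = 0) : c = 0 := by
  have h2 : algebraMap ℝ C 3 = 3 := map_ofNat _ 3
  have h1 : c = algebraMap ℝ C (1 / 3) * (3 * c) := by
    rw [← h2, ← mul_assoc, ← map_mul]; norm_num
  rw [h1, h, mul_zero]

/-- `∇_X` as an additive map. -/
def nabHom (X : Γ) : Γ →+ Γ := AddMonoidHom.mk' (R.nab X) (R.nab_add_right X)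

/-- `X ↦ ∇_X Y` as a linear map. -/
def nabLin (Y : Γ) : Γ →ₗ[C] Γ where
  toFun X := R.nab X Y
  map_add' X X' := R.nab_add_left X X' Y
  map_smul' c X := R.nab_smul_left c X Y

theorem nab_neg_right (X Y : Γ) : R.nab X (-Y) = - R.nab X Y := (R.nabHom X).map_neg Y
theorem nab_sub_right (X Y Z : Γ) : R.nab X (Y - Z) = R.nab X Y - R.nab X Z :=
  (R.nabHom X).map_sub Y Z
theorem nab_zero_right (X : Γ) : R.nab X 0 = 0 := (R.nabHom X).map_zero
theorem nab_sub_left (X Y Z : Γ) : R.nab (X - Y) Z = R.nab X Z - R.nab Y Z :=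
  (R.nabLin Z).map_sub X Y
theorem nab_zero_left (Y : Γ) : R.nab 0 Y = 0 := (R.nabLin Y).map_zero

/-- The metric as a linear map in the first variable. -/
def GLin (Y : Γ) : Γ →ₗ[C] C where
  toFun X := R.G X Y
  map_add' X X' := R.G_add_left X X' Y
  map_smul' c X := R.G_smul_left c X Y

theorem G_neg_left (X Y : Γ) : R.G (-X) Y = - R.G X Y := (R.GLin Y).map_neg X
theorem G_sub_left (X Y Z : Γ) : R.G (X - Y) Z = R.G X Z - R.G Y Z := (R.GLin Z).map_sub X Y
theorem G_zero_left (Y : Γ) : R.G 0 Y = 0 := (R.GLin Y).map_zero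
theorem G_sum_left {ι : Type*} (s : Finset ι) (X : ι → Γ) (Y : Γ) :
    R.G (∑ i ∈ s, X i) Y = ∑ i ∈ s, R.G (X i) Y := map_sum (R.GLin Y) X s
theorem G_add_right (X Y Z : Γ) : R.G X (Y + Z) = R.G X Y + R.G X Z := by
  rw [R.G_symm, R.G_add_left, R.G_symm Y, R.G_symm Z]
theorem G_neg_right (X Y : Γ) : R.G X (-Y) = - R.G X Y := by
  rw [R.G_symm, R.G_neg_left, R.G_symm Y]
theorem G_sub_right (X Y Z : Γ) : R.G X (Y - Z) = R.G X Y - R.G X Z := by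
  rw [R.G_symm, R.G_sub_left, R.G_symm Y, R.G_symm Z]
theorem G_zero_right (X : Γ) : R.G X 0 = 0 := by rw [R.G_symm, R.G_zero_left]
theorem G_smul_right (c : C) (X Y : Γ) : R.G X (c • Y) = c * R.G X Y := by
  rw [R.G_symm, R.G_smul_left, R.G_symm Y]

theorem G_ext {X Y : Γ} (h : ∀ Z, R.G X Z = R.G Y Z) : X = Y :=
  sub_eq_zero.1 (R.G_self _ (by rw [R.G_sub_left, h, sub_self]))

/-- `D X` as an additive map. -/
def DHom (X : Γ) : C →+ C := AddMonoidHom.mk' (R.D X) (R.D_add X)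

theorem D_neg (X : Γ) (c : C) : R.D X (-c) = - R.D X c := (R.DHom X).map_neg c
theorem D_zero (X : Γ) : R.D X 0 = 0 := (R.DHom X).map_zero

/-- The curvature. -/
def curv (X Y Z : Γ) : Γ :=
  R.nab X (R.nab Y Z) - R.nab Y (R.nab X Z) - R.nab (R.nab X Y - R.nab Y X) Z

theorem curv_swap (X Y Z : Γ) : R.curv X Y Z = - R.curv Y X Z := by
  simp only [curv, nab_sub_left]; abel

/-- The commutator of derivations applied to $g(Z,V)$ is expanded by metric compatibility; the mixed
terms cancel. -/
theorem curv_skew (X Y Z V : Γ) : R.G (R.curv X Y Z) V = - R.G (R.curv X Y V) Z := by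
  have h := R.D_bracket X Y (R.G Z V)
  simp only [D_metric, D_add] at h
  simp only [curv, G_sub_left]
  rw [R.G_symm Z, R.G_symm Z, R.G_symm Z] at h
  rw [R.G_symm (R.nab X Z) (R.nab Y V), R.G_symm (R.nab Y Z) (R.nab X V)] at h
  linear_combination -h

theorem bianchi (X Y Z : Γ) : R.curv X Y Z + R.curv Y Z X + R.curv Z X Y = 0 := by
  have h := R.jacobi X Y Z
  simp only [nab_sub_left, nab_sub_right] at h
  simp only [curv, nab_sub_left]
  rw [← sub_eq_zero] at h
  rw [← h]
  abel

theorem G_bianchi (X Y Z V : Γ) :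
    R.G (R.curv X Y Z) V + R.G (R.curv Y Z X) V + R.G (R.curv Z X Y) V = 0 := by
  rw [← R.G_add_left, ← R.G_add_left, bianchi, G_zero_left]

theorem G_curv_swap (X Y Z V : Γ) : R.G (R.curv X Y Z) V = - R.G (R.curv Y X Z) V := by
  rw [curv_swap, G_neg_left]

/-- Pair symmetry follows from the four cyclic identities on $X,Y,Z,V$ and the two skew-symmetries.
-/
theorem curv_pair (X Y Z V : Γ) : R.G (R.curv X Y Z) V = R.G (R.curv Z V X) Y := by
  rw [← sub_eq_zero]
  apply eq_zero_of_two_mul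
  have h1 := R.G_bianchi X Y Z V
  have h2 := R.G_bianchi Y Z V X
  have h3 := R.G_bianchi Z V X Y
  have h4 := R.G_bianchi V X Y Z
  have e1 := R.curv_skew X Y Z V
  have e2 := R.curv_skew Y Z X V
  have e3 := R.curv_skew Z X Y V
  have e4 := R.curv_skew Y Z V X
  have e5 := R.curv_skew Z V Y X
  have e6 := R.curv_skew V Y Z X
  have e7 := R.curv_skew Z V X Y
  have e8 := R.curv_skew V X Z Y
  have e9 := R.curv_skew V X Y Z
  have e10 := R.curv_skew X Y V Z
  have e11 := R.curv_skew Y V X Z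
  have s1 := R.G_curv_swap X Z V Y
  have s2 := R.G_curv_swap Y V X Z
  have s3 := R.G_curv_swap Y V Z X
  have s4 := R.G_curv_swap Z X Y V
  grind

variable (f : Γ →ₗ[C] Γ)

/-- `(∇_Y f) Z`. -/
def covDer (Y Z : Γ) : Γ := R.nab Y (f Z) - f (R.nab Y Z)

theorem covDer_add_left (Y Y' Z : Γ) :
    R.covDer f (Y + Y') Z = R.covDer f Y Z + R.covDer f Y' Z := by
  simp only [covDer, nab_add_left, map_add]; abel

theorem covDer_smul_left (c : C) (Y Z : Γ) :
    R.covDer f (c • Y) Z = c • R.covDer f Y Z := by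
  simp only [covDer, nab_smul_left, map_smul, smul_sub]

theorem covDer_add_right (Y Z Z' : Γ) :
    R.covDer f Y (Z + Z') = R.covDer f Y Z + R.covDer f Y Z' := by
  simp only [covDer, nab_add_right, map_add]; abel

theorem covDer_smul_right (c : C) (Y Z : Γ) :
    R.covDer f Y (c • Z) = c • R.covDer f Y Z := by
  simp only [covDer, nab_smul_right, map_smul, map_add, smul_sub]; abel

/-- The covariant derivative of a skew-symmetric endomorphism is skew-symmetric. -/
theorem covDer_skew (hf : ∀ X Y, R.G (f X) Y = - R.G X (f Y)) (X Y Z : Γ) :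
    R.G (R.covDer f X Y) Z = - R.G Y (R.covDer f X Z) := by
  have h := R.D_metric X (f Y) Z
  rw [hf, D_neg, D_metric, hf] at h
  simp only [covDer, G_sub_left, G_sub_right]
  rw [hf]
  linear_combination -h

/-- The second covariant derivative `(∇²_{X,Y} f) Z`. -/
def covDer₂ (X Y Z : Γ) : Γ :=
  R.nab X (R.covDer f Y Z) - R.covDer f (R.nab X Y) Z - R.covDer f Y (R.nab X Z)

theorem ricci (X Y Z : Γ) : R.covDer₂ f X Y Z - R.covDer₂ f Y X Z =
    R.curv X Y (f Z) - f (R.curv X Y Z) := by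
  simp only [covDer₂, covDer, curv, nab_sub_left, nab_sub_right, map_sub]
  abel

section Nearly

variable (hf : ∀ X Y, R.G (f X) Y = - R.G X (f Y))
  (hn : ∀ X Y, R.covDer f X Y = - R.covDer f Y X)

include hn in
theorem covDer₂_swap (X Y Z : Γ) : R.covDer₂ f X Y Z = - R.covDer₂ f X Z Y := by
  simp only [covDer₂]
  rw [hn Y Z, hn (R.nab X Y), hn Y, nab_neg_right]
  abel

include hf in
theorem covDer₂_skew (X Y Z V : Γ) :
    R.G (R.covDer₂ f X Y Z) V = - R.G (R.covDer₂ f X Y V) Z := by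
  have h := R.D_metric X (R.covDer f Y Z) V
  have hs := R.covDer_skew f hf
  rw [hs, D_neg, D_metric, hs Y Z] at h
  simp only [covDer₂, G_sub_left]
  rw [hs (R.nab X Y), hs Y (R.nab X Z), R.G_symm (R.nab X (R.covDer f Y V)),
    R.G_symm (R.covDer f (R.nab X Y) V) Z, hs Y (R.nab X V), R.G_symm (R.nab X V)]
  linear_combination -h + hs Y Z (R.nab X V)

include hf hn in
/-- A skew endomorphism with skew covariant derivative acts trivially, as a derivation, on the
curvature. -/
theorem curv_derivation (X Y Z V : Γ) :
    R.G (R.curv (f X) Y Z) V + R.G (R.curv X (f Y) Z) V + R.G (R.curv X Y (f Z)) V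
      + R.G (R.curv X Y Z) (f V) = 0 := by
  -- The Ricci identity for $f$, paired with $V$.
  have K : ∀ X Y Z V, R.G (R.covDer₂ f X Y Z) V - R.G (R.covDer₂ f Y X Z) V =
      R.G (R.curv X Y (f Z)) V - R.G (R.curv X Y (f V)) Z := by
    intro X Y Z V
    rw [← R.G_sub_left, ricci, G_sub_left, hf, R.curv_skew X Y Z (f V)]
    ring
  have s1 : ∀ X Y Z V, R.G (R.covDer₂ f X Y Z) V = - R.G (R.covDer₂ f X Z Y) V := by
    intro X Y Z V
    rw [R.covDer₂_swap f hn, G_neg_left]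
  have s2 := R.covDer₂_skew f hf
  have B : ∀ X Y Z V, R.G (R.curv X Y (f V)) Z + R.G (R.curv Y Z (f V)) X +
      R.G (R.curv Z X (f V)) Y = 0 := by
    intro X Y Z V
    rw [R.curv_skew X Y, R.curv_skew Y Z, R.curv_skew Z X]
    linear_combination -R.G_bianchi X Y Z (f V)
  -- By `s1` and `s2` the scalar $g((\nabla^2_{A,B}f)C,D)$ alternates in $B,C,D$, so only four such
  -- scalars occur, one for each choice of $A$. In a combination of the six Ricci identities they
  -- cancel, and the cyclic identities `B` collect the remaining curvature terms into three times
  -- the wanted sum.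
  have key : 3 * ((R.G (R.curv X Y (f Z)) V - R.G (R.curv X Y (f V)) Z) +
      (R.G (R.curv Z V (f X)) Y - R.G (R.curv Z V (f Y)) X)) = 0 := by
    have k1 := K X Y Z V
    have k2 := K Z V X Y
    have k3 := K Y Z X V
    have k4 := K X V Y Z
    have k5 := K Z X Y V
    have k6 := K Y V Z X
    have b1 := B Y Z V X
    have b2 := B Z X V Y
    have b3 := B X Y V Z
    have b4 := B X Y Z V
    have c := R.G_curv_swap
    have cyc : ∀ A X Y Z, R.G (R.covDer₂ f A X Y) Z = R.G (R.covDer₂ f A Y Z) X := by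
      intro A X Y Z
      rw [s1, s2, neg_neg]
    rw [cyc Z V, cyc V Z] at k2
    rw [s1 Y Z, s1 Z Y] at k3
    rw [cyc X V] at k4
    rw [s1 X Z] at k5
    rw [s1 Y V, cyc Y Z, cyc Y V, cyc V Y, cyc V Z] at k6
    linear_combination -2 * (k1 + k2) + k3 + k4 + k5 + k6 + b3 - b4 + b1 + b2
      - c V X (f Z) Y - c V Y (f X) Z - c V Z (f Y) X
  have := eq_zero_of_three_mul key
  rw [R.curv_pair (f X), R.curv_pair X (f Y), R.curv_skew X Y Z (f V)]
  rw [R.curv_skew Z V (f Y)] at this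
  linear_combination this

end Nearly

end RiemannianModule

/-! ### Tensor identities for the $h_i$. -/

/-- The algebraic counterpart of a weak nearly `C`-structure satisfying the four conditions. -/
structure WeakNearlyModule {C Γ : Type*} [CommRing C] [Algebra ℝ C] [AddCommGroup Γ]
    [Module C Γ] (R : RiemannianModule C Γ) (s : ℕ) where
  f : Γ →ₗ[C] Γ
  Q : Γ →ₗ[C] Γ
  ξ : Fin s → Γ
  f_skew : ∀ X Y, R.G (f X) Y = - R.G X (f Y)
  Q_symm : ∀ X Y, R.G (Q X) Y = R.G X (Q Y)
  ortho : ∀ i j, R.G (ξ i) (ξ j) = if i = j then 1 else 0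
  f_sq : ∀ X, f (f X) = - Q X + ∑ i, R.G X (ξ i) • ξ i
  Q_ξ : ∀ i, Q (ξ i) = ξ i
  f_ξ : ∀ i, f (ξ i) = 0
  nearly : ∀ X Y, R.covDer f X Y = - R.covDer f Y X
  comm : ∀ i j, R.nab (ξ i) (ξ j) = R.nab (ξ j) (ξ i)
  flat : ∀ X i j, R.G (R.nab X (ξ i)) (ξ j) = 0
  Q_par : ∀ X Y, (∀ i, R.G Y (ξ i) = 0) → R.nab X (Q Y) = Q (R.nab X Y)
  curv_cond : ∀ X Y Z, (∀ i, R.G X (ξ i) = 0) → (∀ i, R.G Y (ξ i) = 0) →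
    (∀ i, R.G Z (ξ i) = 0) → ∀ i, R.G (R.curv (Q X - X) Y Z) (ξ i) = 0

namespace WeakNearlyModule

variable {C Γ : Type*} [CommRing C] [Algebra ℝ C] [AddCommGroup Γ] [Module C Γ]
  {R : RiemannianModule C Γ} {s : ℕ} (S : WeakNearlyModule R s)

open RiemannianModule

/-- Orthogonality to all the `ξ_i`. -/
def Horizontal (X : Γ) : Prop := ∀ i, R.G X (S.ξ i) = 0

/-- The tensor `h_i = ∇ξ_i`. -/
def h (i : Fin s) : Γ →ₗ[C] Γ := R.nabLin (S.ξ i)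

theorem h_apply (i : Fin s) (X : Γ) : S.h i X = R.nab X (S.ξ i) := rfl

theorem G_eq_zero_of_two (X Y : Γ) (h : 2 * R.G X Y = 0) : R.G X Y = 0 := eq_zero_of_two_mul h

theorem horizontal_sub (X : Γ) : S.Horizontal (X - ∑ i, R.G X (S.ξ i) • S.ξ i) := by
  intro j
  simp [R.G_sub_left, R.G_sum_left, R.G_smul_left, S.ortho]

/-- Tensorial identities may be checked separately on fields orthogonal to the $\xi_i$ and on the
$\xi_i$ themselves. -/
theorem horizontal_induction {p : Γ → Prop} (add : ∀ X Y, p X → p Y → p (X + Y))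
    (smul : ∀ (c : C) X, p X → p (c • X)) (hor : ∀ X, S.Horizontal X → p X)
    (ver : ∀ i, p (S.ξ i)) (X : Γ) : p X := by
  rw [← sub_add_cancel X (∑ i, R.G X (S.ξ i) • S.ξ i)]
  refine add _ _ (hor _ (S.horizontal_sub X)) ?_
  refine Finset.sum_induction _ p add ?_ fun i _ => smul _ _ (ver i)
  exact hor _ fun i => R.G_zero_left _

theorem horizontal_ext {X Y : Γ} (hX : S.Horizontal X) (hY : S.Horizontal Y)
    (h : ∀ Z, S.Horizontal Z → R.G X Z = R.G Y Z) : X = Y := by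
  refine R.G_ext fun Z => ?_
  induction Z using S.horizontal_induction with
  | add Z W h1 h2 => rw [R.G_add_right, R.G_add_right, h1, h2]
  | smul c Z h1 => rw [R.G_smul_right, R.G_smul_right, h1]
  | hor Z hZ => exact h Z hZ
  | ver i => rw [hX i, hY i]

theorem horizontal_h (i : Fin s) (X : Γ) : S.Horizontal (S.h i X) := S.flat X i

theorem horizontal_f (X : Γ) : S.Horizontal (S.f X) := fun i => by
  rw [S.f_skew, S.f_ξ, R.G_zero_right, neg_zero]

theorem horizontal_Q {X : Γ} (hX : S.Horizontal X) : S.Horizontal (S.Q X) := fun i => by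
  rw [S.Q_symm, S.Q_ξ, hX i]

theorem f_sq_of_horizontal {X : Γ} (hX : S.Horizontal X) : S.f (S.f X) = - S.Q X := by
  have hX' : ∀ i, R.G X (S.ξ i) = 0 := hX
  simp [S.f_sq, hX']

theorem Q_f (X : Γ) : S.Q (S.f X) = S.f (S.Q X) := by
  have h1 := S.f_sq_of_horizontal (S.horizontal_f X)
  rw [S.f_sq X, map_add, map_neg, map_sum] at h1
  simp only [map_smul, S.f_ξ, smul_zero, Finset.sum_const_zero, add_zero] at h1
  exact (neg_injective h1).symm

theorem G_nab_ξ (X Y : Γ) (hY : S.Horizontal Y) (i : Fin s) :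
    R.G (R.nab X Y) (S.ξ i) = - R.G Y (S.h i X) := by
  have := R.D_metric X Y (S.ξ i)
  rw [hY i, R.D_zero] at this
  rw [h_apply]
  linear_combination -this

/-- The $\xi_i$-component of $\nabla_X(QZ)=Q\nabla_XZ$, for $Z$ orthogonal to all $\xi_j$, reads
$g(QZ,h_iX)=g(Z,h_iX)$ because $Q\xi_i=\xi_i$. -/
theorem Q_h (i : Fin s) (X : Γ) : S.Q (S.h i X) = S.h i X := by
  refine S.horizontal_ext (S.horizontal_Q (S.horizontal_h i X)) (S.horizontal_h i X) ?_
  intro Z hZ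
  have h1 := congrArg (fun W => R.G W (S.ξ i)) (S.Q_par X Z hZ)
  rw [S.G_nab_ξ X _ (S.horizontal_Q hZ), S.Q_symm, S.Q_symm, S.Q_ξ, S.G_nab_ξ X Z hZ,
    neg_inj] at h1
  rw [R.G_symm, h1, R.G_symm]

/-- Condition 3 covers horizontal arguments. On $\xi_i$ the derivative is $h_iX-Qh_iX$, which
vanishes by `Q_h`. -/
theorem covDer_Q (X Y : Γ) : R.covDer S.Q X Y = 0 := by
  induction Y using S.horizontal_induction with
  | add Z W h1 h2 => rw [covDer_add_right, h1, h2, add_zero]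
  | smul c Z h1 => rw [covDer_smul_right, h1, smul_zero]
  | hor Z hZ => rw [covDer, S.Q_par X Z hZ, sub_self]
  | ver i => rw [covDer, S.Q_ξ, ← h_apply, S.Q_h, sub_self]

theorem eq_neg_f_f_of {X : Γ} (hX : S.Horizontal X) (hQ : S.Q X = X) : X = - S.f (S.f X) := by
  rw [S.f_sq_of_horizontal hX, hQ, neg_neg]

/-- Where $Q$ acts as the identity, $f^2=-1$ on horizontal fields. With `Q_h` this lets $f$ be
cancelled in identities between the $h_i$. -/
theorem eq_zero_of_f {X : Γ} (hX : S.Horizontal X) (hQ : S.Q X = X) (hf : S.f X = 0) : X = 0 := by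
  rw [S.eq_neg_f_f_of hX hQ, hf, map_zero, neg_zero]

theorem covDer_ξ_right (X : Γ) (i : Fin s) : R.covDer S.f X (S.ξ i) = - S.f (S.h i X) := by
  rw [covDer, S.f_ξ, R.nab_zero_right, zero_sub, h_apply]

theorem covDer_ξ_left (X : Γ) (i : Fin s) : R.covDer S.f (S.ξ i) X = S.f (S.h i X) := by
  rw [S.nearly, covDer_ξ_right, neg_neg]

/-- Commutation of the Reeb fields gives $h_i\xi_j=h_j\xi_i$, so $(\nabla_{\xi_j}f)\xi_i$ equals
both $-fh_i\xi_j$ and $fh_i\xi_j$. -/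
theorem h_ξ (i j : Fin s) : S.h i (S.ξ j) = 0 := by
  refine S.eq_zero_of_f (S.horizontal_h i _) (S.Q_h i _) ?_
  refine R.G_self _ (G_eq_zero_of_two _ _ ?_)
  have h1 := S.covDer_ξ_right (S.ξ j) i
  rw [covDer_ξ_left, h_apply, S.comm, ← h_apply] at h1
  have h2 := congrArg (fun W => R.G W (S.f (S.h i (S.ξ j)))) h1
  simp only [R.G_neg_left] at h2
  linear_combination h2

/-- The tensor $f^2=-Q+\sum_j\eta^j\otimes\xi_j$ is parallel along $\xi_i$, since $\nabla Q=0$ and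
$\nabla_{\xi_i}\xi_j=0$. As $\nabla_{\xi_i}f=fh_i$, its derivative is $f(fh_i+h_if)$, and the outer
$f$ can be cancelled. -/
theorem f_h (i : Fin s) (X : Γ) : S.f (S.h i X) = - S.h i (S.f X) := by
  rw [← sub_eq_zero, sub_neg_eq_add]
  refine S.eq_zero_of_f (X := S.f (S.h i X) + S.h i (S.f X)) ?_ ?_ ?_
  · intro j
    rw [R.G_add_left, S.horizontal_f _ j, S.horizontal_h _ _ j, add_zero]
  · rw [map_add, S.Q_f, S.Q_h, S.Q_h]
  · have h1 : R.nab (S.ξ i) (S.f (S.f X)) - S.f (S.f (R.nab (S.ξ i) X)) =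
        S.f (S.f (S.h i X) + S.h i (S.f X)) := by
      have e1 := S.covDer_ξ_left (S.f X) i
      have e2 := S.covDer_ξ_left X i
      simp only [covDer] at e1 e2
      rw [sub_eq_iff_eq_add] at e1 e2
      rw [e1, e2, map_add, map_add]
      abel
    rw [← h1, S.f_sq, S.f_sq, R.nab_add_right, R.nab_neg_right, sub_eq_zero]
    have h2 := S.covDer_Q (S.ξ i) X
    rw [covDer, sub_eq_zero] at h2
    rw [h2]
    congr 1
    change R.nabHom (S.ξ i) _ = _
    rw [map_sum]
    refine Finset.sum_congr rfl fun j _ => ?_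
    change R.nab (S.ξ i) _ = _
    rw [R.nab_smul_right, ← h_apply, S.h_ξ, smul_zero, zero_add, R.D_metric, ← h_apply, S.h_ξ,
      R.G_zero_right, add_zero]

theorem Q_comm_h (i : Fin s) (X : Γ) : S.h i (S.Q X) = S.h i X := by
  have h1 : S.h i (S.f (S.f X)) = S.f (S.f (S.h i X)) := by
    rw [S.f_h i X, map_neg, S.f_h, neg_neg]
  rw [S.f_sq, S.f_sq_of_horizontal (S.horizontal_h i X), S.Q_h, map_add, map_neg, map_sum] at h1
  simp only [map_smul, S.h_ξ, smul_zero, Finset.sum_const_zero, add_zero] at h1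
  exact neg_injective h1

/-- The derivative $\nabla_{\xi_i}f=fh_i$ of a skew tensor is skew. Since $f$ anticommutes with
$h_i$, this is skewness of $h_i$ against the image of $f$; replacing $X$ by $fX$ and using
$h_iQ=h_i=Qh_i$ removes the restriction. -/
theorem h_skew (i : Fin s) (X Y : Γ) : R.G (S.h i X) Y = - R.G X (S.h i Y) := by
  have h1 : ∀ X, R.G (S.h i (S.f X)) Y = - R.G (S.f X) (S.h i Y) := by
    intro X
    have h2 := R.covDer_skew S.f S.f_skew (S.ξ i) X Y
    rw [covDer_ξ_left, covDer_ξ_left, S.f_h i X, R.G_neg_left] at h2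
    rw [S.f_skew]
    linear_combination -h2
  have h2 := h1 (S.f X)
  rw [S.f_sq, map_add, map_neg, map_sum, Q_comm_h] at h2
  simp only [map_smul, S.h_ξ, smul_zero, Finset.sum_const_zero, add_zero] at h2
  have h3 : R.G (∑ j, R.G X (S.ξ j) • S.ξ j) (S.h i Y) = 0 := by
    rw [R.G_sum_left]
    refine Finset.sum_eq_zero fun j _ => ?_
    rw [R.G_smul_left, R.G_symm (S.ξ j), S.horizontal_h i Y j, mul_zero]
  rw [R.G_neg_left, R.G_add_left, h3, R.G_neg_left, S.Q_symm, S.Q_h] at h2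
  linear_combination -h2

theorem curv_ξ (X Y Z : Γ) (hX : S.Horizontal X) (hY : S.Horizontal Y) (hZ : S.Horizontal Z)
    (i : Fin s) : R.G (R.curv X Y Z) (S.ξ i) = 0 := by
  let B : Γ → Γ → Γ → C := fun X Y Z => R.G (R.curv X Y Z) (S.ξ i)
  -- Since $f\xi_i=0$, the derivation property of $f$ involves only the three remaining slots.
  have hL : ∀ X Y Z, B (S.f X) Y Z + B X (S.f Y) Z + B X Y (S.f Z) = 0 := by
    intro X Y Z
    have := R.curv_derivation S.f S.f_skew S.nearly X Y Z (S.ξ i)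
    rwa [S.f_ξ, R.G_zero_right, add_zero] at this
  have sub1 : ∀ X X' Y Z, B (X - X') Y Z = B X Y Z - B X' Y Z := by
    intro X X' Y Z
    simp only [B]
    rw [R.curv_skew, R.curv_skew X, R.curv_skew X', R.curv_pair, R.curv_pair X, R.curv_pair X',
      R.curv_skew, R.curv_skew _ _ X, R.curv_skew _ _ X', R.G_sub_right]
    ring
  have neg1 : ∀ X Y Z, B (-X) Y Z = - B X Y Z := by
    intro X Y Z
    have h1 := sub1 0 X Y Z
    have h2 := sub1 0 0 Y Z
    rw [zero_sub] at h1
    rw [sub_self, sub_self] at h2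
    rw [h1, h2, zero_sub]
  -- Condition 4 makes $Q$ act as the identity in the first slot, so $f^2$ acts as $-1$ there.
  -- Antisymmetry and then the Bianchi identity carry this to the other slots.
  have q1 : ∀ X Y Z, S.Horizontal X → S.Horizontal Y → S.Horizontal Z →
      B (S.f (S.f X)) Y Z = - B X Y Z := by
    intro X Y Z hX hY hZ
    have := S.curv_cond X Y Z hX hY hZ i
    rw [S.f_sq_of_horizontal hX, neg1]
    change B _ Y Z = 0 at this
    rw [sub1] at this
    linear_combination -this
  have sw : ∀ X Y Z, B X Y Z = - B Y X Z := fun X Y Z => R.G_curv_swap X Y Z _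
  have bi : ∀ X Y Z, B X Y Z + B Y Z X + B Z X Y = 0 := fun X Y Z => R.G_bianchi X Y Z _
  have q2 : ∀ X Y Z, S.Horizontal X → S.Horizontal Y → S.Horizontal Z →
      B X (S.f (S.f Y)) Z = - B X Y Z := by
    intro X Y Z hX hY hZ
    rw [sw, q1 Y X Z hY hX hZ]
    linear_combination sw X Y Z
  have q3 : ∀ X Y Z, S.Horizontal X → S.Horizontal Y → S.Horizontal Z →
      B X Y (S.f (S.f Z)) = - B X Y Z := by
    intro X Y Z hX hY hZ
    have h1 := bi X Y (S.f (S.f Z))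
    rw [q2 _ _ _ hY hZ hX, q1 _ _ _ hZ hX hY] at h1
    linear_combination h1 + bi X Y Z
  -- Applying this relation twice, with $f^2=-1$ in both slots, gives $4B=B$ and hence $B=0$.
  have half : ∀ X Y Z, S.Horizontal X → S.Horizontal Y → S.Horizontal Z →
      2 * B (S.f X) (S.f Y) Z = B X Y Z := by
    intro X Y Z hX hY hZ
    have e1 := hL (S.f X) Y Z
    have e2 := hL X (S.f Y) Z
    have e3 := hL X Y (S.f Z)
    rw [q1 X Y Z hX hY hZ] at e1
    rw [q2 X Y Z hX hY hZ] at e2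
    rw [q3 X Y Z hX hY hZ] at e3
    linear_combination e1 + e2 - e3
  have h1 := half _ _ Z (S.horizontal_f X) (S.horizontal_f Y) hZ
  rw [q1 _ _ _ hX (S.horizontal_f _) hZ, q2 _ _ _ hX hY hZ] at h1
  have h2 := half X Y Z hX hY hZ
  change B X Y Z = 0
  exact eq_zero_of_three_mul (by linear_combination 2 * h1 + h2)

theorem covDer_h_sub (i : Fin s) (X Y : Γ) :
    R.covDer (S.h i) X Y - R.covDer (S.h i) Y X = R.curv X Y (S.ξ i) := by
  simp only [covDer, curv, h_apply, nab_sub_left]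
  abel

theorem covDer_h_ξ (i j : Fin s) (X : Γ) :
    R.covDer (S.h i) X (S.ξ j) = - S.h i (S.h j X) := by
  rw [covDer, S.h_ξ, R.nab_zero_right, zero_sub, S.h_apply j]

theorem covDer_h_skew (i : Fin s) (X Y Z : Γ) :
    R.G (R.covDer (S.h i) X Y) Z = - R.G Y (R.covDer (S.h i) X Z) :=
  R.covDer_skew _ (S.h_skew i) X Y Z

theorem G_covDer_h_ξ (i j : Fin s) (X Y : Γ) :
    R.G (R.covDer (S.h i) X Y) (S.ξ j) = R.G Y (S.h i (S.h j X)) := by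
  rw [covDer_h_skew, covDer_h_ξ, R.G_neg_right, neg_neg]

/-- By `covDer_h_sub` and `curv_ξ` the form is symmetric in $X,Y$; it is skew in $Y,Z$. A trilinear
form with both symmetries is zero. -/
theorem G_covDer_h_horizontal (i : Fin s) (X Y Z : Γ) (hX : S.Horizontal X)
    (hY : S.Horizontal Y) (hZ : S.Horizontal Z) : R.G (R.covDer (S.h i) X Y) Z = 0 := by
  have sym : ∀ X Y Z, S.Horizontal X → S.Horizontal Y → S.Horizontal Z →
      R.G (R.covDer (S.h i) X Y) Z = R.G (R.covDer (S.h i) Y X) Z := by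
    intro X Y Z hX hY hZ
    rw [← sub_eq_zero, ← R.G_sub_left, covDer_h_sub, R.curv_skew, S.curv_ξ X Y Z hX hY hZ,
      neg_zero]
  have sk : ∀ X Y Z, R.G (R.covDer (S.h i) X Y) Z = - R.G (R.covDer (S.h i) X Z) Y := by
    intro X Y Z
    rw [covDer_h_skew, R.G_symm]
  apply eq_zero_of_two_mul
  linear_combination sym X Y Z hX hY hZ + sk Y X Z - sym Y Z X hY hZ hX - sk Z Y X
    + sym Z X Y hZ hX hY + sk X Z Y

/-- Write $P_{ji}=\nabla_{\xi_j}h_i$ and $K=[h_j,h_i]$. Pair symmetry gives $P_{ij}=-P_{ji}$, the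
Bianchi identity gives $R_{\xi_j,\xi_i}=2P_{ji}-K$, and pair symmetry again gives $P_{ji}=K$, so
$R_{\xi_j,\xi_i}=K$. The Ricci identity for $f$ then reads $[K,f]=f(P_{ji}-P_{ij}+K)=3fK$, while $K$
commutes with $f$. Hence $fK=0$ and $K=0$. -/
theorem h_comm_aux (i j : Fin s) (Y : Γ) :
    R.covDer (S.h i) (S.ξ j) Y = S.h j (S.h i Y) - S.h i (S.h j Y) ∧
      S.h j (S.h i Y) - S.h i (S.h j Y) = 0 := by
  let P : Fin s → Fin s → Γ → Γ := fun j i Y => R.covDer (S.h i) (S.ξ j) Y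
  let K : Γ → Γ := fun Y => S.h j (S.h i Y) - S.h i (S.h j Y)
  have a1 : ∀ i j Y, R.covDer₂ S.f (S.ξ j) (S.ξ i) Y = S.f (P j i Y + S.h j (S.h i Y)) := by
    intro i j Y
    have e1 := S.covDer_ξ_left (S.h i Y) j
    simp only [P]
    rw [covDer₂, S.covDer_ξ_left, ← h_apply, S.h_ξ]
    simp only [covDer, nab_zero_left, map_zero, sub_zero, map_add, map_sub] at e1 ⊢
    have e2 := S.covDer_ξ_left (R.nab (S.ξ j) Y) i
    simp only [covDer] at e2
    rw [e2, ← e1]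
    abel
  -- The Ricci identity for $f$ in the directions $\xi_j,\xi_i$.
  have a : ∀ Y, R.curv (S.ξ j) (S.ξ i) (S.f Y) - S.f (R.curv (S.ξ j) (S.ξ i) Y) =
      S.f (P j i Y - P i j Y + K Y) := by
    intro Y
    rw [← ricci, a1, a1, ← map_sub]
    congr 1
    simp only [K]
    abel
  have b : ∀ i j Y, R.curv (S.ξ j) Y (S.ξ i) = P j i Y + S.h i (S.h j Y) := by
    intro i j Y
    rw [← covDer_h_sub, covDer_h_ξ, sub_neg_eq_add]
  have c : ∀ Y, P i j Y = - P j i Y := by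
    intro Y
    refine R.G_ext fun Z => ?_
    have h1 := R.curv_pair (S.ξ j) Y (S.ξ i) Z
    rw [b, b, R.G_add_left, R.G_add_left] at h1
    have h2 := S.h_skew j (S.h i Z) Y
    have h3 := S.h_skew i Z (S.h j Y)
    have h4 := S.covDer_h_skew j (S.ξ i) Z Y
    have h5 := R.G_symm (S.h i (S.h j Y)) Z
    have h6 := R.G_symm (P i j Y) Z
    rw [R.G_neg_left]
    simp only [P] at *
    linear_combination h6 + h1 + h4 + h2 - h3 - h5
  have d : ∀ Y, R.curv (S.ξ j) (S.ξ i) Y = P j i Y + P j i Y - K Y := by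
    intro Y
    have h1 := R.bianchi (S.ξ j) (S.ξ i) Y
    rw [R.curv_swap Y, b, b, c] at h1
    rw [← sub_eq_zero, ← h1]
    simp only [K]
    abel
  have e : ∀ Y, P j i Y = K Y := by
    intro Y
    refine R.G_ext fun Z => ?_
    rw [← sub_eq_zero]
    apply eq_zero_of_two_mul
    have h1 := R.curv_pair Y Z (S.ξ i) (S.ξ j)
    rw [R.curv_swap (S.ξ i), d, R.G_neg_left, ← covDer_h_sub, R.G_sub_left, G_covDer_h_ξ,
      G_covDer_h_ξ] at h1
    have h2 := S.h_skew i Y (S.h j Z)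
    have h3 := S.h_skew j (S.h i Y) Z
    have h4 := R.G_symm Z (S.h i (S.h j Y))
    simp only [K, R.G_sub_left, R.G_add_left] at *
    linear_combination h2 - h3 - h4 + h1
  have hK : K Y = 0 := by
    refine S.eq_zero_of_f ?_ ?_ ?_
    · intro k
      simp only [K, R.G_sub_left]
      rw [S.horizontal_h _ _ k, S.horizontal_h _ _ k, sub_zero]
    · simp only [K, map_sub, S.Q_h]
    · refine R.G_self _ (eq_zero_of_three_mul ?_)
      have h1 := a Y
      -- The curvature has become $K$ itself, which commutes with $f$ because both $h_i$ and $h_j$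
      -- anticommute with it.
      rw [d, d, c, e, e] at h1
      have h2 : K (S.f Y) = S.f (K Y) := by
        have e1 := fun i => S.f_h i Y
        simp only [K, map_sub, S.f_h, map_neg, neg_neg]
      rw [h2] at h1
      have h3 := congrArg (fun W => R.G W (S.f (K Y))) h1
      simp only [map_add, map_sub, map_neg, R.G_sub_left, R.G_add_left, R.G_neg_left] at h3
      linear_combination -h3
  exact ⟨e Y, hK⟩

theorem h_comm (i j : Fin s) (Y : Γ) : S.h i (S.h j Y) = S.h j (S.h i Y) :=
  (sub_eq_zero.1 (S.h_comm_aux i j Y).2).symm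

theorem covDer_h_ξ_left (i j : Fin s) (Y : Γ) : R.covDer (S.h i) (S.ξ j) Y = 0 := by
  rw [(S.h_comm_aux i j Y).1, (S.h_comm_aux i j Y).2]

/-- Both sides are tensorial, so horizontal and vertical arguments suffice. For $X=\xi_k$ both sides
vanish; for horizontal $X$ the component on horizontal $Y,Z$ vanishes, and those involving some
$\xi_k$ come from differentiating $h_i\xi_k=0$ and from skewness. -/
theorem covDer_h (i : Fin s) (X Y : Γ) : R.covDer (S.h i) X Y =
    ∑ j, (R.G Y (S.h i (S.h j X)) • S.ξ j - R.G Y (S.ξ j) • S.h i (S.h j X)) := by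
  refine R.G_ext fun Z => ?_
  induction X using S.horizontal_induction with
  | add X X' h1 h2 =>
    rw [covDer_add_left, R.G_add_left, h1, h2, ← R.G_add_left, ← Finset.sum_add_distrib]
    congr 1
    refine Finset.sum_congr rfl fun j _ => ?_
    simp only [map_add, R.G_add_right, smul_add, add_smul]
    abel
  | smul c X h1 =>
    rw [covDer_smul_left, R.G_smul_left, h1, ← R.G_smul_left, Finset.smul_sum]
    congr 1
    refine Finset.sum_congr rfl fun j _ => ?_
    simp only [map_smul, R.G_smul_right, smul_sub, smul_smul, mul_comm]
  | ver k => simp [covDer_h_ξ_left, S.h_ξ, R.G_zero_right]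
  | hor X hX =>
    rw [R.G_sum_left]
    induction Z using S.horizontal_induction with
    | add Z Z' h1 h2 => simp only [R.G_add_right, h1, h2, Finset.sum_add_distrib]
    | smul c Z h1 => simp only [R.G_smul_right, h1, Finset.mul_sum]
    | ver k =>
      rw [G_covDer_h_ξ]
      have h1 : ∀ j, R.G (S.h i (S.h j X)) (S.ξ k) = 0 := fun j => S.horizontal_h i _ k
      simp [R.G_sub_left, R.G_smul_left, S.ortho, h1]
    | hor Z hZ =>
      have hZ' : ∀ j, R.G (S.ξ j) Z = 0 := fun j => by rw [R.G_symm, hZ j]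
      induction Y using S.horizontal_induction with
      | add Y Y' h1 h2 =>
        simp only [covDer_add_right, R.G_add_left, h1, h2, ← Finset.sum_add_distrib]
        refine Finset.sum_congr rfl fun j _ => ?_
        simp only [R.G_sub_left, R.G_smul_left]
        ring
      | smul c Y h1 =>
        simp only [covDer_smul_right, R.G_smul_left, h1, Finset.mul_sum]
        refine Finset.sum_congr rfl fun j _ => ?_
        simp only [R.G_sub_left, R.G_smul_left]
        ring
      | ver k =>
        simp only [covDer_h_ξ, R.G_sub_left, R.G_smul_left, hZ', S.ortho, mul_zero, zero_sub,
          R.G_neg_left]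
        simp
      | hor Y hY =>
        have hY' : ∀ j, R.G Y (S.ξ j) = 0 := hY
        rw [S.G_covDer_h_horizontal i X Y Z hX hY hZ]
        simp [R.G_smul_left, hZ', hY']

end WeakNearlyModule

/-! ### Smooth vector fields as an instance of the algebra. -/

section FieldModule

variable {E : Type*} [NormedAddCommGroup E] [NormedSpace ℝ E] [FiniteDimensional ℝ E]
  {M : Type*} [TopologicalSpace M] [ChartedSpace E M] [IsManifold 𝓘(ℝ, E) ∞ M]

variable (E M) in
/-- The algebra of smooth functions. -/
def smoothFunctions : Subalgebra ℝ (M → ℝ) where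
  carrier := {c | CMDiff ∞ c}
  mul_mem' ha hb := ContMDiff.mul ha hb
  add_mem' ha hb := ContMDiff.add ha hb
  algebraMap_mem' _ := contMDiff_const

theorem SmoothField.zero : SmoothField (fun x : M => (0 : TangentSpace 𝓘(ℝ, E) x)) :=
  contMDiff_zeroSection ℝ (TangentSpace 𝓘(ℝ, E))

variable (E M) in
/-- The module of smooth vector fields. -/
def smoothFields : Submodule (smoothFunctions E M) (Π x : M, TangentSpace 𝓘(ℝ, E) x) where
  carrier := {X | SmoothField X}
  add_mem' ha hb := SmoothField.add ha hb
  zero_mem' := SmoothField.zero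
  smul_mem' c _ hX := SmoothField.smul c.2 hX

variable (g : Metric 𝓘(ℝ, E) M)

theorem leviCivita_add {Y Y' : Π x : M, TangentSpace 𝓘(ℝ, E) x} {x : M}
    (hY : MDiffAt (T% Y) x) (hY' : MDiffAt (T% Y') x) :
    leviCivita g (fun y => Y y + Y' y) x = leviCivita g Y x + leviCivita g Y' x :=
  (leviCivita g).isCovariantDerivativeOnUniv.add hY hY' trivial

theorem leviCivita_smul {Y : Π x : M, TangentSpace 𝓘(ℝ, E) x} {c : M → ℝ} {x : M}
    (hc : MDiffAt c x) (hY : MDiffAt (T% Y) x) (v : TangentSpace 𝓘(ℝ, E) x) :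
    leviCivita g (fun y => c y • Y y) x v = c x • leviCivita g Y x v + d% c x v • Y x := by
  have := (leviCivita g).isCovariantDerivativeOnUniv.leibniz hY hc trivial
  exact congrArg (fun A => A v) this

theorem leviCivita_sub {Y Y' : Π x : M, TangentSpace 𝓘(ℝ, E) x} {x : M}
    (hY : MDiffAt (T% Y) x) (hY' : MDiffAt (T% Y') x) :
    leviCivita g (fun y => Y y - Y' y) x = leviCivita g Y x - leviCivita g Y' x := by
  have h1 : MDiffAt (T% (fun y : M => Y y - Y' y)) x := mdifferentiableAt_sub_section hY hY'
  have h2 := leviCivita_add g h1 hY'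
  simp only [sub_add_cancel] at h2
  rw [h2, add_sub_cancel_right]

theorem leviCivita_torsion_free {X Y : Π x : M, TangentSpace 𝓘(ℝ, E) x} {x : M}
    (hX : MDiffAt (T% X) x) (hY : MDiffAt (T% Y) x) :
    leviCivita g Y x (X x) - leviCivita g X x (Y x) = mlieBracket 𝓘(ℝ, E) X Y x :=
  ((leviCivita g).torsion_eq_zero_iff.1 (leviCivita_torsion g)) hX hY

variable [T2Space M]

/-- The module of smooth vector fields of a Riemannian manifold. -/
noncomputable def fieldModule : RiemannianModule (smoothFunctions E M) (smoothFields E M) where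
  nab X Y := ⟨fun x => leviCivita g Y.1 x (X.1 x), SmoothField.leviCivita g X.2 Y.2⟩
  G X Y := ⟨fun x => g.inner x (X.1 x) (Y.1 x), SmoothField.inner g X.2 Y.2⟩
  D X c := ⟨fun x => d% c.1 x (X.1 x), contMDiff_mvfderiv_apply c.2 X.2⟩
  nab_add_left X X' Y := by ext x; exact map_add _ _ _
  nab_smul_left c X Y := by ext x; exact map_smul _ _ _
  nab_add_right X Y Y' := by
    ext x
    exact congrArg (fun A => A (X.1 x)) (leviCivita_add g Y.2.mdiffAt Y'.2.mdiffAt)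
  nab_smul_right X c Y := by
    ext x
    exact leviCivita_smul g (c.2.mdifferentiable (by simp) x) Y.2.mdiffAt (X.1 x)
  G_symm X Y := by ext x; exact g.symm _ _ _
  G_add_left X X' Y := by
    ext x
    change g.inner x (X.1 x + X'.1 x) (Y.1 x) = g.inner x (X.1 x) (Y.1 x) + g.inner x (X'.1 x) (Y.1 x)
    simp
  G_smul_left c X Y := by
    ext x
    change g.inner x (c.1 x • X.1 x) (Y.1 x) = c.1 x * g.inner x (X.1 x) (Y.1 x)
    simp
  G_self X h := by
    ext x
    by_contra hne
    have h1 := g.pos x (X.1 x) hne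
    have h2 := congrFun (congrArg Subtype.val h) x
    exact h1.ne' h2
  D_add X c c' := by
    ext x
    have := mvfderiv_fun_add (c.2.mdifferentiable (by simp) x) (c'.2.mdifferentiable (by simp) x)
    exact congrArg (fun A => A (X.1 x)) this
  D_metric X Y Z := by
    ext x
    exact leviCivita_metric g X.2.mdiffAt Y.2.mdiffAt Z.2.mdiffAt
  D_bracket X Y c := by
    ext x
    have h2 : CMDiffAt 2 c.1 x := (c.2 x).of_le ENat.LEInfty.out
    have := mvfderiv_mlieBracket h2 (X.2.mdiffAt (x := x)) Y.2.mdiffAt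
    rw [← leviCivita_torsion_free g X.2.mdiffAt Y.2.mdiffAt] at this
    exact this
  jacobi X Y Z := by
    have : IsManifold 𝓘(ℝ, E) (minSmoothness ℝ 3) M := by
      rw [minSmoothness_of_isRCLikeNormedField]; infer_instance
    have key : ∀ (X Y : smoothFields E M) (x : M), leviCivita g Y.1 x (X.1 x) -
        leviCivita g X.1 x (Y.1 x) = mlieBracket 𝓘(ℝ, E) X.1 Y.1 x :=
      fun X Y x => leviCivita_torsion_free g X.2.mdiffAt Y.2.mdiffAt
    have keyf : ∀ (X Y : smoothFields E M), (fun x => leviCivita g Y.1 x (X.1 x) -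
        leviCivita g X.1 x (Y.1 x)) = mlieBracket 𝓘(ℝ, E) X.1 Y.1 := fun X Y => funext (key X Y)
    have two : ∀ X : smoothFields E M, ∀ x, CMDiffAt (minSmoothness ℝ 2) (T% X.1) x := by
      intro X x
      rw [minSmoothness_of_isRCLikeNormedField]
      exact (X.2 x).of_le ENat.LEInfty.out
    have lb : ∀ X Y : smoothFields E M, SmoothField (mlieBracket 𝓘(ℝ, E) X.1 Y.1) :=
      fun X Y => SmoothField.mlieBracket X.2 Y.2
    ext x
    have h1 := leibniz_identity_mlieBracket_apply (two X x) (two Y x) (two Z x)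
    have k1 := key X ⟨_, lb Y Z⟩ x
    have k2 := key ⟨_, lb X Y⟩ Z x
    have k3 := key Y ⟨_, lb X Z⟩ x
    rw [← k1, ← k2, ← k3] at h1
    simp only [← keyf] at h1
    exact h1

end FieldModule

/-! ### The identities for the $h_i$ at each point of the manifold. -/

section Pointwise

variable {E : Type*} [NormedAddCommGroup E] [NormedSpace ℝ E] [FiniteDimensional ℝ E]
  {M : Type u} [TopologicalSpace M] [ChartedSpace E M] [IsManifold 𝓘(ℝ, E) ∞ M]

theorem SmoothEnd.apply {A : Π x : M, TangentSpace 𝓘(ℝ, E) x →L[ℝ] TangentSpace 𝓘(ℝ, E) x}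
    (hA : SmoothEnd A) {X : Π x : M, TangentSpace 𝓘(ℝ, E) x} (hX : SmoothField X) :
    SmoothField (fun x => A x (X x)) := fun x =>
  ContMDiffAt.clm_bundle_apply (F₁ := E) (F₂ := E) (hA x) (hX x)

theorem SmoothEnd.of_apply [T2Space M]
    {A : Π x : M, TangentSpace 𝓘(ℝ, E) x →L[ℝ] TangentSpace 𝓘(ℝ, E) x}
    (h : ∀ X : Π x : M, TangentSpace 𝓘(ℝ, E) x, SmoothField X → SmoothField fun x => A x (X x)) :
    SmoothEnd A := contMDiff_hom_of_apply A h

/-- The action of a smooth `(1,1)`-tensor on smooth vector fields. -/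
noncomputable def SmoothEnd.toLinearMap {A : Π x : M, TangentSpace 𝓘(ℝ, E) x →L[ℝ] TangentSpace 𝓘(ℝ, E) x}
    (hA : SmoothEnd A) : smoothFields E M →ₗ[smoothFunctions E M] smoothFields E M where
  toFun X := ⟨fun x => A x (X.1 x), hA.apply X.2⟩
  map_add' X Y := by ext x; exact map_add _ _ _
  map_smul' c X := by ext x; exact map_smul _ _ _

theorem smoothFields_sum_apply {ι : Type*} (t : Finset ι) (X : ι → smoothFields E M) (x : M) :
    (∑ i ∈ t, X i).1 x = ∑ i ∈ t, (X i).1 x := by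
  classical
  induction t using Finset.induction_on with
  | empty => rfl
  | insert a t ha ih => rw [Finset.sum_insert ha, Finset.sum_insert ha, ← ih]; rfl

namespace WeakMetricFStructure

variable {g : Metric 𝓘(ℝ, E) M} {n s : ℕ} (S : WeakMetricFStructure g n s)

/-- The compatibility relation gives $|f\xi_i|^2=1-1=0$. -/
theorem f_ξ (i : Fin s) (x : M) : S.f x (S.ξ i x) = 0 := by
  by_contra h
  have h1 := g.pos x _ h
  rw [S.compat, S.Q_ξ, S.ξ_orthonormal] at h1
  simp [S.η_ξ] at h1

theorem η_eq (i : Fin s) (x : M) (v : TangentSpace 𝓘(ℝ, E) x) :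
    S.η i x v = g.inner x v (S.ξ i x) := by
  have h1 := S.compat x v (S.ξ i x)
  rw [S.f_ξ, S.Q_ξ] at h1
  simp [S.η_ξ] at h1
  linarith

theorem mem_contactDist {x : M} {v : TangentSpace 𝓘(ℝ, E) x} :
    v ∈ S.contactDist x ↔ ∀ i, g.inner x v (S.ξ i x) = 0 := by
  simp [contactDist, S.η_eq]

theorem Q_eq (x : M) (v : TangentSpace 𝓘(ℝ, E) x) :
    S.Q x v = - S.f x (S.f x v) + ∑ i, g.inner x v (S.ξ i x) • S.ξ i x := by
  rw [S.f_sq]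
  simp [S.η_eq]

/-- The hypotheses on a weak nearly `C`-structure. -/
structure Adapted : Prop where
  nearly : S.IsWeakNearlyC
  comm : S.ReebCommute
  flat : S.ReebConnectionFlat
  parallel : S.QParallelOnContact
  curv : S.CurvatureCondition

variable [T2Space M] {S} (hS : S.Adapted)
include hS

/-- The algebraic structure on the module of vector fields. -/
noncomputable def Adapted.toModule : WeakNearlyModule (fieldModule g) s where
  f := S.f_smooth.toLinearMap
  Q := S.Q_smooth.toLinearMap
  ξ i := ⟨S.ξ i, S.ξ_smooth i⟩
  f_skew X Y := by ext x; exact S.f_skew _ _ _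
  Q_symm X Y := by ext x; exact S.Q_selfAdjoint _ _ _
  ortho i j := by
    ext x
    refine (S.ξ_orthonormal i j x).trans ?_
    split_ifs <;> rfl
  f_sq X := by
    ext x
    refine (S.f_sq x (X.1 x)).trans ?_
    change _ = - S.Q x (X.1 x) + (∑ i, _ : smoothFields E M).1 x
    rw [smoothFields_sum_apply]
    congr 1
    exact Finset.sum_congr rfl fun i _ => congrArg (· • S.ξ i x) (S.η_eq i x (X.1 x))
  Q_ξ i := by ext x; exact S.Q_ξ i x
  f_ξ i := by ext x; exact S.f_ξ i x
  nearly X Y := by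
    ext x
    exact eq_neg_of_add_eq_zero_left (hS.nearly X.1 Y.1 X.2 Y.2 x)
  comm i j := by
    ext x
    refine sub_eq_zero.1 ?_
    exact (leviCivita_torsion_free g (S.ξ_smooth i).mdiffAt (S.ξ_smooth j).mdiffAt).trans
      (hS.comm i j x)
  flat X i j := by ext x; exact hS.flat X.1 X.2 i j x
  Q_par X Y hY := by
    ext x
    refine sub_eq_zero.1 (hS.parallel X.1 Y.1 X.2 Y.2 (fun y => ?_) x)
    rw [S.mem_contactDist]
    exact fun i => congrFun (congrArg Subtype.val (hY i)) y
  curv_cond X Y Z hX hY hZ i := by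
    have mem : ∀ W : smoothFields E M, (∀ i, (fieldModule g).G W ⟨S.ξ i, S.ξ_smooth i⟩ = 0) →
        ∀ x, W.1 x ∈ S.contactDist x := fun W hW x =>
      S.mem_contactDist.2 fun i => congrFun (congrArg Subtype.val (hW i)) x
    ext x
    have h1 := S.mem_contactDist.1
      (hS.curv X.1 Y.1 Z.1 X.2 Y.2 Z.2 (mem X hX) (mem Y hY) (mem Z hZ) x) i
    have h2 := leviCivita_torsion_free g
      (S.Q_smooth.toLinearMap X - X : smoothFields E M).2.mdiffAt (Y.2.mdiffAt (x := x))
    rw [curvature] at h1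
    refine Eq.trans ?_ h1
    change g.inner x (leviCivita g _ x _ - leviCivita g _ x _ - leviCivita g _ x
      (leviCivita g Y.1 x ((S.Q_smooth.toLinearMap X - X).1 x) -
        leviCivita g (S.Q_smooth.toLinearMap X - X).1 x (Y.1 x))) _ = _
    rw [h2]
    rfl

theorem Adapted.h_skew (i : Fin s) (x : M) (v w : TangentSpace 𝓘(ℝ, E) x) :
    g.inner x (S.h i x v) w = - g.inner x v (S.h i x w) := by
  obtain ⟨V, hV, rfl⟩ := exists_smooth_extension v
  obtain ⟨W, hW, rfl⟩ := exists_smooth_extension w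
  exact congrFun (congrArg Subtype.val (hS.toModule.h_skew i ⟨V, hV⟩ ⟨W, hW⟩)) x

theorem Adapted.h_ξ (i j : Fin s) (x : M) : S.h i x (S.ξ j x) = 0 :=
  congrFun (congrArg Subtype.val (hS.toModule.h_ξ i j)) x

theorem Adapted.inner_h_ξ (i j : Fin s) (x : M) (v : TangentSpace 𝓘(ℝ, E) x) :
    g.inner x (S.h i x v) (S.ξ j x) = 0 := by
  rw [hS.h_skew, hS.h_ξ, map_zero, neg_zero]

theorem Adapted.h_comm (i j : Fin s) (x : M) (v : TangentSpace 𝓘(ℝ, E) x) :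
    S.h i x (S.h j x v) = S.h j x (S.h i x v) := by
  obtain ⟨V, hV, rfl⟩ := exists_smooth_extension v
  exact congrFun (congrArg Subtype.val (hS.toModule.h_comm i j ⟨V, hV⟩)) x

theorem Adapted.f_h (i : Fin s) (x : M) (v : TangentSpace 𝓘(ℝ, E) x) :
    S.f x (S.h i x v) = - S.h i x (S.f x v) := by
  obtain ⟨V, hV, rfl⟩ := exists_smooth_extension v
  exact congrFun (congrArg Subtype.val (hS.toModule.f_h i ⟨V, hV⟩)) x

theorem Adapted.smoothEnd_h (i : Fin s) : SmoothEnd (S.h i) :=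
  .of_apply fun _ hX => SmoothField.leviCivita g hX (S.ξ_smooth i)

theorem Adapted.covEnd_Q {X Y : Π x : M, TangentSpace 𝓘(ℝ, E) x} (hX : SmoothField X)
    (hY : SmoothField Y) (x : M) : covEnd g S.Q X Y x = 0 :=
  congrFun (congrArg Subtype.val (hS.toModule.covDer_Q ⟨X, hX⟩ ⟨Y, hY⟩)) x

theorem Adapted.covEnd_h {X Y : Π x : M, TangentSpace 𝓘(ℝ, E) x} (hX : SmoothField X)
    (hY : SmoothField Y) (i : Fin s) (x : M) : covEnd g (S.h i) X Y x =
      ∑ j, (g.inner x (Y x) (S.h i x (S.h j x (X x))) • S.ξ j x -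
        g.inner x (Y x) (S.ξ j x) • S.h i x (S.h j x (X x))) := by
  have := congrFun (congrArg Subtype.val (hS.toModule.covDer_h i ⟨X, hX⟩ ⟨Y, hY⟩)) x
  rw [smoothFields_sum_apply] at this
  exact this

end WeakMetricFStructure

end Pointwise

/-! ### Tensors parallel for a metric connection. -/

section Parallel

variable {E : Type*} [NormedAddCommGroup E] [NormedSpace ℝ E] [FiniteDimensional ℝ E]
  {M : Type u} [TopologicalSpace M] [ChartedSpace E M] [IsManifold 𝓘(ℝ, E) ∞ M]

/-- In a chart this is the mean value theorem on a ball around the image of $p$. -/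
theorem eventually_eq_of_mvfderiv_eq_zero {u : M → ℝ} {p : M}
    (hu : ∀ᶠ x in 𝓝 p, MDiffAt u x) (h : ∀ᶠ x in 𝓝 p, d% u x = 0) :
    ∀ᶠ x in 𝓝 p, u x = u p := by
  set c := extChartAt 𝓘(ℝ, E) p with hc
  have hcont : ContinuousAt c.symm (c p) := continuousAt_extChartAt_symm p
  have hev : ∀ᶠ z in 𝓝 (c p), z ∈ c.target ∧ MDiffAt u (c.symm z) ∧ d% u (c.symm z) = 0 := by
    refine Filter.Eventually.and (extChartAt_target_mem_nhds p) ?_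
    rw [ContinuousAt, hc, extChartAt_to_inv p] at hcont
    exact hcont.eventually (hu.and h)
  obtain ⟨r, hr, hball⟩ := Metric.eventually_nhds_iff_ball.1 hev
  have hd : ∀ z ∈ Metric.ball (c p) r, HasFDerivAt (u ∘ c.symm) (0 : E →L[ℝ] ℝ) z := by
    intro z hz
    obtain ⟨h1, h2, h3⟩ := hball z hz
    have h4 : MDiffAt c.symm z := by
      have := mdifferentiableWithinAt_extChartAt_symm (I := 𝓘(ℝ, E)) h1
      rwa [modelWithCornersSelf_coe, Set.range_id, mdifferentiableWithinAt_univ] at this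
    have h5 := mvfderiv_comp z h2 h4
    rw [h3] at h5
    have h6 : DifferentiableAt ℝ (u ∘ c.symm) z :=
      (MDifferentiableAt.comp z h2 h4).differentiableAt
    have h7 : fderiv ℝ (u ∘ c.symm) z = 0 := by
      rw [← mfderiv_eq_fderiv]
      exact h5
    rw [← h7]
    exact h6.hasFDerivAt
  have hconst : ∀ z ∈ Metric.ball (c p) r, (u ∘ c.symm) z = (u ∘ c.symm) (c p) := fun z hz =>
    (convex_ball (c p) r).is_const_of_fderivWithin_eq_zero (𝕜 := ℝ)
    (fun z hz => (hd z hz).differentiableAt.differentiableWithinAt)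
    (fun z hz => (hd z hz).hasFDerivWithinAt.fderivWithin
      (Metric.isOpen_ball.uniqueDiffWithinAt hz)) hz (Metric.mem_ball_self hr)
  filter_upwards [(continuousAt_extChartAt (I := 𝓘(ℝ, E)) p).eventually
    (Metric.ball_mem_nhds (c p) hr), extChartAt_source_mem_nhds (I := 𝓘(ℝ, E)) p] with x hx hxs
  have h1 := hconst _ hx
  simp only [Function.comp_apply] at h1
  rwa [c.left_inv hxs, hc, extChartAt_to_inv p] at h1

theorem mvfderiv_finset_sum {ι : Type*} (t : Finset ι) {u : ι → M → ℝ} {x : M}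
    (hu : ∀ a, MDiffAt (u a) x) : d% (fun y => ∑ a ∈ t, u a y) x = ∑ a ∈ t, d% (u a) x := by
  classical
  have key : MDiffAt (fun y : M => ∑ a ∈ t, u a y) x ∧
      d% (fun y : M => ∑ a ∈ t, u a y) x = ∑ a ∈ t, d% (u a) x := by
    induction t using Finset.induction_on with
    | empty => exact ⟨mdifferentiableAt_const, by simp [mvfderiv_const]⟩
    | insert a t ha ih =>
      simp only [Finset.sum_insert ha]
      exact ⟨(hu a).add ih.1, (mvfderiv_fun_add (hu a) ih.1).trans (by rw [ih.2])⟩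
  exact key.2

/-- The Gram determinant turns independence of fields into the nonvanishing of a continuous
function, hence an open condition. -/
theorem linearIndependent_iff_det_gram (g : Metric 𝓘(ℝ, E) M) {x : M} {ι : Type*} [Fintype ι]
    [DecidableEq ι] (v : ι → TangentSpace 𝓘(ℝ, E) x) :
    LinearIndependent ℝ v ↔ (Matrix.of fun a b => g.inner x (v a) (v b)).det ≠ 0 := by
  have key : ∀ c : ι → ℝ, (Matrix.of fun a b => g.inner x (v a) (v b)).mulVec c =
      fun a => g.inner x (v a) (∑ b, c b • v b) := by
    intro c
    ext a
    simp [Matrix.mulVec, dotProduct, map_sum, mul_comm]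
  rw [ne_eq, ← Matrix.exists_mulVec_eq_zero_iff, Fintype.linearIndependent_iff]
  constructor
  · rintro h ⟨c, hc, h0⟩
    rw [key] at h0
    refine hc (funext fun i => h c ?_ i)
    by_contra hne
    have h1 := g.pos x _ hne
    have h2 : ∀ a, g.inner x (v a) (∑ b, c b • v b) = 0 := fun a => congrFun h0 a
    have h3 : g.inner x (∑ b, c b • v b) (∑ b, c b • v b) = 0 := by
      conv_lhs => enter [1]; rw [map_sum]
      rw [sum_apply]
      exact Finset.sum_eq_zero fun a _ => by rw [map_smul, smul_apply, h2, smul_zero]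
    exact h1.ne' h3
  · intro h c hc i
    by_contra hne
    refine h ⟨c, fun h0 => hne (congrFun h0 i), ?_⟩
    rw [key, hc]
    ext a
    simp

theorem eventually_linearIndependent (g : Metric 𝓘(ℝ, E) M) {ι : Type*} [Fintype ι]
    {V : ι → Π x : M, TangentSpace 𝓘(ℝ, E) x} (hV : ∀ a, SmoothField (V a)) {p : M}
    (h : LinearIndependent ℝ fun a => V a p) :
    ∀ᶠ x in 𝓝 p, LinearIndependent ℝ fun a => V a x := by
  classical
  simp only [linearIndependent_iff_det_gram g] at h ⊢
  refine ContinuousAt.eventually_ne ?_ h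
  refine Continuous.continuousAt ?_
  refine Continuous.matrix_det ?_
  refine continuous_matrix fun a b => ?_
  exact ((hV a).inner g (hV b)).continuous

/-- `A` is parallel for the metric connection `∇ + τ`. -/
structure IsParallel (g : Metric 𝓘(ℝ, E) M)
    (τ : Π x : M, TangentSpace 𝓘(ℝ, E) x → TangentSpace 𝓘(ℝ, E) x →ₗ[ℝ] TangentSpace 𝓘(ℝ, E) x)
    (A : Π x : M, TangentSpace 𝓘(ℝ, E) x →L[ℝ] TangentSpace 𝓘(ℝ, E) x) : Prop where
  smooth : SmoothEnd A
  covEnd_eq : ∀ X Y : Π x : M, TangentSpace 𝓘(ℝ, E) x, SmoothField X → SmoothField Y → ∀ x,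
    covEnd g A X Y x = A x (τ x (X x) (Y x)) - τ x (X x) (A x (Y x))

namespace IsParallel

variable [T2Space M] {g : Metric 𝓘(ℝ, E) M}
    {τ : Π x : M, TangentSpace 𝓘(ℝ, E) x → TangentSpace 𝓘(ℝ, E) x →ₗ[ℝ] TangentSpace 𝓘(ℝ, E) x}
    {A B : Π x : M, TangentSpace 𝓘(ℝ, E) x →L[ℝ] TangentSpace 𝓘(ℝ, E) x}

theorem leviCivita_apply (hA : IsParallel g τ A) {X Y : Π x : M, TangentSpace 𝓘(ℝ, E) x}
    (hX : SmoothField X) (hY : SmoothField Y) (x : M) :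
    leviCivita g (fun y => A y (Y y)) x (X x) = A x (leviCivita g Y x (X x)) +
      (A x (τ x (X x) (Y x)) - τ x (X x) (A x (Y x))) := by
  rw [← hA.covEnd_eq X Y hX hY, covEnd, add_sub_cancel]

theorem id : IsParallel g τ fun x => ContinuousLinearMap.id ℝ (TangentSpace 𝓘(ℝ, E) x) where
  smooth := .of_apply fun _ hX => hX
  covEnd_eq X Y hX hY x := by simp [covEnd]

theorem add (hA : IsParallel g τ A) (hB : IsParallel g τ B) :
    IsParallel g τ fun x => A x + B x where
  smooth := .of_apply fun _ hX => (hA.smooth.apply hX).add (hB.smooth.apply hX)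
  covEnd_eq X Y hX hY x := by
    have h1 := leviCivita_add g (hA.smooth.apply hY).mdiffAt ((hB.smooth.apply hY).mdiffAt (x := x))
    simp only [covEnd, add_apply, h1, hA.leviCivita_apply hX hY, hB.leviCivita_apply hX hY, map_add]
    abel

theorem smul (hA : IsParallel g τ A) (c : ℝ) : IsParallel g τ fun x => c • A x where
  smooth := .of_apply fun _ hX => SmoothField.smul (c := fun _ => c) contMDiff_const
    (hA.smooth.apply hX)
  covEnd_eq X Y hX hY x := by
    have h1 := leviCivita_smul g (c := fun _ => c) mdifferentiableAt_const
      ((hA.smooth.apply hY).mdiffAt (x := x)) (X x)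
    simp only [covEnd, smul_apply, h1, hA.leviCivita_apply hX hY, mvfderiv_const, map_smul,
      smul_add, smul_sub]
    simp

theorem comp (hA : IsParallel g τ A) (hB : IsParallel g τ B) :
    IsParallel g τ fun x => A x ∘L B x where
  smooth := .of_apply fun _ hX => hA.smooth.apply (hB.smooth.apply hX)
  covEnd_eq X Y hX hY x := by
    simp only [covEnd, ContinuousLinearMap.comp_apply, hA.leviCivita_apply hX (hB.smooth.apply hY),
      hB.leviCivita_apply hX hY, map_add, map_sub]
    abel

theorem sub (hA : IsParallel g τ A) (hB : IsParallel g τ B) :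
    IsParallel g τ fun x => A x - B x := by
  have := hA.add (hB.smul (-1))
  simpa only [neg_smul, one_smul, ← sub_eq_add_neg] using this

/-- Parallel tensors form an algebra over $\mathbb R$. -/
theorem aeval (hA : IsParallel g τ A) (r : Polynomial ℝ) :
    IsParallel g τ fun x => Polynomial.aeval (A x) r := by
  induction r using Polynomial.induction_on' with
  | add r q h1 h2 => simpa only [map_add] using h1.add h2
  | monomial k c =>
    have hpow : IsParallel g τ fun x => A x ^ k := by
      induction k with
      | zero => simp only [pow_zero]; exact IsParallel.id
      | succ k ih => simp only [pow_succ]; exact ih.comp hA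
    have := hpow.smul c
    simpa only [Polynomial.aeval_monomial, ← Algebra.smul_def] using this

/-- A parallel tensor vanishing at a point vanishes near it. -/
theorem eventually_eq_zero (hA : IsParallel g τ A)
    (hτ : ∀ x v w z, g.inner x (τ x v w) z = - g.inner x w (τ x v z)) {p : M} (h0 : A p = 0) :
    ∀ᶠ x in 𝓝 p, A x = 0 := by
  obtain ⟨e, he, ho⟩ := exists_orthonormal_frame g p
  -- The squared norm of $A$ in an orthonormal frame; it is locally constant because the connection
  -- is metric and $A$ is parallel.
  set u : M → ℝ := fun x => ∑ a, g.inner x (A x (e a x)) (A x (e a x)) with hu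
  have hsm : ∀ a, SmoothField fun x => A x (e a x) := fun a => hA.smooth.apply (he a)
  have hcu : CMDiff ∞ u := by
    have : u = ∑ a, fun x => g.inner x (A x (e a x)) (A x (e a x)) := by
      ext x; simp [hu]
    rw [this]
    exact contMDiff_finsetSum' fun a _ => SmoothField.inner g (hsm a) (hsm a)
  have hd : ∀ᶠ x in 𝓝 p, d% u x = 0 := by
    filter_upwards [ho.eventually_nhds] with x hx
    ext v
    obtain ⟨X, hX, rfl⟩ := exists_smooth_extension v
    have hox : OrthonormalAt g e x := hx.self_of_nhds
    -- The coefficients of $\nabla+\tau$ in the frame, skew because the frame is orthonormal near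
    -- $x$ and the connection is metric. In $du$ they are contracted with the symmetric matrix
    -- $g(Ae_a,Ae_b)$.
    let θ := fun a b => g.inner x (leviCivita g (e a) x (X x) + τ x (X x) (e a x)) (e b x)
    have hθ : ∀ a b, θ a b = - θ b a := by
      intro a b
      have h1 := leviCivita_metric g (hX.mdiffAt (x := x)) (he a).mdiffAt (he b).mdiffAt
      have h2 : (fun y => g.inner y (e a y) (e b y)) =ᶠ[𝓝 x] fun _ => if a = b then (1 : ℝ) else 0 :=
        hx.mono fun y hy => hy a b
      have h3 : d% (fun y => g.inner y (e a y) (e b y)) x (X x) = 0 := by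
        rw [mvfderiv, h2.mfderiv_eq]
        change d% (fun _ : M => if a = b then (1 : ℝ) else 0) x (X x) = 0
        rw [mvfderiv_const]
        rfl
      have h4 := hτ x (X x) (e a x) (e b x)
      have h5 := g.symm x (e a x) (leviCivita g (e b) x (X x))
      have h6 := g.symm x (e a x) (τ x (X x) (e b x))
      simp only [θ, map_add, add_apply]
      linarith
    have hexp : ∀ a, leviCivita g (e a) x (X x) + τ x (X x) (e a x) = ∑ b, θ a b • e b x :=
      fun a => hox.sum_eq _
    have hda : ∀ a, d% (fun y => g.inner y (A y (e a y)) (A y (e a y))) x (X x) =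
        2 * ∑ b, θ a b * g.inner x (A x (e b x)) (A x (e a x)) := by
      intro a
      have h1 := leviCivita_metric g (hX.mdiffAt (x := x)) (hsm a).mdiffAt (hsm a).mdiffAt
      have h2 : leviCivita g (fun y => A y (e a y)) x (X x) =
          ∑ b, θ a b • A x (e b x) - τ x (X x) (A x (e a x)) := by
        rw [hA.leviCivita_apply hX (he a), ← add_sub_assoc, ← map_add, hexp, map_sum]
        simp only [map_smul]
      have h3 := hτ x (X x) (A x (e a x)) (A x (e a x))
      have h4 := g.symm x (A x (e a x)) (τ x (X x) (A x (e a x)))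
      rw [h1, g.symm x (A x (e a x)), h2, map_sub, sub_apply, map_sum, sum_apply]
      simp only [map_smul, smul_apply, smul_eq_mul]
      linarith
    have hdu : d% u x = ∑ a, d% (fun y => g.inner y (A y (e a y)) (A y (e a y))) x := by
      exact mvfderiv_finset_sum _ fun a =>
        ((hsm a).inner g (hsm a)).mdifferentiable (by simp) x
    rw [hdu, sum_apply]
    simp only [hda, ← Finset.mul_sum]
    have h1 : ∑ a, ∑ b, θ a b * g.inner x (A x (e b x)) (A x (e a x)) =
        - ∑ a, ∑ b, θ a b * g.inner x (A x (e b x)) (A x (e a x)) := by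
      conv_lhs => rw [Finset.sum_comm]
      rw [← Finset.sum_neg_distrib]
      refine Finset.sum_congr rfl fun a _ => ?_
      rw [← Finset.sum_neg_distrib]
      refine Finset.sum_congr rfl fun b _ => ?_
      rw [hθ b a, g.symm x (A x (e b x))]
      ring
    have h2 : ∑ a, ∑ b, θ a b * g.inner x (A x (e b x)) (A x (e a x)) = 0 := by linarith
    rw [h2, mul_zero]
    rfl
  have hconst := eventually_eq_of_mvfderiv_eq_zero
    (.of_forall fun x => hcu.mdifferentiable (by simp) x) hd
  filter_upwards [hconst, ho] with x hx hox
  have h1 : u x = 0 := by rw [hx, hu]; simp [h0]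
  have hnn : ∀ a, 0 ≤ g.inner x (A x (e a x)) (A x (e a x)) := by
    intro a
    rcases eq_or_ne (A x (e a x)) 0 with h | h
    · simp [h]
    · exact (g.pos x _ h).le
  have h2 : ∀ a, A x (e a x) = 0 := by
    intro a
    by_contra hne
    have h3 := (Finset.sum_eq_zero_iff_of_nonneg fun a _ => hnn a).1 h1 a (Finset.mem_univ a)
    exact (g.pos x _ hne).ne' h3
  ext v
  rw [hox.sum_eq v, map_sum]
  simp [h2]

end IsParallel

end Parallel

theorem linearIndependent_sum_of_disjoint {V ι κ : Type*} [AddCommGroup V] [Module ℝ V]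
    {P K : Submodule ℝ V} (b : Basis ι ℝ P) (c : Basis κ ℝ K) (h : Disjoint P K) :
    LinearIndependent ℝ (Sum.elim (fun a => (b a : V)) (fun a => (c a : V))) := by
  refine LinearIndependent.sum_type (b.linearIndependent.map' P.subtype P.ker_subtype)
    (c.linearIndependent.map' K.subtype K.ker_subtype) (h.mono ?_ ?_)
  · rw [Submodule.span_le]; rintro _ ⟨a, rfl⟩; exact (b a).2
  · rw [Submodule.span_le]; rintro _ ⟨a, rfl⟩; exact (c a).2

/-! ### Kernels of parallel tensors as images of parallel projections. -/

section ParallelProjection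

variable {E : Type*} [NormedAddCommGroup E] [NormedSpace ℝ E] [FiniteDimensional ℝ E]
  {M : Type u} [TopologicalSpace M] [ChartedSpace E M] [IsManifold 𝓘(ℝ, E) ∞ M]

/-- A self-adjoint endomorphism `A` satisfies `A r(A) = 0` for a polynomial `r` with `r(0) = 1`. -/
theorem exists_polynomial_mul_eq_zero (g : Metric 𝓘(ℝ, E) M) {x : M}
    {A : TangentSpace 𝓘(ℝ, E) x →L[ℝ] TangentSpace 𝓘(ℝ, E) x}
    (hA : ∀ v w, g.inner x (A v) w = g.inner x v (A w)) :
    ∃ r : Polynomial ℝ, r.eval 0 = 1 ∧ ∀ v, A (Polynomial.aeval A r v) = 0 := by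
  -- Self-adjointness excludes nilpotent parts: $A^2v=0$ forces $g(Av,Av)=g(v,A^2v)=0$.
  have hpow : ∀ k : ℕ, ∀ v, (A ^ k) v = 0 → A v = 0 := by
    intro k
    induction k with
    | zero => intro v hv; rw [pow_zero] at hv; rw [show v = 0 from hv, map_zero]
    | succ k ih =>
      intro v hv
      rw [pow_succ] at hv
      have h1 := ih (A v) hv
      by_contra hne
      have h2 := g.pos x _ hne
      rw [hA, h1, map_zero] at h2
      exact lt_irrefl _ h2
  have hint : ∃ P : Polynomial ℝ, P ≠ 0 ∧ Polynomial.aeval A P = 0 := by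
    have : FiniteDimensional ℝ (TangentSpace 𝓘(ℝ, E) x →L[ℝ] TangentSpace 𝓘(ℝ, E) x) :=
      inferInstanceAs (FiniteDimensional ℝ (E →L[ℝ] E))
    have h1 := Algebra.IsIntegral.isIntegral (R := ℝ) A
    exact ⟨minpoly ℝ A, minpoly.ne_zero h1, minpoly.aeval ℝ A⟩
  obtain ⟨P, hP, hPA⟩ := hint
  -- Split the minimal polynomial as $X^mq$ with $q(0)\ne0$. Then $A^mq(A)=0$, so $A\,q(A)=0$ by
  -- `hpow`, and $r=q/q(0)$ works.
  obtain ⟨q, hq, hqX⟩ := Polynomial.exists_eq_pow_rootMultiplicity_mul_and_not_dvd P hP 0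
  rw [map_zero, sub_zero] at hq hqX
  rw [Polynomial.X_dvd_iff, Polynomial.coeff_zero_eq_eval_zero] at hqX
  refine ⟨Polynomial.C (q.eval 0)⁻¹ * q, by simp [hqX], fun v => ?_⟩
  have h1 : (A ^ P.rootMultiplicity 0) (Polynomial.aeval A q v) = 0 := by
    rw [hq, map_mul, map_pow, Polynomial.aeval_X] at hPA
    exact congrArg (fun B => B v) hPA
  have h2 := hpow _ _ h1
  rw [← Polynomial.smul_eq_C_mul, map_smul, smul_apply, map_smul, h2, smul_zero]

/-- Locally, `Δ` is the image of a parallel projection. -/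
def HasParallelProjection (g : Metric 𝓘(ℝ, E) M)
    (τ : Π x : M, TangentSpace 𝓘(ℝ, E) x → TangentSpace 𝓘(ℝ, E) x →ₗ[ℝ] TangentSpace 𝓘(ℝ, E) x)
    (Δ : Π x : M, Submodule ℝ (TangentSpace 𝓘(ℝ, E) x)) : Prop :=
  ∀ p, ∃ R : Π x : M, TangentSpace 𝓘(ℝ, E) x →L[ℝ] TangentSpace 𝓘(ℝ, E) x,
    IsParallel g τ R ∧ ∀ᶠ x in 𝓝 p, (∀ v, R x v ∈ Δ x) ∧ ∀ v ∈ Δ x, R x v = v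

variable [T2Space M] {g : Metric 𝓘(ℝ, E) M}
    {τ : Π x : M, TangentSpace 𝓘(ℝ, E) x → TangentSpace 𝓘(ℝ, E) x →ₗ[ℝ] TangentSpace 𝓘(ℝ, E) x}
    {Δ : Π x : M, Submodule ℝ (TangentSpace 𝓘(ℝ, E) x)}

/-- Near `p`, the kernel of a parallel self-adjoint tensor is the image of a polynomial in it. -/
theorem IsParallel.exists_polynomial
    {A : Π x : M, TangentSpace 𝓘(ℝ, E) x →L[ℝ] TangentSpace 𝓘(ℝ, E) x} (hA : IsParallel g τ A)
    (hτ : ∀ x v w z, g.inner x (τ x v w) z = - g.inner x w (τ x v z)) {p : M}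
    (hs : ∀ v w, g.inner p (A p v) w = g.inner p v (A p w)) :
    ∃ r : Polynomial ℝ, ∀ᶠ x in 𝓝 p, (∀ v, Polynomial.aeval (A x) r v ∈ (A x).ker) ∧
      ∀ v ∈ (A x).ker, Polynomial.aeval (A x) r v = v := by
  obtain ⟨r, hr0, hr⟩ := exists_polynomial_mul_eq_zero g hs
  refine ⟨r, ?_⟩
  -- The relation $A\,r(A)=0$ holds at $p$; its left side is parallel, so the same $r$ serves near
  -- $p$.
  filter_upwards [(hA.comp (hA.aeval r)).eventually_eq_zero hτ (p := p)
    (ContinuousLinearMap.ext hr)] with x hx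
  refine ⟨fun v => DFunLike.congr_fun hx v, fun v hv => ?_⟩
  have hv' : A x v = 0 := hv
  obtain ⟨q, hq⟩ : ∃ q : Polynomial ℝ, r = q * Polynomial.X + 1 := by
    obtain ⟨q, hq⟩ := Polynomial.dvd_iff_isRoot.2 (show (r - 1).IsRoot 0 by simp [hr0])
    rw [map_zero, sub_zero] at hq
    exact ⟨q, by rw [mul_comm, ← hq, sub_add_cancel]⟩
  rw [hq, map_add, map_mul, Polynomial.aeval_X, map_one]
  change Polynomial.aeval (A x) q (A x v) + v = v
  rw [hv', map_zero, zero_add]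

theorem HasParallelProjection.of_ker
    (hτ : ∀ x v w z, g.inner x (τ x v w) z = - g.inner x w (τ x v z))
    (h : ∀ p, ∃ A : Π x : M, TangentSpace 𝓘(ℝ, E) x →L[ℝ] TangentSpace 𝓘(ℝ, E) x,
      IsParallel g τ A ∧ (∀ v w, g.inner p (A p v) w = g.inner p v (A p w)) ∧
      ∀ᶠ x in 𝓝 p, Δ x = (A x).ker) : HasParallelProjection g τ Δ := by
  intro p
  obtain ⟨A, hA, hs, hk⟩ := h p
  obtain ⟨r, hr⟩ := hA.exists_polynomial hτ hs
  refine ⟨_, hA.aeval r, ?_⟩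
  filter_upwards [hr, hk] with x h1 h2
  rw [h2]
  exact h1

/-- Extend bases of $\Delta_p$ and $\ker R_p$ to fields $V_a$, $W_b$. The fields $RV_a$ and
$W_b-RW_b$ form a basis at $p$, hence nearby. There $R$ fixes the former and kills the latter, so
the $RV_a$ span the image of $R$, which is $\Delta$. -/
theorem HasParallelProjection.isSmoothDistribution (h : HasParallelProjection g τ Δ) :
    IsSmoothDistribution Δ := by
  intro p
  have : FiniteDimensional ℝ (TangentSpace 𝓘(ℝ, E) p) := inferInstanceAs (FiniteDimensional ℝ E)
  obtain ⟨R, hR, hev⟩ := h p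
  obtain ⟨hp1, hp2⟩ := hev.self_of_nhds
  set K : Submodule ℝ (TangentSpace 𝓘(ℝ, E) p) := (R p).ker with hK
  let b₁ := Module.finBasis ℝ (Δ p)
  let b₂ := Module.finBasis ℝ K
  choose V hV hVp using fun a => exists_smooth_extension (b₁ a : TangentSpace 𝓘(ℝ, E) p)
  choose W hW hWp using fun a => exists_smooth_extension (b₂ a : TangentSpace 𝓘(ℝ, E) p)
  let F : Fin (finrank ℝ (Δ p)) ⊕ Fin (finrank ℝ K) → Π x : M, TangentSpace 𝓘(ℝ, E) x :=
    Sum.elim (fun a x => R x (V a x)) (fun a x => W a x - R x (W a x))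
  have hF : ∀ a, SmoothField (F a) := by
    rintro (a | a)
    · exact hR.smooth.apply (hV a)
    · exact (hW a).sub (hR.smooth.apply (hW a))
  have hFp : (fun a => F a p) =
      Sum.elim (fun a => (b₁ a : TangentSpace 𝓘(ℝ, E) p)) (fun a => (b₂ a : TangentSpace 𝓘(ℝ, E) p)) := by
    ext a : 1
    rcases a with a | a
    · simp only [F, Sum.elim_inl, hVp]
      exact hp2 _ (b₁ a).2
    · simp only [F, Sum.elim_inr, hWp]
      rw [show R p (b₂ a) = 0 from (b₂ a).2, sub_zero]
  have hli : LinearIndependent ℝ fun a => F a p := by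
    rw [hFp]
    refine linearIndependent_sum_of_disjoint b₁ b₂ ?_
    rw [Submodule.disjoint_def]
    intro v hv hv'
    exact (hp2 v hv).symm.trans hv'
  have hcard : finrank ℝ (Δ p) + finrank ℝ K = finrank ℝ E := by
    have h1 := (R p).toLinearMap.finrank_range_add_finrank_ker
    have h2 : (R p).toLinearMap.range = Δ p := by
      ext v
      exact ⟨fun ⟨w, hw⟩ => hw ▸ hp1 w, fun hv => ⟨v, hp2 v hv⟩⟩
    rw [h2] at h1
    exact h1
  refine ⟨_, fun a => F (Sum.inl a), fun a => hF _, ?_⟩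
  filter_upwards [eventually_linearIndependent g hF hli, hev] with x hx hxR
  refine ⟨hx.comp _ Sum.inl_injective, le_antisymm ?_ ?_⟩
  · rw [Submodule.span_le]
    rintro _ ⟨a, rfl⟩
    exact hxR.1 _
  · intro v hv
    have : FiniteDimensional ℝ (TangentSpace 𝓘(ℝ, E) x) := inferInstanceAs (FiniteDimensional ℝ E)
    have htop : Submodule.span ℝ (Set.range fun a => F a x) = ⊤ := by
      refine hx.span_eq_top_of_card_eq_finrank' ?_
      rw [Fintype.card_sum, Fintype.card_fin, Fintype.card_fin, hcard]
      rfl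
    have hv2 : v ∈ Submodule.span ℝ (Set.range fun a => F a x) := by rw [htop]; trivial
    obtain ⟨c, hc⟩ := (Submodule.mem_span_range_iff_exists_fun ℝ).1 hv2
    rw [← hxR.2 v hv, ← hc, map_sum, Fintype.sum_sum_type]
    have h0 : ∀ a, R x (F (Sum.inr a) x) = 0 := by
      intro a
      simp only [F, Sum.elim_inr, map_sub]
      rw [hxR.2 _ (hxR.1 _), sub_self]
    simp only [map_smul, h0, smul_zero, Finset.sum_const_zero, add_zero]
    refine Submodule.sum_mem _ fun a _ => Submodule.smul_mem _ _ ?_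
    rw [show R x (F (Sum.inl a) x) = F (Sum.inl a) x from hxR.2 _ (hxR.1 _)]
    exact Submodule.subset_span ⟨a, rfl⟩

section Along

variable {E' : Type*} [NormedAddCommGroup E'] [NormedSpace ℝ E'] {H' : Type*} [TopologicalSpace H']
  {I' : ModelWithCorners ℝ E' H'} {L : Type*} [TopologicalSpace L] [ChartedSpace H' L]

/-- The derivative, along a map, of a vector field vanishing along that map is zero. -/
theorem leviCivita_eq_zero_of_along {ι : L → M} {x : L}
    (hι : MDifferentiableAt I' 𝓘(ℝ, E) ι x)
    {V : Π x : M, TangentSpace 𝓘(ℝ, E) x} (hV : SmoothField V)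
    (h : ∀ᶠ y in 𝓝 x, V (ι y) = 0) (v : TangentSpace I' x) :
    leviCivita g V (ι x) (mfderiv I' 𝓘(ℝ, E) ι x v) = 0 := by
  refine metric_ext g fun z => ?_
  obtain ⟨Z, hZ, rfl⟩ := exists_smooth_extension z
  obtain ⟨X, hX, hXv⟩ := exists_smooth_extension (mfderiv I' 𝓘(ℝ, E) ι x v)
  have h1 := leviCivita_metric g (hX.mdiffAt (x := ι x)) hV.mdiffAt hZ.mdiffAt
  rw [hXv, h.self_of_nhds, map_zero, zero_apply, add_zero] at h1
  rw [map_zero, zero_apply, ← h1]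
  have h2 : MDiffAt (fun y : M => g.inner y (V y) (Z y)) (ι x) :=
    (hV.inner g hZ).mdifferentiable (by simp) _
  rw [← mvfderiv_comp_apply x h2 hι, mvfderiv]
  have h3 : (fun y => g.inner y (V y) (Z y)) ∘ ι =ᶠ[𝓝 x] fun _ => (0 : ℝ) := by
    filter_upwards [h] with y hy
    simp [hy]
  rw [h3.mfderiv_eq]
  change mvfderiv I' (fun _ : L => (0 : ℝ)) x v = 0
  rw [mvfderiv_const]
  rfl

/-- Along the map $\iota$ the field $RY-Y$ vanishes, hence so does its derivative in a tangent
direction. Therefore $\nabla_XY=\nabla_X(RY)=R(\nabla_XY+\tau_XY)-\tau_XY$ at the point, which is in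
$\Delta$. Taking the identity for $\iota$ gives involutivity; an integral manifold gives total
geodesy. -/
theorem HasParallelProjection.leviCivita_mem (h : HasParallelProjection g τ Δ)
    (hΔ : ∀ x, ∀ v ∈ Δ x, ∀ w ∈ Δ x, τ x v w ∈ Δ x) {ι : L → M} {x : L}
    (hι : MDifferentiableAt I' 𝓘(ℝ, E) ι x)
    {X Y : Π x : M, TangentSpace 𝓘(ℝ, E) x} (hX : SmoothField X) (hY : SmoothField Y)
    (hXι : X (ι x) ∈ (mfderiv I' 𝓘(ℝ, E) ι x).range) (hXΔ : X (ι x) ∈ Δ (ι x))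
    (hYΔ : ∀ᶠ y in 𝓝 x, Y (ι y) ∈ Δ (ι y)) :
    leviCivita g Y (ι x) (X (ι x)) ∈ Δ (ι x) := by
  obtain ⟨R, hR, hev⟩ := h (ι x)
  have hRY : SmoothField fun y => R y (Y y) := hR.smooth.apply hY
  have hev' : ∀ᶠ y in 𝓝 x, R (ι y) (Y (ι y)) - Y (ι y) = 0 := by
    filter_upwards [hι.continuousAt.eventually hev, hYΔ] with y h1 h2
    rw [h1.2 _ h2, sub_self]
  obtain ⟨v, hv⟩ := hXι
  have h1 := leviCivita_eq_zero_of_along (g := g) hι (hRY.sub hY) hev' v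
  have hv' : mfderiv I' 𝓘(ℝ, E) ι x v = X (ι x) := hv
  rw [hv', leviCivita_sub g hRY.mdiffAt hY.mdiffAt, sub_apply, sub_eq_zero,
    hR.leviCivita_apply hX hY] at h1
  have h2 := hev.self_of_nhds
  rw [← h1, h2.2 _ hYΔ.self_of_nhds]
  exact add_mem (h2.1 _) (sub_mem (h2.1 _) (hΔ _ _ hXΔ _ hYΔ.self_of_nhds))

end Along

/-- Brackets of fields tangent to `Δ` are tangent to `Δ`. -/
def IsInvolutive (Δ : Π x : M, Submodule ℝ (TangentSpace 𝓘(ℝ, E) x)) : Prop :=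
  ∀ X Y : Π x : M, TangentSpace 𝓘(ℝ, E) x, SmoothField X → SmoothField Y → ∀ x,
    (∀ᶠ y in 𝓝 x, X y ∈ Δ y ∧ Y y ∈ Δ y) → mlieBracket 𝓘(ℝ, E) X Y x ∈ Δ x

theorem HasParallelProjection.isInvolutive (h : HasParallelProjection g τ Δ)
    (hΔ : ∀ x, ∀ v ∈ Δ x, ∀ w ∈ Δ x, τ x v w ∈ Δ x) : IsInvolutive Δ := by
  intro X Y hX hY x hxy
  have hid : MDifferentiableAt 𝓘(ℝ, E) 𝓘(ℝ, E) (id : M → M) x := mdifferentiableAt_id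
  have hr : ∀ v : TangentSpace 𝓘(ℝ, E) x, v ∈ (mfderiv 𝓘(ℝ, E) 𝓘(ℝ, E) (id : M → M) x).range := by
    intro v
    rw [mfderiv_id]
    exact ⟨v, rfl⟩
  rw [← leviCivita_torsion_free g hX.mdiffAt hY.mdiffAt]
  exact sub_mem
    (h.leviCivita_mem hΔ hid hX hY (hr _) hxy.self_of_nhds.1 (hxy.mono fun y hy => hy.2))
    (h.leviCivita_mem hΔ hid hY hX (hr _) hxy.self_of_nhds.2 (hxy.mono fun y hy => hy.1))

theorem HasParallelProjection.isTotallyGeodesic (h : HasParallelProjection g τ Δ)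
    (hΔ : ∀ x, ∀ v ∈ Δ x, ∀ w ∈ Δ x, τ x v w ∈ Δ x) {k : ℕ} {L : Type w} [TopologicalSpace L]
    [ChartedSpace (EuclideanSpace ℝ (Fin k)) L] {ι : L → M}
    (hι : IsIntegralManifold (k := k) (I := 𝓘(ℝ, E)) Δ ι) : IsTotallyGeodesic (k := k) g ι := by
  intro X Y hX hY x hxy
  simp only [hι.range_mfderiv] at hxy ⊢
  have h1 : MDifferentiableAt (𝓡 k) 𝓘(ℝ, E) ι x := hι.contMDiff.mdifferentiable (by simp) x
  refine h.leviCivita_mem hΔ h1 hX hY ?_ hxy.self_of_nhds.1 (hxy.mono fun y hy => hy.2)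
  rw [hι.range_mfderiv]
  exact hxy.self_of_nhds.1

end ParallelProjection

/-! ### Total differential equations $Dy=G(y)$. -/

section TotalDifferentialEquation

open Metric Set NNReal

variable {E F : Type*} [NormedAddCommGroup E] [NormedSpace ℝ E] [CompleteSpace E]
  [NormedAddCommGroup F] [NormedSpace ℝ F]

/-- The Picard-Lindelöf theorem, with the solution staying in the ball. -/
theorem exists_solution_mem_closedBall {f : ℝ → E → E} {tmin tmax : ℝ} {t₀ : Icc tmin tmax}
    {x₀ : E} {a L K : ℝ≥0} (hf : IsPicardLindelof f t₀ x₀ a 0 L K) :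
    ∃ α : ℝ → E, α t₀ = x₀ ∧ (∀ t, α t ∈ closedBall x₀ a) ∧
      ∀ t ∈ Icc tmin tmax, HasDerivWithinAt α (f t (α t)) (Icc tmin tmax) t := by
  have hx : x₀ ∈ closedBall x₀ (0 : ℝ≥0) := mem_closedBall_self le_rfl
  obtain ⟨α, hα⟩ := ODE.FunSpace.exists_isFixedPt_next hf hx
  refine ⟨α.compProj, by rw [ODE.FunSpace.compProj_val, ← hα, ODE.FunSpace.next_apply₀],
    fun t => α.compProj_mem_closedBall hf.mul_max_le, fun t ht ↦ ?_⟩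
  apply ODE.hasDerivWithinAt_picard_Icc t₀.2 hf.continuousOn_uncurry
    α.continuous_compProj.continuousOn (fun _ ht' ↦ α.compProj_mem_closedBall hf.mul_max_le)
    x₀ ht |>.congr_of_mem _ ht
  intro t' ht'
  nth_rw 1 [← hα]
  rw [ODE.FunSpace.compProj_of_mem ht', ODE.FunSpace.next_apply]

/-- The bound is linear in the defect, so a defect of order $\|u\|^2$ gives an error of order
$\|u\|^2$ below. -/
theorem gronwallBound_zero_eq_mul (K ε x : ℝ) :
    gronwallBound 0 K ε x = ε * gronwallBound 0 K 1 x := by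
  by_cases hK : K = 0
  · subst hK; simp [gronwallBound_K0]
  · simp only [gronwallBound_of_K_ne_0 hK]; ring

theorem norm_sub_sub_le_of_lipschitzOnWith {V : Type*} [NormedAddCommGroup V] [NormedSpace ℝ V]
    {f : E → V} {f' : E → E →L[ℝ] V} {s : Set E} {C : ℝ≥0} (hs : Convex ℝ s)
    (hf : ∀ z ∈ s, HasFDerivAt f (f' z) z) (hf' : LipschitzOnWith C f' s) {z w : E}
    (hz : z ∈ s) (hw : w ∈ s) : ‖f w - f z - f' z (w - z)‖ ≤ C * ‖w - z‖ * ‖w - z‖ := by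
  have hsub : segment ℝ z w ⊆ s := hs.segment_subset hz hw
  refine (convex_segment z w).norm_image_sub_le_of_norm_hasFDerivWithin_le' (f' := f')
    (fun q hq => (hf q (hsub hq)).hasFDerivWithinAt) (fun q hq => ?_)
    (left_mem_segment ℝ z w) (right_mem_segment ℝ z w)
  refine (hf'.norm_sub_le (hsub hq) hz).trans ?_
  gcongr
  obtain ⟨θ, hθ, rfl⟩ := segment_eq_image' ℝ z w ▸ hq
  rw [add_sub_cancel_left, norm_smul, Real.norm_of_nonneg hθ.1]
  exact mul_le_of_le_one_left (norm_nonneg _) hθ.2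

theorem eventually_norm_lt_add_one {V : Type*} [NormedAddCommGroup V] {f : E → V} {a : E}
    (hf : ContinuousAt f a) : ∀ᶠ z in 𝓝 a, ‖f z‖ < ‖f a‖ + 1 :=
  hf.norm.eventually_lt continuousAt_const (lt_add_one _)

theorem eventually_norm_fderiv_lt {G : E → F →L[ℝ] E} {a : E}
    (hG : ContinuousAt (fderiv ℝ G) a) : ∀ᶠ z in 𝓝 a, ‖fderiv ℝ G z‖ < ‖fderiv ℝ G a‖ + 1 :=
  eventually_norm_lt_add_one (E := E) (V := E →L[ℝ] F →L[ℝ] E) hG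

/-- Data for the total differential equation `Dy = G(y)` on a closed ball. -/
structure TotalDifferentialEquation (G : E → F →L[ℝ] E) (G' : E → E →L[ℝ] F →L[ℝ] E) (a : E)
    (R : ℝ) (C : ℝ≥0) : Prop where
  R_pos : 0 < R
  hasFDerivAt : ∀ z ∈ closedBall a R, HasFDerivAt G (G' z) z
  norm_le : ∀ z ∈ closedBall a R, ‖G z‖ ≤ C
  norm_deriv_le : ∀ z ∈ closedBall a R, ‖G' z‖ ≤ C
  lipschitz : LipschitzOnWith C G' (closedBall a R)
  symm : ∀ z ∈ closedBall a R, ∀ u v, G' z (G z u) v = G' z (G z v) u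

namespace TotalDifferentialEquation

variable {G : E → F →L[ℝ] E} {G' : E → E →L[ℝ] F →L[ℝ] E} {a : E} {R : ℝ} {C : ℝ≥0}
  (h : TotalDifferentialEquation G G' a R C)
include h

theorem lipschitz_G : LipschitzOnWith C G (closedBall a R) :=
  (convex_closedBall a R).lipschitzOnWith_of_nnnorm_hasFDerivWithin_le
    (fun z hz => (h.hasFDerivAt z hz).hasFDerivWithinAt) (fun z hz => h.norm_deriv_le z hz)

theorem lipschitz_apply (x : F) :
    LipschitzOnWith (C * ‖x‖₊) (fun z => G z x) (closedBall a R) := by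
  refine LipschitzOnWith.of_dist_le_mul fun z hz w hw => ?_
  rw [dist_eq_norm, ← sub_apply]
  refine ((G z - G w).le_opNorm x).trans ?_
  have h1 := h.lipschitz_G.dist_le_mul z hz w hw
  rw [dist_eq_norm] at h1
  calc ‖G z - G w‖ * ‖x‖ ≤ C * dist z w * ‖x‖ := by gcongr
    _ = _ := by push_cast; ring

theorem exists_ray (x : F) (hx : C * ‖x‖ ≤ R / 2) :
    ∃ c : ℝ → E, c 0 = a ∧ (∀ t, c t ∈ closedBall a (R / 2)) ∧
      ∀ t ∈ Icc (0 : ℝ) 1, HasDerivWithinAt c (G (c t) x) (Icc 0 1) t := by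
  have hsub : closedBall a (R / 2) ⊆ closedBall a R :=
    closedBall_subset_closedBall (by linarith [h.R_pos])
  have hR : (0 : ℝ) ≤ R / 2 := by linarith [h.R_pos]
  have hpl : IsPicardLindelof (fun _ z => G z x) (⟨0, by simp⟩ : Icc (0 : ℝ) 1) a
      ⟨R / 2, hR⟩ 0 (C * ‖x‖₊) (C * ‖x‖₊) :=
    { lipschitzOnWith := fun _ _ => (h.lipschitz_apply x).mono hsub
      continuousOn := fun _ _ => continuousOn_const
      norm_le := fun _ _ z hz => by
        refine ((G z).le_opNorm x).trans ?_
        push_cast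
        gcongr
        exact h.norm_le z (hsub hz)
      mul_max_le := by simp; exact hx }
  exact exists_solution_mem_closedBall hpl

theorem remainder_le {z w : E} (hz : z ∈ closedBall a R) (hw : w ∈ closedBall a R) :
    ‖G w - G z - G' z (w - z)‖ ≤ C * ‖w - z‖ * ‖w - z‖ :=
  norm_sub_sub_le_of_lipschitzOnWith (convex_closedBall a R) h.hasFDerivAt h.lipschitz hz hw

/-- Put $y(x)=c_x(1)$, where $c_x$ solves $c'=G(c)x$ from $a$. To differentiate $y$ at $x$, the
curve $c_{x+u}$ is compared with the first-order guess $c_x(t)+tG(c_x(t))u$. Symmetry of $G'$ makes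
the guess an approximate solution with defect $O(\|u\|^2)$, and Gronwall's inequality gives
$y(x+u)-y(x)-G(y(x))u=O(\|u\|^2)$. -/
theorem exists_solution : ∃ δ > 0, ∃ y : F → E, y 0 = a ∧
    (∀ x ∈ ball (0 : F) δ, y x ∈ closedBall a (R / 2)) ∧
    ∀ x ∈ ball (0 : F) δ, HasFDerivAt y (G (y x)) x := by
  have hsub : closedBall a (R / 2) ⊆ closedBall a R :=
    closedBall_subset_closedBall (by linarith [h.R_pos])
  have hC1 : (0 : ℝ) < C + 1 := by positivity
  -- With this radius the rays stay in the ball of radius $R/2$ and the guesses below stay in the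
  -- ball of radius $R$. The $+1$ avoids dividing by zero when $C=0$.
  set δ : ℝ := R / (2 * (C + 1)) with hδ
  have hδpos : 0 < δ := div_pos h.R_pos (by positivity)
  have hCδ : ∀ u : F, ‖u‖ < δ → C * ‖u‖ ≤ R / 2 := by
    intro u hu
    have h1 : (C + 1) * δ = R / 2 := by rw [hδ]; field_simp
    rw [← h1]
    have := norm_nonneg u
    nlinarith [C.coe_nonneg]
  have hray : ∀ x : F, ∃ c : ℝ → E, ‖x‖ < δ → c 0 = a ∧ (∀ t, c t ∈ closedBall a (R / 2)) ∧
      ∀ t ∈ Icc (0 : ℝ) 1, HasDerivWithinAt c (G (c t) x) (Icc 0 1) t := by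
    intro x
    by_cases hx : ‖x‖ < δ
    · obtain ⟨c, hc⟩ := h.exists_ray x (hCδ x hx)
      exact ⟨c, fun _ => hc⟩
    · exact ⟨fun _ => a, fun hx' => absurd hx' hx⟩
  choose c hc using hray
  have hcI : ∀ x, ‖x‖ < δ → ∀ t ∈ Ico (0 : ℝ) 1, HasDerivWithinAt (c x) (G (c x t) x) (Ici t) t :=
    fun x hx t ht => ((hc x hx).2.2 t ⟨ht.1, ht.2.le⟩).mono_of_mem_nhdsWithin
      (Icc_mem_nhdsGE_of_mem ht)
  have hcc : ∀ x, ‖x‖ < δ → ContinuousOn (c x) (Icc 0 1) :=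
    fun x hx t ht => ((hc x hx).2.2 t ht).continuousWithinAt
  refine ⟨δ, hδpos, fun x => c x 1, ?_, fun x hx => ?_, fun x hx => ?_⟩
  · have h0 : ‖(0 : F)‖ < δ := by simpa using hδpos
    have hconst := constant_of_has_deriv_right_zero (hcc 0 h0) (fun t ht => by
      have := hcI 0 h0 t ht
      rwa [map_zero] at this)
    exact (hconst 1 (by simp)).trans (hc 0 h0).1
  · exact (hc x (mem_ball_zero_iff.1 hx)).2.1 1
  · rw [mem_ball_zero_iff] at hx
    set A : ℝ := C * C + C * (C * C) * δ with hA
    have key : ∀ u : F, ‖u‖ < δ → ‖x + u‖ < δ →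
        ‖c (x + u) 1 - c x 1 - G (c x 1) u‖ ≤
          A * gronwallBound 0 (C * δ) 1 1 * (‖u‖ * ‖u‖) := by
      intro u hu hxu
      set d : ℝ → E := fun t => c x t + t • G (c x t) u with hd
      have hmem : ∀ t, c x t ∈ closedBall a R := fun t => hsub ((hc x hx).2.1 t)
      have hGu : ∀ t, ‖G (c x t) u‖ ≤ C * ‖u‖ := fun t =>
        ((G (c x t)).le_opNorm u).trans (by gcongr; exact h.norm_le _ (hmem t))
      have htGu : ∀ t ∈ Icc (0 : ℝ) 1, ‖t • G (c x t) u‖ ≤ C * ‖u‖ := by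
        intro t ht
        rw [norm_smul, Real.norm_of_nonneg ht.1]
        exact (mul_le_of_le_one_left (norm_nonneg _) ht.2).trans (hGu t)
      have hdmem : ∀ t ∈ Icc (0 : ℝ) 1, d t ∈ closedBall a R := by
        intro t ht
        have h1 := (hc x hx).2.1 t
        rw [mem_closedBall_iff_norm] at h1 ⊢
        calc ‖d t - a‖ = ‖(c x t - a) + t • G (c x t) u‖ := by simp only [hd]; congr 1; abel
          _ ≤ R / 2 + R / 2 := (norm_add_le _ _).trans (add_le_add h1 ((htGu t ht).trans (hCδ u hu)))
          _ = R := by ring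
      have hdd : ∀ t ∈ Icc (0 : ℝ) 1, HasDerivWithinAt d
          (G (c x t) x + (G (c x t) u + t • G' (c x t) (G (c x t) x) u)) (Icc 0 1) t := by
        intro t ht
        have h1 := (hc x hx).2.2 t ht
        have h2 := (h.hasFDerivAt _ (hmem t)).comp_hasDerivWithinAt t h1
        have h3 := h2.clm_apply (hasDerivWithinAt_const t (Icc 0 1) u)
        have h4 := h1.add ((hasDerivWithinAt_id t (Icc 0 1)).smul h3)
        refine h4.congr_deriv ?_
        simp
        abel
      have hbound : ∀ t ∈ Ico (0 : ℝ) 1,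
          dist (G (c x t) x + (G (c x t) u + t • G' (c x t) (G (c x t) x) u)) (G (d t) (x + u))
            ≤ A * (‖u‖ * ‖u‖) := by
        intro t ht
        have ht' : t ∈ Icc (0 : ℝ) 1 := ⟨ht.1, ht.2.le⟩
        set z := c x t with hz
        have hrem := h.remainder_le (hmem t) (hdmem t ht')
        have hdz : d t - z = t • G z u := by rw [hd]; simp [hz]
        rw [← hz, hdz] at hrem
        -- The symmetry $G'(Gx)u=G'(Gu)x$ cancels the terms linear in $u$; a quadratic term and the
        -- Taylor remainder are left.
        have hexp : G z x + (G z u + t • G' z (G z x) u) - G (d t) (x + u) =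
            - (t • G' z (G z u) u) - (G (d t) - G z - G' z (t • G z u)) (x + u) := by
          have hs := h.symm z (hmem t) x u
          simp only [sub_apply, map_add, map_smul, smul_apply, hs]
          module
        rw [dist_eq_norm, hexp]
        have e1 : ‖t • G' z (G z u) u‖ ≤ C * C * (‖u‖ * ‖u‖) := by
          rw [norm_smul, Real.norm_of_nonneg ht.1]
          refine (mul_le_of_le_one_left (norm_nonneg _) ht.2.le).trans ?_
          calc ‖G' z (G z u) u‖ ≤ ‖G' z‖ * ‖G z u‖ * ‖u‖ := (G' z).le_opNorm₂ _ _
            _ ≤ C * (C * ‖u‖) * ‖u‖ := by gcongr; exacts [h.norm_deriv_le _ (hmem t), hGu t]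
            _ = _ := by ring
        have e2 : ‖(G (d t) - G z - G' z (t • G z u)) (x + u)‖ ≤
            C * (C * C) * δ * (‖u‖ * ‖u‖) := by
          refine (ContinuousLinearMap.le_opNorm _ _).trans ?_
          calc _ ≤ C * (C * ‖u‖) * (C * ‖u‖) * δ := by
                gcongr
                refine hrem.trans ?_
                gcongr <;> exact htGu t ht'
            _ = _ := by ring
        calc _ ≤ ‖t • G' z (G z u) u‖ + ‖(G (d t) - G z - G' z (t • G z u)) (x + u)‖ := by
              rw [← norm_neg (t • _)]
              exact norm_sub_le _ _
          _ ≤ _ := by rw [hA]; linarith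
      have hCxu : ((C * ‖x + u‖₊ : ℝ≥0) : ℝ) ≤ (C * ⟨δ, hδpos.le⟩ : ℝ≥0) := by
        push_cast
        change C * ‖x + u‖ ≤ C * δ
        gcongr
      have hgr := dist_le_of_approx_trajectories_ODE_of_mem
        (v := fun _ z => G z (x + u)) (s := fun _ => closedBall a R) (K := C * ⟨δ, hδpos.le⟩)
        (f := d) (g := c (x + u)) (a := 0) (b := 1) (δ := 0) (εf := A * (‖u‖ * ‖u‖)) (εg := 0)
        (fun t _ => (h.lipschitz_apply (x + u)).weaken hCxu)
        (fun t ht => (hdd t ht).continuousWithinAt)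
        (fun t ht => (hdd t ⟨ht.1, ht.2.le⟩).mono_of_mem_nhdsWithin (Icc_mem_nhdsGE_of_mem ht))
        hbound (fun t ht => hdmem t ⟨ht.1, ht.2.le⟩) (hcc _ hxu) (hcI _ hxu)
        (fun t _ => by simp) (fun t _ => hsub ((hc _ hxu).2.1 t))
        (by simp [hd, (hc x hx).1, (hc _ hxu).1]) 1 (by simp)
      rw [gronwallBound_zero_eq_mul, dist_comm, dist_eq_norm] at hgr
      have hd1 : c (x + u) 1 - d 1 = c (x + u) 1 - c x 1 - G (c x 1) u := by
        rw [hd]; simp only [one_smul]; abel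
      rw [hd1] at hgr
      refine hgr.trans (le_of_eq ?_)
      simp only [add_zero, sub_zero]
      change _ * gronwallBound 0 (C * δ) 1 1 = _
      ring
    rw [hasFDerivAt_iff_isLittleO_nhds_zero]
    refine Asymptotics.IsBigO.trans_isLittleO (g := fun u : F => ‖u‖ * ‖u‖) ?_ ?_
    · refine Asymptotics.IsBigO.of_bound (A * gronwallBound 0 (C * δ) 1 1) ?_
      have h1 : ∀ᶠ u : F in 𝓝 0, ‖u‖ < δ := by
        have := ball_mem_nhds (0 : F) hδpos
        filter_upwards [this] with u hu using mem_ball_zero_iff.1 hu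
      have h2 : ∀ᶠ u : F in 𝓝 0, ‖x + u‖ < δ := by
        have : ContinuousAt (fun u : F => ‖x + u‖) 0 := by fun_prop
        exact this.eventually_lt continuousAt_const (by simpa using hx)
      filter_upwards [h1, h2] with u hu1 hu2
      rw [Real.norm_of_nonneg (by positivity)]
      exact key u hu1 hu2
    · have := (Asymptotics.isLittleO_norm_left (f' := fun u : F => u) (g := fun _ : F => (1 : ℝ))
        (l := 𝓝 0)).2 ((Asymptotics.isLittleO_one_iff ℝ).2 Filter.tendsto_id)
      have h2 := this.mul_isBigO (Asymptotics.isBigO_refl (fun u : F => ‖u‖) (𝓝 0))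
      exact Asymptotics.isLittleO_norm_right.1 (by simpa using h2)

end TotalDifferentialEquation

/-- The integrable total differential equation `Dy = G(y)` has smooth local solutions. -/
theorem exists_contDiffOn_solution {G : E → F →L[ℝ] E} {a : E}
    (hG : ∀ᶠ z in 𝓝 a, ContDiffAt ℝ ∞ G z)
    (hsymm : ∀ᶠ z in 𝓝 a, ∀ u v, fderiv ℝ G z (G z u) v = fderiv ℝ G z (G z v) u)
    {p : E → Prop} (hp : ∀ᶠ z in 𝓝 a, p z) :
    ∃ δ > 0, ∃ y : F → E, y 0 = a ∧ (∀ x ∈ ball (0 : F) δ, p (y x)) ∧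
      (∀ x ∈ ball (0 : F) δ, HasFDerivAt y (G (y x)) x) ∧ ContDiffOn ℝ ∞ y (ball 0 δ) := by
  have hGa := hG.self_of_nhds
  have hG'a : ContDiffAt ℝ 1 (fderiv ℝ G) a :=
    hGa.fderiv_right (by rw [one_add_one_eq_two]; exact ENat.LEInfty.out)
  obtain ⟨K, t, ht, hK⟩ := hG'a.exists_lipschitzOnWith
  have hb1 : ∀ᶠ z in 𝓝 a, ‖G z‖ < ‖G a‖ + 1 :=
    eventually_norm_lt_add_one hGa.continuousAt
  have hb2 : ∀ᶠ z in 𝓝 a, ‖fderiv ℝ G z‖ < ‖fderiv ℝ G a‖ + 1 :=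
    eventually_norm_fderiv_lt hG'a.continuousAt
  obtain ⟨R, hR, hball⟩ := nhds_basis_closedBall.mem_iff.1
    (Filter.inter_mem ht ((((hG.and hsymm).and hp).and hb1).and hb2))
  -- One constant bounds $G$, its derivative and the Lipschitz constant of the derivative.
  let C : ℝ≥0 := K + ‖G a‖₊ + 1 + ‖fderiv ℝ G a‖₊
  have hC1 : (C : ℝ) = K + ‖G a‖ + 1 + ‖fderiv ℝ G a‖ := rfl
  have h : TotalDifferentialEquation G (fderiv ℝ G) a R C :=
    { R_pos := hR
      hasFDerivAt := fun z hz =>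
        ((hball hz).2.1.1.1.1.differentiableAt (by simp)).hasFDerivAt
      norm_le := fun z hz => by
        have h1 : ‖G z‖ < ‖G a‖ + 1 := (hball hz).2.1.2
        have h2 := norm_nonneg (fderiv ℝ G a)
        rw [hC1]
        linarith [K.coe_nonneg]
      norm_deriv_le := fun z hz => by
        have h1 : ‖fderiv ℝ G z‖ < ‖fderiv ℝ G a‖ + 1 := (hball hz).2.2
        have h2 := norm_nonneg (G a)
        rw [hC1]
        linarith [K.coe_nonneg]
      lipschitz := (hK.mono fun z hz => (hball hz).1).weaken (by
        rw [← NNReal.coe_le_coe, hC1]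
        have h1 := norm_nonneg (G a)
        have h2 := norm_nonneg (fderiv ℝ G a)
        linarith)
      symm := fun z hz => (hball hz).2.1.1.1.2 }
  obtain ⟨δ, hδ, y, hy0, hyB, hyd⟩ := h.exists_solution
  have hyB' : ∀ x ∈ ball (0 : F) δ, y x ∈ closedBall a R := fun x hx =>
    closedBall_subset_closedBall (by linarith) (hyB x hx)
  refine ⟨δ, hδ, y, hy0, fun x hx => (hball (hyB' x hx)).2.1.1.2, hyd, ?_⟩
  -- Bootstrap: $Dy=G\circ y$ is as regular as $y$, so $y$ gains one derivative at each step.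
  have hsm : ∀ n : ℕ, ContDiffOn ℝ n y (ball 0 δ) := by
    intro n
    induction n with
    | zero =>
      exact contDiffOn_zero.2 fun x hx => (hyd x hx).continuousAt.continuousWithinAt
    | succ n ih =>
      push_cast
      rw [contDiffOn_succ_iff_fderiv_of_isOpen isOpen_ball]
      refine ⟨fun x hx => (hyd x hx).differentiableAt.differentiableWithinAt, by simp, ?_⟩
      refine ContDiffOn.congr (f := G ∘ y) (fun x hx => ?_) fun x hx => (hyd x hx).fderiv
      exact ContDiffAt.comp_contDiffWithinAt x
        ((hball (hyB' x hx)).2.1.1.1.1.of_le (by exact_mod_cast le_top)) (ih x hx)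
  exact contDiffOn_infty.2 hsm

end TotalDifferentialEquation

/-! ### Frobenius' theorem. -/

section Frobenius

variable {E : Type*} [NormedAddCommGroup E] [NormedSpace ℝ E] [FiniteDimensional ℝ E]
  {M : Type u} [TopologicalSpace M] [ChartedSpace E M] [IsManifold 𝓘(ℝ, E) ∞ M] [T2Space M]
  {Δ : Π x : M, Submodule ℝ (TangentSpace 𝓘(ℝ, E) x)}

theorem exists_contMDiff_eventuallyEq_extChartAt (p : M) :
    ∃ φ : M → E, CMDiff ∞ φ ∧ ∀ᶠ x in 𝓝 p, φ x = extChartAt 𝓘(ℝ, E) p x := by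
  refine exists_contMDiff_eventuallyEq ?_
  filter_upwards [(isOpen_extChartAt_source (I := 𝓘(ℝ, E)) p).mem_nhds
    (mem_extChartAt_source p)] with x hx
  rw [extChartAt_source] at hx
  exact contMDiffAt_extChartAt' hx

/-- The linear map `v ↦ ∑ v_j dφ(Y_j)`. -/
noncomputable def frameMap {k : ℕ} (φ : M → E) (Y : Fin k → Π x : M, TangentSpace 𝓘(ℝ, E) x)
    (x : M) : EuclideanSpace ℝ (Fin k) →L[ℝ] E :=
  ∑ j, (EuclideanSpace.proj (𝕜 := ℝ) j).smulRight (d% φ x (Y j x))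

theorem frameMap_apply {k : ℕ} (φ : M → E) (Y : Fin k → Π x : M, TangentSpace 𝓘(ℝ, E) x)
    (x : M) (v : EuclideanSpace ℝ (Fin k)) :
    frameMap φ Y x v = d% φ x (∑ j, v j • Y j x) := by
  simp [frameMap, sum_apply]

theorem contMDiff_frameMap {k : ℕ} {φ : M → E} (hφ : CMDiff ∞ φ)
    {Y : Fin k → Π x : M, TangentSpace 𝓘(ℝ, E) x} (hY : ∀ j, SmoothField (Y j)) :
    CMDiff ∞ (frameMap φ Y) := by
  have h1 : ∀ j, CMDiff ∞ fun x : M => (EuclideanSpace.proj (𝕜 := ℝ) j).smulRight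
      (d% φ x (Y j x)) := fun j => by
    have := (ContinuousLinearMap.smulRightL ℝ (EuclideanSpace ℝ (Fin k)) E
      (EuclideanSpace.proj (𝕜 := ℝ) j)).contMDiff (n := ∞)
    exact this.comp (contMDiff_mvfderiv_apply hφ (hY j))
  have h2 : frameMap φ Y = ∑ j, fun x : M => (EuclideanSpace.proj (𝕜 := ℝ) j).smulRight
      (d% φ x (Y j x)) := by
    ext1 x
    simp [frameMap]
  rw [h2]
  exact contMDiff_finsetSum' fun j _ => h1 j

/-- A smooth distribution has local frames whose coordinates form a graph over `ℝ^k`. -/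
theorem IsSmoothDistribution.exists_graph_frame (hΔ : IsSmoothDistribution Δ) {p : M} {φ : M → E}
    (hφ : CMDiff ∞ φ) (hφp : Function.Injective (d% φ p)) :
    ∃ (k : ℕ) (Y : Fin k → Π x : M, TangentSpace 𝓘(ℝ, E) x)
      (q : E →L[ℝ] EuclideanSpace ℝ (Fin k)), (∀ j, SmoothField (Y j)) ∧
      ∀ᶠ x in 𝓝 p, Submodule.span ℝ (Set.range fun j => Y j x) = Δ x ∧
        ∀ v, q (frameMap φ Y x v) = v := by
  obtain ⟨k, e, he, hev⟩ := hΔ p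
  have hTp : (frameMap φ e p).toLinearMap.ker = ⊥ := by
    rw [LinearMap.ker_eq_bot']
    intro v hv
    have h1 : d% φ p (∑ j, v j • e j p) = 0 := (frameMap_apply φ e p v).symm.trans hv
    have h2 := hφp (h1.trans (map_zero _).symm)
    ext j
    exact Fintype.linearIndependent_iff.1 hev.self_of_nhds.1 v h2 j
  obtain ⟨q₀, hq₀⟩ := LinearMap.exists_leftInverse_of_injective _ hTp
  set q : E →L[ℝ] EuclideanSpace ℝ (Fin k) := LinearMap.toContinuousLinearMap q₀ with hq
  -- Since $q$ inverts the frame map on the left at $p$, $S(p)=1$ and $S$ is invertible nearby.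
  -- Changing the frame by $S^{-1}$ makes $q\circ d\varphi$ send it to the standard basis of
  -- $\mathbb R^k$.
  set S : M → EuclideanSpace ℝ (Fin k) →L[ℝ] EuclideanSpace ℝ (Fin k) :=
    fun x => q ∘L frameMap φ e x with hS
  have hSp : S p = 1 := by
    ext1 v
    exact congrArg (fun A => A v) hq₀
  have hSsm : CMDiff ∞ S := contMDiff_const.clm_comp (contMDiff_frameMap hφ he)
  have hunit : ∀ᶠ x in 𝓝 p, IsUnit (S x) := by
    refine hSsm.continuous.continuousAt.eventually (Units.isOpen.mem_nhds ?_)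
    rw [hSp]
    exact isUnit_one
  have hW : ∀ᶠ x in 𝓝 p, CMDiffAt ∞ (fun y : M => Ring.inverse (S y)) x := by
    filter_upwards [hunit] with x hx
    obtain ⟨a, ha⟩ := hx
    have h1 := contDiffAt_ringInverse ℝ (n := ∞) a
    rw [ha] at h1
    exact h1.contMDiffAt.comp x (hSsm x)
  have hY : ∀ j, ∃ V : Π x : M, TangentSpace 𝓘(ℝ, E) x, SmoothField V ∧
      ∀ᶠ x in 𝓝 p, V x = ∑ i, Ring.inverse (S x) (EuclideanSpace.single j 1) i • e i x := by
    intro j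
    refine exists_smoothField_eventuallyEq ?_
    filter_upwards [hW] with x hx
    have h1 : ∀ i, CMDiffAt ∞ (fun y : M =>
        Ring.inverse (S y) (EuclideanSpace.single j 1) i) x := by
      intro i
      have h2 : CMDiffAt ∞ (fun y : M => Ring.inverse (S y) (EuclideanSpace.single j 1)) x :=
        hx.clm_apply contMDiffAt_const
      exact ((EuclideanSpace.proj (𝕜 := ℝ) i).contMDiff (n := ∞)).contMDiffAt.comp x h2
    exact ContMDiffAt.sum_section fun i _ => (h1 i).smul_section (he i x)
  choose Y hYs hYe using hY
  refine ⟨k, Y, q, hYs, ?_⟩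
  filter_upwards [hev, hunit, Filter.eventually_all.2 hYe] with x hx hu hYx
  have hYv : ∀ v : EuclideanSpace ℝ (Fin k),
      ∑ j, v j • Y j x = ∑ i, Ring.inverse (S x) v i • e i x := by
    intro v
    have hv : v = ∑ j, v j • EuclideanSpace.single j (1 : ℝ) := by
      ext i
      simp [Pi.single_apply]
    conv_rhs => rw [hv]
    simp only [hYx, map_sum, map_smul, PiLp.smul_apply, smul_eq_mul, WithLp.ofLp_sum,
      Finset.sum_apply, Finset.sum_smul, Finset.smul_sum, smul_smul, PiLp.smul_apply]
    rw [Finset.sum_comm]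
  have hinv : ∀ v, S x (Ring.inverse (S x) v) = v := fun v =>
    congrArg (fun A => A v) (Ring.mul_inverse_cancel _ hu)
  have hinv' : ∀ v, Ring.inverse (S x) (S x v) = v := fun v =>
    congrArg (fun A => A v) (Ring.inverse_mul_cancel _ hu)
  constructor
  · rw [← hx.2]
    apply le_antisymm
    · rw [Submodule.span_le]
      rintro _ ⟨j, rfl⟩
      simp only [hYx]
      exact Submodule.sum_mem _ fun i _ => Submodule.smul_mem _ _ (Submodule.subset_span ⟨i, rfl⟩)
    · intro w hw
      obtain ⟨c, rfl⟩ := (Submodule.mem_span_range_iff_exists_fun ℝ).1 hw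
      have h1 := hYv (S x (WithLp.toLp 2 c))
      rw [hinv'] at h1
      rw [show ∑ i, c i • e i x = _ from h1.symm]
      exact Submodule.sum_mem _ fun i _ => Submodule.smul_mem _ _ (Submodule.subset_span ⟨i, rfl⟩)
  · intro v
    rw [frameMap_apply, hYv, ← frameMap_apply]
    exact hinv v

/-- In a graph frame, involutivity is the symmetry of the derivative of the frame. -/
theorem IsInvolutive.frameMap_symm (hΔ : IsInvolutive Δ) {φ : M → E} (hφ : CMDiff ∞ φ) {k : ℕ}
    {Y : Fin k → Π x : M, TangentSpace 𝓘(ℝ, E) x} (hY : ∀ j, SmoothField (Y j))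
    {q : E →L[ℝ] EuclideanSpace ℝ (Fin k)} {x : M}
    (hx : ∀ᶠ y in 𝓝 x, Submodule.span ℝ (Set.range fun j => Y j y) = Δ y ∧
      ∀ v, q (frameMap φ Y y v) = v) (u v : EuclideanSpace ℝ (Fin k)) :
    d% (fun y => frameMap φ Y y v) x (∑ j, u j • Y j x) =
      d% (fun y => frameMap φ Y y u) x (∑ j, v j • Y j x) := by
  have hsm : ∀ v : EuclideanSpace ℝ (Fin k), SmoothField fun y => ∑ j, v j • Y j y := fun v =>
    .sum fun j => SmoothField.smul (c := fun _ => v j) contMDiff_const (hY j)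
  have hmem : ∀ v : EuclideanSpace ℝ (Fin k), ∀ᶠ y in 𝓝 x, ∑ j, v j • Y j y ∈ Δ y := fun v => by
    filter_upwards [hx] with y hy
    rw [← hy.1]
    exact Submodule.sum_mem _ fun i _ => Submodule.smul_mem _ _ (Submodule.subset_span ⟨i, rfl⟩)
  have hbr := hΔ _ _ (hsm u) (hsm v) x ((hmem u).and (hmem v))
  have hφ2 : CMDiffAt 2 φ x := (hφ x).of_le ENat.LEInfty.out
  have h1 := mvfderiv_mlieBracket hφ2 ((hsm u).mdiffAt (x := x)) ((hsm v).mdiffAt (x := x))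
  simp only [← frameMap_apply φ] at h1
  rw [← sub_eq_zero, ← h1]
  rw [← hx.self_of_nhds.1] at hbr
  obtain ⟨t, ht⟩ := (Submodule.mem_span_range_iff_exists_fun ℝ).1 hbr
  have h2 := frameMap_apply φ Y x (WithLp.toLp 2 t)
  rw [show ∑ j, (WithLp.toLp 2 t : EuclideanSpace ℝ (Fin k)) j • Y j x = _ from ht] at h2
  -- The function $q(d\varphi(\sum_jv_jY_j))$ is constantly $v$ near $x$, so $q$ kills its
  -- derivatives and hence kills $d\varphi$ of the bracket. The bracket lies in $\Delta$, and
  -- $q\circ d\varphi$ is injective there, so $d\varphi$ of the bracket is zero.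
  have hq : ∀ v (w : TangentSpace 𝓘(ℝ, E) x), q (d% (fun y => frameMap φ Y y v) x w) = 0 := by
    intro v w
    have h3 : MDiffAt (fun y => frameMap φ Y y v) x :=
      ((contMDiff_frameMap hφ hY).clm_apply contMDiff_const).mdifferentiable (by simp) x
    have h4 : d% (q ∘ fun y => frameMap φ Y y v) x w = q (d% (fun y => frameMap φ Y y v) x w) := by
      have h6 : HasMFDerivAt 𝓘(ℝ, E) 𝓘(ℝ, EuclideanSpace ℝ (Fin k)) q (frameMap φ Y x v) q :=
        q.hasFDerivAt.hasMFDerivAt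
      have h7 := (h6.comp x h3.hasMFDerivAt).mfderiv
      exact congrArg (fun A => A w) h7
    have h5 : (q ∘ fun y => frameMap φ Y y v) =ᶠ[𝓝 x] fun _ => v := by
      filter_upwards [hx] with y hy using hy.2 v
    rw [← h4, mvfderiv, h5.mfderiv_eq]
    change d% (fun _ : M => v) x w = 0
    rw [mvfderiv_const]
    rfl
  have h6 : q (d% φ x (mlieBracket 𝓘(ℝ, E) (fun y => ∑ j, u j • Y j y)
      (fun y => ∑ j, v j • Y j y) x)) = 0 := by
    rw [h1, map_sub, hq, hq, sub_zero]
  rw [← h2] at h6 ⊢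
  rw [hx.self_of_nhds.2] at h6
  rw [h6, map_zero]

/-- On the convex set $q\circ y-\mathrm{id}$ has zero derivative, so $q\circ y$ is a translation. -/
theorem injOn_of_hasFDerivAt_of_leftInverse {F : Type*} [NormedAddCommGroup F] [NormedSpace ℝ F]
    {y : F → E} {y' : F → F →L[ℝ] E} {s : Set F} (hs : Convex ℝ s) (hso : IsOpen s)
    (hy : ∀ x ∈ s, HasFDerivAt y (y' x) x) (q : E →L[ℝ] F) (hq : ∀ x ∈ s, ∀ v, q (y' x v) = v) :
    Set.InjOn y s := by
  have hd : ∀ x ∈ s, HasFDerivAt (fun x => q (y x) - x) (0 : F →L[ℝ] F) x := by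
    intro x hx
    refine ((q.hasFDerivAt.comp x (hy x hx)).sub (hasFDerivAt_id x)).congr_fderiv ?_
    ext v
    simp [hq x hx]
  intro x hx z hz hxz
  have h1 := hs.is_const_of_fderivWithin_eq_zero (𝕜 := ℝ)
    (fun w hw => (hd w hw).differentiableAt.differentiableWithinAt)
    (fun w hw => (hd w hw).hasFDerivWithinAt.fderivWithin (hso.uniqueDiffWithinAt hw)) hx hz
  simp only [hxz] at h1
  exact sub_right_injective h1

/-- Frobenius' theorem: an involutive smooth distribution is integrable. -/
theorem IsInvolutive.exists_integralManifold (hi : IsInvolutive Δ) (hΔ : IsSmoothDistribution Δ)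
    (p : M) : ∃ (k : ℕ) (ι : EuclideanSpace ℝ (Fin k) → M),
      IsIntegralManifold (k := k) (I := 𝓘(ℝ, E)) Δ ι ∧ p ∈ Set.range ι := by
  set c := extChartAt 𝓘(ℝ, E) p with hc
  obtain ⟨φ, hφ, hφc⟩ := exists_contMDiff_eventuallyEq_extChartAt (E := E) p
  have hdφ : ∀ x, (∀ᶠ y in 𝓝 x, φ y = c y) → x ∈ c.source → ∀ w : TangentSpace 𝓘(ℝ, E) x,
      mfderiv 𝓘(ℝ, E) 𝓘(ℝ, E) c x w = d% φ x w := by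
    intro x hx _ w
    have hx' : φ =ᶠ[𝓝 x] c := hx
    rw [mvfderiv, hx'.mfderiv_eq]
    rfl
  have hinv : ∀ x, x ∈ c.source → Function.Injective (mfderiv 𝓘(ℝ, E) 𝓘(ℝ, E) c x) := by
    intro x hx
    obtain ⟨e, he⟩ := isInvertible_mfderiv_extChartAt (I := 𝓘(ℝ, E)) hx
    rw [← he]
    exact e.injective
  have hφp : Function.Injective (d% φ p) := by
    intro v w hvw
    rw [← hdφ p hφc (mem_extChartAt_source p), ← hdφ p hφc (mem_extChartAt_source p)] at hvw
    exact hinv p (mem_extChartAt_source p) hvw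
  obtain ⟨k, Y, q, hY, hYq⟩ := hΔ.exists_graph_frame hφ hφp
  -- In the chart, an integral manifold parametrized as a graph over $\mathbb R^k$ solves $Dy=G(y)$.
  set G : E → EuclideanSpace ℝ (Fin k) →L[ℝ] E := fun z => frameMap φ Y (c.symm z) with hG
  have hcont : ContinuousAt c.symm (c p) := continuousAt_extChartAt_symm p
  have hsp : c.symm (c p) = p := extChartAt_to_inv p
  have hgood : ∀ᶠ z in 𝓝 (c p), z ∈ c.target ∧
      (∀ᶠ y in 𝓝 (c.symm z), Submodule.span ℝ (Set.range fun j => Y j y) = Δ y ∧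
        ∀ v, q (frameMap φ Y y v) = v) ∧ ∀ᶠ y in 𝓝 (c.symm z), φ y = c y := by
    refine Filter.Eventually.and (extChartAt_target_mem_nhds p) ?_
    rw [ContinuousAt, hsp] at hcont
    exact hcont.eventually (hYq.eventually_nhds.and hφc.eventually_nhds)
  have hsymmat : ∀ z ∈ c.target, ContMDiffAt 𝓘(ℝ, E) 𝓘(ℝ, E) ∞ c.symm z := fun z hz =>
    (contMDiffOn_extChartAt_symm p).contMDiffAt ((isOpen_extChartAt_target p).mem_nhds hz)
  have hGsm : ∀ z ∈ c.target, ContDiffAt ℝ ∞ G z := fun z hz =>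
    ContMDiffAt.contDiffAt ((contMDiff_frameMap hφ hY _).comp z (hsymmat z hz))
  have hdY : ∀ z ∈ c.target, (∀ᶠ y in 𝓝 (c.symm z), φ y = c y) → ∀ u : EuclideanSpace ℝ (Fin k),
      mfderiv 𝓘(ℝ, E) 𝓘(ℝ, E) c (c.symm z) (∑ j, u j • Y j (c.symm z)) = G z u := by
    intro z hz hz' u
    rw [hdφ _ hz' (c.map_target hz), hG, frameMap_apply]
  have hGsymm : ∀ᶠ z in 𝓝 (c p), ∀ u v, fderiv ℝ G z (G z u) v = fderiv ℝ G z (G z v) u := by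
    filter_upwards [hgood] with z ⟨hz, hz1, hz2⟩ u v
    have hcd : MDifferentiableAt 𝓘(ℝ, E) 𝓘(ℝ, E) c (c.symm z) := by
      refine mdifferentiableAt_extChartAt ?_
      rw [← extChartAt_source 𝓘(ℝ, E)]
      exact c.map_target hz
    have key : ∀ (v : EuclideanSpace ℝ (Fin k)) (w : TangentSpace 𝓘(ℝ, E) (c.symm z)),
        d% (fun y => frameMap φ Y y v) (c.symm z) w =
          fderiv ℝ G z (mfderiv 𝓘(ℝ, E) 𝓘(ℝ, E) c (c.symm z) w) v := by
      intro v w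
      have h1 : (fun y => frameMap φ Y y v) =ᶠ[𝓝 (c.symm z)] (fun z => G z v) ∘ c := by
        filter_upwards [(isOpen_extChartAt_source p).mem_nhds (c.map_target hz)] with y hy
        simp only [hG, Function.comp_apply]
        rw [c.left_inv hy]
      have h2 : HasFDerivAt (fun z => G z v) ((fderiv ℝ G z).flip v) z := by
        have h3 := ((hGsm z hz).differentiableAt (by simp)).hasFDerivAt
        refine (h3.clm_apply (hasFDerivAt_const v z)).congr_fderiv ?_
        ext w
        simp
      have h4 : c (c.symm z) = z := c.right_inv hz
      rw [mvfderiv, h1.mfderiv_eq]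
      refine (mfderiv_comp_apply (c.symm z) (I'' := 𝓘(ℝ, E)) (g := fun z => G z v) ?_ hcd w).trans ?_
      · rw [h4]; exact h2.differentiableAt.mdifferentiableAt
      · rw [h4, mfderiv_eq_fderiv, h2.fderiv]
        rfl
    have h5 := hi.frameMap_symm hφ hY hz1 u v
    rw [key, key, hdY z hz hz2, hdY z hz hz2] at h5
    exact h5
  obtain ⟨δ, hδ, y, hy0, hyp, hyd, hysm⟩ := exists_contDiffOn_solution
    (hgood.mono fun z hz => hGsm z hz.1) hGsymm hgood
  set B := Metric.ball (0 : EuclideanSpace ℝ (Fin k)) δ with hB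
  -- The solution lives on a ball; composing with a diffeomorphism from $\mathbb R^k$ onto the ball
  -- makes the whole space its domain.
  set ub := OpenPartialHomeomorph.univBall (0 : EuclideanSpace ℝ (Fin k)) δ with hub
  have hubB : ∀ t, ub t ∈ B := fun t => by
    have := ub.map_source (x := t) (by rw [hub, OpenPartialHomeomorph.univBall_source]; trivial)
    rwa [hub, OpenPartialHomeomorph.univBall_target _ hδ] at this
  have hleft : ∀ t, ub.symm (ub t) = t := fun t =>
    ub.left_inv (by rw [hub, OpenPartialHomeomorph.univBall_source]; trivial)
  have hright : ∀ x ∈ B, ub (ub.symm x) = x := fun x hx =>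
    ub.right_inv (by rw [hub, OpenPartialHomeomorph.univBall_target _ hδ]; exact hx)
  have hubsm : ContDiff ℝ ∞ ub := OpenPartialHomeomorph.contDiff_univBall
  have hubsm' : ContDiffOn ℝ ∞ ub.symm B := OpenPartialHomeomorph.contDiffOn_univBall_symm
  have hubd : ∀ t, Function.Bijective (fderiv ℝ ub t) := by
    intro t
    have h1 := (hubsm.differentiable (by simp) t).hasFDerivAt
    have h2 : HasFDerivAt ub.symm (fderiv ℝ ub.symm (ub t)) (ub t) :=
      ((hubsm'.contDiffAt (Metric.isOpen_ball.mem_nhds (hubB t))).differentiableAt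
        (by simp)).hasFDerivAt
    have h3 : HasFDerivAt (ub.symm ∘ ub) (ContinuousLinearMap.id ℝ _) t :=
      (hasFDerivAt_id t).congr_of_eventuallyEq (.of_forall hleft)
    have h4 := (h2.comp t h1).unique h3
    have h5 : HasFDerivAt (ub ∘ ub.symm) (ContinuousLinearMap.id ℝ _) (ub t) :=
      (hasFDerivAt_id _).congr_of_eventuallyEq (by
        filter_upwards [Metric.isOpen_ball.mem_nhds (hubB t)] with x hx using hright x hx)
    have h1' : HasFDerivAt ub (fderiv ℝ ub t) (ub.symm (ub t)) := by rwa [hleft]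
    have h6 := (h1'.comp (ub t) h2).unique h5
    exact ⟨Function.LeftInverse.injective (g := fderiv ℝ ub.symm (ub t)) fun v =>
        congrArg (fun A => A v) h4,
      Function.RightInverse.surjective (g := fderiv ℝ ub.symm (ub t)) fun v =>
        congrArg (fun A => A v) h6⟩
  set ι : EuclideanSpace ℝ (Fin k) → M := fun t => c.symm (y (ub t)) with hι
  have hyat : ∀ x ∈ B, ContDiffAt ℝ ∞ y x := fun x hx =>
    hysm.contDiffAt (Metric.isOpen_ball.mem_nhds hx)
  have hιsm : ContMDiff (𝓡 k) 𝓘(ℝ, E) ∞ ι := by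
    intro t
    have h1 := ((hyat _ (hubB t)).comp t hubsm.contDiffAt).contMDiffAt
    exact (hsymmat _ (hyp _ (hubB t)).1).comp t h1
  have hmf : ∀ t (v : TangentSpace (𝓡 k) t), mfderiv (𝓡 k) 𝓘(ℝ, E) ι t v =
      ∑ j, (fderiv ℝ ub t v) j • Y j (ι t) := by
    intro t v
    obtain ⟨hz, hz1, hz2⟩ := hyp _ (hubB t)
    have hsrc : ι t ∈ c.source := c.map_target hz
    refine hinv _ hsrc ?_
    rw [hι, hdY _ hz hz2]
    have hcd : MDifferentiableAt 𝓘(ℝ, E) 𝓘(ℝ, E) c (ι t) := by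
      refine mdifferentiableAt_extChartAt ?_
      rw [← extChartAt_source 𝓘(ℝ, E)]
      exact hsrc
    have h1 := mfderiv_comp_apply (I := 𝓡 k) (I' := 𝓘(ℝ, E)) (I'' := 𝓘(ℝ, E)) t (g := c) hcd
      (hιsm.mdifferentiable (by simp) t) v
    have h2 : c ∘ ι = y ∘ ub := by
      ext t
      exact c.right_inv (hyp _ (hubB t)).1
    have h3 : HasFDerivAt (y ∘ ub) ((G (y (ub t))).comp (fderiv ℝ ub t)) t :=
      (hyd _ (hubB t)).comp t (hubsm.differentiable (by simp) t).hasFDerivAt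
    rw [h2, mfderiv_eq_fderiv, h3.fderiv] at h1
    exact h1.symm
  have hYinj : ∀ t (u : EuclideanSpace ℝ (Fin k)), ∑ j, u j • Y j (ι t) = 0 → u = 0 := by
    intro t u hu
    obtain ⟨hz, hz1, hz2⟩ := hyp _ (hubB t)
    rw [← hz1.self_of_nhds.2 u, frameMap_apply]
    rw [show ∑ j, u j • Y j (c.symm (y (ub t))) = 0 from hu, map_zero, map_zero]
  refine ⟨k, ι, ⟨inferInstance, hιsm, ?_, ?_, ?_⟩, ⟨0, ?_⟩⟩
  · intro t t' htt
    have h1 := c.symm.injOn (hyp _ (hubB t)).1 (hyp _ (hubB t')).1 htt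
    have h2 := injOn_of_hasFDerivAt_of_leftInverse (convex_ball 0 δ) Metric.isOpen_ball hyd q
      (fun x hx v => (hyp x hx).2.1.self_of_nhds.2 v) (hubB t) (hubB t') h1
    rw [← hleft t, h2, hleft]
  · intro t
    refine (injective_iff_map_eq_zero _).2 fun v hv => ?_
    rw [hmf] at hv
    exact (hubd t).1 ((hYinj t _ hv).trans (map_zero _).symm)
  · intro t
    rw [← (hyp _ (hubB t)).2.1.self_of_nhds.1]
    apply le_antisymm
    · rintro _ ⟨v, rfl⟩
      have := hmf t v
      change mfderiv (𝓡 k) 𝓘(ℝ, E) ι t v ∈ _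
      rw [this]
      exact Submodule.sum_mem _ fun i _ => Submodule.smul_mem _ _ (Submodule.subset_span ⟨i, rfl⟩)
    · intro w hw
      obtain ⟨a, rfl⟩ := (Submodule.mem_span_range_iff_exists_fun ℝ).1 hw
      obtain ⟨v, hv⟩ := (hubd t).2 (WithLp.toLp 2 a)
      refine ⟨v, ?_⟩
      refine (hmf t v).trans ?_
      rw [hv]
  · rw [hι]
    simp only
    rw [hub, OpenPartialHomeomorph.univBall_apply_zero, hy0, hsp]

end Frobenius

/-- The form $B$ is used as an inner product, for which the spectral theorem applies to $A$. -/
theorem iSup_eigenspace_eq_top_of_selfAdjoint {V : Type*} [AddCommGroup V] [Module ℝ V]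
    [FiniteDimensional ℝ V] (B : V →ₗ[ℝ] V →ₗ[ℝ] ℝ) (hB : ∀ v w, B v w = B w v)
    (hpos : ∀ v, v ≠ 0 → 0 < B v v) {A : Module.End ℝ V} (hA : ∀ v w, B (A v) w = B v (A w)) :
    ⨆ μ, A.eigenspace μ = ⊤ := by
  have hnn : ∀ v, 0 ≤ B v v := fun v => by
    by_cases h : v = 0
    · simp [h]
    · exact (hpos v h).le
  let c : InnerProductSpace.Core ℝ V :=
    { inner := fun v w => B v w
      conj_inner_symm := fun v w => by simp [hB v w]
      re_inner_nonneg := fun v => by simpa using hnn v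
      add_left := fun v w z => by simp
      smul_left := fun v w r => by simp
      definite := fun v hv => by
        by_contra h
        exact (hpos v h).ne' hv }
  let _ : NormedAddCommGroup V := c.toNormedAddCommGroup
  let _ : InnerProductSpace ℝ V := InnerProductSpace.ofCore c.toCore
  have hs : A.IsSymmetric := hA
  have := hs.orthogonalComplement_iSup_eigenspaces_eq_bot
  rwa [Submodule.orthogonal_eq_bot_iff] at this

/-! ### The twisted connection and the totally geodesic foliations. -/

section

variable {E : Type*} [NormedAddCommGroup E] [NormedSpace ℝ E] [FiniteDimensional ℝ E]
  {M : Type u} [TopologicalSpace M] [ChartedSpace E M] [IsManifold 𝓘(ℝ, E) ∞ M] [T2Space M]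
  {g : Metric 𝓘(ℝ, E) M}

theorem HasParallelProjection.isTotallyGeodesicFoliation
    {τ : Π x : M, TangentSpace 𝓘(ℝ, E) x → TangentSpace 𝓘(ℝ, E) x →ₗ[ℝ] TangentSpace 𝓘(ℝ, E) x}
    {Δ : Π x : M, Submodule ℝ (TangentSpace 𝓘(ℝ, E) x)} (h : HasParallelProjection g τ Δ)
    (hΔ : ∀ x, ∀ v ∈ Δ x, ∀ w ∈ Δ x, τ x v w ∈ Δ x) : IsTotallyGeodesicFoliation g Δ where
  smooth := h.isSmoothDistribution
  integrable := (h.isInvolutive hΔ).exists_integralManifold h.isSmoothDistribution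
  totallyGeodesic _ _ _ _ _ _ hι := h.isTotallyGeodesic hΔ hι

theorem aeval_selfAdjoint (g : Metric 𝓘(ℝ, E) M) {x : M}
    {A : TangentSpace 𝓘(ℝ, E) x →L[ℝ] TangentSpace 𝓘(ℝ, E) x}
    (hA : ∀ v w, g.inner x (A v) w = g.inner x v (A w)) (r : Polynomial ℝ)
    (v w : TangentSpace 𝓘(ℝ, E) x) :
    g.inner x (Polynomial.aeval A r v) w = g.inner x v (Polynomial.aeval A r w) := by
  induction r using Polynomial.induction_on' generalizing v w with
  | add r q h1 h2 => rw [map_add, add_apply, add_apply, map_add, map_add, add_apply, h1, h2]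
  | monomial k c =>
    have hpow : ∀ v w, g.inner x ((A ^ k) v) w = g.inner x v ((A ^ k) w) := by
      induction k with
      | zero => intro v w; rfl
      | succ k ih =>
        intro v w
        rw [pow_succ]
        nth_rw 2 [← pow_succ]
        rw [pow_succ']
        change g.inner x ((A ^ k) (A v)) w = g.inner x v (A ((A ^ k) w))
        rw [ih, hA]
    rw [Polynomial.aeval_monomial, ← Algebra.smul_def, smul_apply, smul_apply, map_smul, map_smul,
      smul_apply, hpow]

theorem leviCivita_sum {ι : Type*} (t : Finset ι) {Y : ι → Π x : M, TangentSpace 𝓘(ℝ, E) x}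
    (hY : ∀ i, SmoothField (Y i)) (x : M) :
    leviCivita g (fun y => ∑ i ∈ t, Y i y) x = ∑ i ∈ t, leviCivita g (Y i) x := by
  classical
  induction t using Finset.induction_on with
  | empty =>
    simp only [Finset.sum_empty]
    have h := leviCivita_add g (SmoothField.zero (E := E) (M := M)).mdiffAt
      (SmoothField.zero (E := E) (M := M)).mdiffAt (x := x)
    simpa using h
  | insert a t ha ih =>
    simp only [Finset.sum_insert ha]
    rw [leviCivita_add g (hY a).mdiffAt (SmoothField.sum hY).mdiffAt, ih]

namespace WeakMetricFStructure

variable {n s : ℕ} (S : WeakMetricFStructure g n s)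

/-- The difference between the Levi-Civita connection and the metric connection
that makes the `ξ_j` and the `h_j` parallel. -/
noncomputable def reebTwist (x : M) (v : TangentSpace 𝓘(ℝ, E) x) :
    TangentSpace 𝓘(ℝ, E) x →ₗ[ℝ] TangentSpace 𝓘(ℝ, E) x :=
  ∑ j, (((g.inner x (S.h j x v)).toLinearMap.smulRight (S.ξ j x)) -
    ((g.inner x (S.ξ j x)).toLinearMap.smulRight (S.h j x v)))

theorem reebTwist_apply (x : M) (v w : TangentSpace 𝓘(ℝ, E) x) : S.reebTwist x v w =
    ∑ j, (g.inner x w (S.h j x v) • S.ξ j x - g.inner x w (S.ξ j x) • S.h j x v) := by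
  simp [reebTwist, g.symm x w]

/-- This skewness is what makes $\nabla+\tau$ a metric connection. -/
theorem inner_reebTwist (x : M) (v w z : TangentSpace 𝓘(ℝ, E) x) :
    g.inner x (S.reebTwist x v w) z = - g.inner x w (S.reebTwist x v z) := by
  simp only [reebTwist_apply, map_sum, sum_apply, map_sub, map_smul, sub_apply, smul_apply,
    smul_eq_mul, ← Finset.sum_neg_distrib]
  refine Finset.sum_congr rfl fun j _ => ?_
  rw [g.symm x (S.ξ j x) z, g.symm x (S.h j x v) z]
  ring

theorem reebTwist_mem {K : Submodule ℝ (TangentSpace 𝓘(ℝ, E) x)} {v : TangentSpace 𝓘(ℝ, E) x}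
    (hK : ∀ j, S.ξ j x ∈ K) (hv : ∀ j, S.h j x v ∈ K) (w : TangentSpace 𝓘(ℝ, E) x) :
    S.reebTwist x v w ∈ K := by
  rw [reebTwist_apply]
  exact K.sum_mem fun j _ => K.sub_mem (K.smul_mem _ (hK j)) (K.smul_mem _ (hv j))

/-- The orthogonal projection onto the span of the `ξ_j`. -/
noncomputable def reebProj (x : M) : TangentSpace 𝓘(ℝ, E) x →L[ℝ] TangentSpace 𝓘(ℝ, E) x :=
  ∑ j, (g.inner x (S.ξ j x)).smulRight (S.ξ j x)

theorem reebProj_apply (x : M) (v : TangentSpace 𝓘(ℝ, E) x) :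
    S.reebProj x v = ∑ j, g.inner x v (S.ξ j x) • S.ξ j x := by
  simp [reebProj, sum_apply, g.symm x v]

theorem inner_reebProj_ξ (x : M) (v : TangentSpace 𝓘(ℝ, E) x) (j : Fin s) :
    g.inner x (S.reebProj x v) (S.ξ j x) = g.inner x v (S.ξ j x) := by
  simp [reebProj_apply, sum_apply, S.ξ_orthonormal]

theorem reebProj_ξ (x : M) (j : Fin s) : S.reebProj x (S.ξ j x) = S.ξ j x := by
  simp [reebProj_apply, S.ξ_orthonormal]

theorem reebProj_eq_zero_iff {x : M} {v : TangentSpace 𝓘(ℝ, E) x} :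
    S.reebProj x v = 0 ↔ ∀ j, g.inner x v (S.ξ j x) = 0 := by
  refine ⟨fun h j => ?_, fun h => ?_⟩
  · rw [← inner_reebProj_ξ, h]; simp
  · simp [reebProj_apply, h]

theorem reebProj_selfAdjoint (x : M) (v w : TangentSpace 𝓘(ℝ, E) x) :
    g.inner x (S.reebProj x v) w = g.inner x v (S.reebProj x w) := by
  simp only [reebProj_apply, map_sum, sum_apply, map_smul, smul_apply, smul_eq_mul]
  exact Finset.sum_congr rfl fun j _ => by rw [g.symm x (S.ξ j x) w]; ring

/-- If $fv=0$ then $Qv=\sum_ig(v,\xi_i)\xi_i$, and $Q$ sends the right-hand side to itself;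
injectivity of $Q$ concludes. -/
theorem reebDist_eq (x : M) :
    S.reebDist x = Submodule.span ℝ (Set.range fun j => S.ξ j x) := by
  apply le_antisymm
  · intro v hv
    have hv : S.f x v = 0 := hv
    have h1 := S.Q_eq x v
    rw [hv, map_zero, neg_zero, zero_add] at h1
    have h2 : S.Q x (∑ i, g.inner x v (S.ξ i x) • S.ξ i x) =
        ∑ i, g.inner x v (S.ξ i x) • S.ξ i x := by simp [S.Q_ξ]
    rw [(S.Q_nonsingular x).1 (h1.trans h2.symm)]
    exact Submodule.sum_mem _ fun i _ => Submodule.smul_mem _ _ (Submodule.subset_span ⟨i, rfl⟩)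
  · rw [Submodule.span_le]
    rintro _ ⟨j, rfl⟩
    exact S.f_ξ j x

theorem ξ_mem_reebDist (x : M) (j : Fin s) : S.ξ j x ∈ S.reebDist x := S.f_ξ j x

theorem reebProj_mem_reebDist (x : M) (v : TangentSpace 𝓘(ℝ, E) x) :
    S.reebProj x v ∈ S.reebDist x := by
  rw [reebProj_apply]
  exact Submodule.sum_mem _ fun i _ => Submodule.smul_mem _ _ (S.ξ_mem_reebDist x i)

theorem reebProj_eq_self {x : M} {v : TangentSpace 𝓘(ℝ, E) x} (hv : v ∈ S.reebDist x) :
    S.reebProj x v = v := by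
  rw [reebDist_eq] at hv
  induction hv using Submodule.span_induction with
  | mem v hv => obtain ⟨j, rfl⟩ := hv; exact S.reebProj_ξ x j
  | zero => simp
  | add v w _ _ hv hw => rw [map_add, hv, hw]
  | smul a v _ hv => rw [map_smul, hv]

theorem mem_nullDist {i : Fin s} {x : M} {v : TangentSpace 𝓘(ℝ, E) x} :
    v ∈ S.nullDist i x ↔ S.h i x (S.h i x v) = 0 ∧ ∀ j, g.inner x v (S.ξ j x) = 0 := by
  rw [nullDist, Submodule.mem_inf, Module.End.mem_eigenspace_iff, zero_smul]
  refine and_congr Iff.rfl ?_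
  simp only [Submodule.mem_iInf, Subtype.forall, LinearMap.mem_ker]
  constructor
  · intro h j
    rw [g.symm]
    exact h _ (S.ξ_mem_reebDist x j)
  · intro h w hw
    rw [reebDist_eq] at hw
    obtain ⟨c, rfl⟩ := (Submodule.mem_span_range_iff_exists_fun ℝ).1 hw
    change g.inner x _ v = 0
    simp [sum_apply, g.symm x _ v, h]

theorem mem_eigenDist {i : Fin s} {μ : ℝ} {x : M} {v : TangentSpace 𝓘(ℝ, E) x} :
    v ∈ S.eigenDist i μ x ↔ S.h i x (S.h i x v) = μ • v := by
  rw [eigenDist, Module.End.mem_eigenspace_iff]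
  rfl

theorem finrank_reebDist_le (x : M) :
    Module.finrank ℝ (S.reebDist x) ≤ s := by
  rw [reebDist_eq]
  exact (finrank_range_le_card _).trans_eq (Fintype.card_fin s)

variable {S} (hS : S.Adapted)
include hS

/-- The formula for $\nabla h_i$ is the commutator $[h_i,\tau_X]$: the other terms vanish because
$h_i\xi_j=0$ and $h_i$ takes values orthogonal to the $\xi_j$. -/
theorem Adapted.isParallel_h (i : Fin s) : IsParallel g S.reebTwist (S.h i) where
  smooth := hS.smoothEnd_h i
  covEnd_eq X Y hX hY x := by
    rw [hS.covEnd_h hX hY, reebTwist_apply, reebTwist_apply, map_sum, ← Finset.sum_sub_distrib]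
    refine Finset.sum_congr rfl fun j _ => ?_
    rw [map_sub, map_smul, map_smul, hS.h_ξ, hS.inner_h_ξ, hS.h_skew]
    module

/-- Each $\xi_j$ is parallel for $\nabla+\tau$, since $\tau_X\xi_j=-h_jX$, and the connection is
metric. -/
theorem Adapted.isParallel_reebProj : IsParallel g S.reebTwist S.reebProj where
  smooth := .of_apply fun X hX => by
    simp only [reebProj_apply]
    exact .sum fun j => .smul (hX.inner g (S.ξ_smooth j)) (S.ξ_smooth j)
  covEnd_eq X Y hX hY x := by
    have h1 : ∀ j, SmoothField fun y => g.inner y (Y y) (S.ξ j y) • S.ξ j y := fun j =>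
      .smul (hY.inner g (S.ξ_smooth j)) (S.ξ_smooth j)
    have h2 : ∀ j, g.inner x (S.reebProj x (Y x)) (S.h j x (X x)) = 0 := fun j => by
      simp [reebProj_apply, sum_apply, g.symm x (S.ξ _ x), hS.inner_h_ξ]
    have h3 : ∀ j, S.reebProj x (S.h j x (X x)) = 0 := fun j =>
      S.reebProj_eq_zero_iff.2 fun k => hS.inner_h_ξ j k x _
    rw [covEnd]
    simp only [reebProj_apply S x (leviCivita g Y x (X x)), reebProj_apply S _ (Y _)]
    rw [leviCivita_sum _ h1, sum_apply, ← Finset.sum_sub_distrib, reebTwist_apply, reebTwist_apply,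
      map_sum]
    simp only [← reebProj_apply, h2, inner_reebProj_ξ, map_sub, map_smul, h3, reebProj_ξ]
    rw [← Finset.sum_sub_distrib]
    refine Finset.sum_congr rfl fun j _ => ?_
    rw [leviCivita_smul g ((hY.inner g (S.ξ_smooth j)).mdifferentiable (by simp) x)
      (S.ξ_smooth j).mdiffAt, leviCivita_metric g hX.mdiffAt hY.mdiffAt (S.ξ_smooth j).mdiffAt]
    change _ • S.h j x (X x) + (_ + g.inner x (Y x) (S.h j x (X x))) • _ - _ = _
    module

theorem Adapted.isParallel_hSq (i : Fin s) :
    IsParallel g S.reebTwist fun x => S.h i x ∘L S.h i x :=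
  (hS.isParallel_h i).comp (hS.isParallel_h i)

theorem Adapted.hSq_selfAdjoint (i : Fin s) (x : M) (v w : TangentSpace 𝓘(ℝ, E) x) :
    g.inner x (S.h i x (S.h i x v)) w = g.inner x v (S.h i x (S.h i x w)) := by
  rw [hS.h_skew, hS.h_skew, neg_neg]

theorem Adapted.h_reebProj (i : Fin s) (x : M) (v : TangentSpace 𝓘(ℝ, E) x) :
    S.h i x (S.reebProj x v) = 0 := by
  simp [reebProj_apply, hS.h_ξ]

theorem Adapted.h_eq_zero_of_mem_reebDist (i : Fin s) {x : M} {v : TangentSpace 𝓘(ℝ, E) x}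
    (hv : v ∈ S.reebDist x) : S.h i x v = 0 := by
  rw [← S.reebProj_eq_self hv, hS.h_reebProj]

theorem Adapted.reebProj_h (i : Fin s) (x : M) (v : TangentSpace 𝓘(ℝ, E) x) :
    S.reebProj x (S.h i x v) = 0 :=
  S.reebProj_eq_zero_iff.2 fun k => hS.inner_h_ξ i k x _

theorem Adapted.h_h_eq_zero_iff {i : Fin s} {x : M} {v : TangentSpace 𝓘(ℝ, E) x} :
    S.h i x (S.h i x v) = 0 ↔ S.h i x v = 0 := by
  refine ⟨fun h => ?_, fun h => by rw [h, map_zero]⟩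
  by_contra hne
  have h1 := metric_self_pos g hne
  rw [hS.h_skew, h, map_zero, neg_zero] at h1
  exact h1.false

theorem Adapted.reebProj_eq_zero_of_mem_eigenDist {i : Fin s} {μ : ℝ} (hμ : μ ≠ 0) {x : M}
    {v : TangentSpace 𝓘(ℝ, E) x} (hv : v ∈ S.eigenDist i μ x) : S.reebProj x v = 0 := by
  have h1 := S.mem_eigenDist.1 hv
  have h2 : μ • S.reebProj x v = 0 := by rw [← map_smul, ← h1, hS.reebProj_h]
  exact (smul_eq_zero.1 h2).resolve_left hμ

theorem Adapted.h_mem_eigenDist {i : Fin s} {μ : ℝ} {x : M} (j : Fin s)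
    {v : TangentSpace 𝓘(ℝ, E) x} (hv : v ∈ S.eigenDist i μ x) : S.h j x v ∈ S.eigenDist i μ x := by
  rw [mem_eigenDist] at hv ⊢
  rw [hS.h_comm i j, hS.h_comm i j, hv, map_smul]

theorem Adapted.h_mem_nullDist {i : Fin s} {x : M} (j : Fin s)
    {v : TangentSpace 𝓘(ℝ, E) x} (hv : v ∈ S.nullDist i x) : S.h j x v ∈ S.nullDist i x := by
  rw [mem_nullDist] at hv ⊢
  refine ⟨?_, fun k => hS.inner_h_ξ j k x _⟩
  rw [hS.h_comm i j, hS.h_comm i j, hv.1, map_zero]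

/-- The values $\tau_vw$ are combinations of the $\xi_j$ and the $h_jv$, so invariance of $F$ under
the $h_j$ is enough, whatever $w$ is. -/
theorem Adapted.reebTwist_mem_sup {x : M} {F : Submodule ℝ (TangentSpace 𝓘(ℝ, E) x)}
    (hF : ∀ j, ∀ v ∈ F, S.h j x v ∈ F) {v : TangentSpace 𝓘(ℝ, E) x} (hv : v ∈ S.reebDist x ⊔ F)
    (w : TangentSpace 𝓘(ℝ, E) x) : S.reebTwist x v w ∈ S.reebDist x ⊔ F := by
  refine S.reebTwist_mem (fun j => (le_sup_left : S.reebDist x ≤ _) (S.ξ_mem_reebDist x j))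
    (fun j => ?_) w
  obtain ⟨a, ha, b, hb, rfl⟩ := Submodule.mem_sup.1 hv
  rw [map_add, hS.h_eq_zero_of_mem_reebDist j ha, zero_add]
  exact (le_sup_right : F ≤ S.reebDist x ⊔ F) (hF j b hb)

/-- The projection onto the contact distribution, as a parallel tensor. -/
theorem Adapted.isParallel_contactProj : IsParallel g S.reebTwist
    fun x => ContinuousLinearMap.id ℝ (TangentSpace 𝓘(ℝ, E) x) - S.reebProj x :=
  IsParallel.id.sub hS.isParallel_reebProj

/-- Eigenvectors for $\mu\ne0$ lie in the image of $h_i$, hence are orthogonal to $\ker f$. So the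
sum is cut out by the eigenvalue equation on the component orthogonal to $\ker f$. -/
theorem Adapted.reebDist_sup_eigenDist_eq {i : Fin s} {μ : ℝ} (hμ : μ ≠ 0) (x : M) :
    S.reebDist x ⊔ S.eigenDist i μ x =
      ((S.h i x ∘L S.h i x - μ • ContinuousLinearMap.id ℝ (TangentSpace 𝓘(ℝ, E) x)) ∘L
        (ContinuousLinearMap.id ℝ (TangentSpace 𝓘(ℝ, E) x) - S.reebProj x)).ker := by
  have key : ∀ v, ((S.h i x ∘L S.h i x - μ • ContinuousLinearMap.id ℝ (TangentSpace 𝓘(ℝ, E) x)) ∘L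
        (ContinuousLinearMap.id ℝ (TangentSpace 𝓘(ℝ, E) x) - S.reebProj x)) v = 0 ↔
      v - S.reebProj x v ∈ S.eigenDist i μ x := fun v => by
    rw [mem_eigenDist, ← sub_eq_zero (b := μ • _)]
    rfl
  apply le_antisymm
  · refine sup_le (fun v hv => (key v).2 ?_) fun v hv => (key v).2 ?_
    · rw [S.reebProj_eq_self hv, sub_self]
      exact zero_mem _
    · rwa [hS.reebProj_eq_zero_of_mem_eigenDist hμ hv, sub_zero]
  · intro v hv
    exact Submodule.mem_sup.2 ⟨_, S.reebProj_mem_reebDist x v, _, (key v).1 hv,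
      add_sub_cancel _ _⟩

theorem Adapted.ker_h_eq (i : Fin s) (x : M) :
    (S.h i x).ker = S.reebDist x ⊔ S.nullDist i x := by
  apply le_antisymm
  · intro v hv
    have hv : S.h i x v = 0 := hv
    refine Submodule.mem_sup.2 ⟨_, S.reebProj_mem_reebDist x v, v - S.reebProj x v,
      S.mem_nullDist.2 ⟨?_, fun j => ?_⟩, add_sub_cancel _ _⟩
    · rw [map_sub, hv, hS.h_reebProj, sub_zero, map_zero]
    · rw [map_sub, sub_apply, S.inner_reebProj_ξ, sub_self]
  · exact sup_le (fun v hv => hS.h_eq_zero_of_mem_reebDist i hv) fun v hv =>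
      hS.h_h_eq_zero_iff.1 (S.mem_nullDist.1 hv).1

/-- The images of $h_i^2$ and $P$ are orthogonal, so $h_i^2v=Pv$ forces both sides to vanish. -/
theorem Adapted.nullDist_eq_ker (i : Fin s) (x : M) :
    S.nullDist i x = (S.h i x ∘L S.h i x - S.reebProj x).ker := by
  ext v
  rw [mem_nullDist, ← S.reebProj_eq_zero_iff]
  change _ ↔ S.h i x (S.h i x v) - S.reebProj x v = 0
  constructor
  · rintro ⟨h1, h2⟩
    rw [h1, h2, sub_zero]
  · intro h
    have h1 : S.reebProj x v = 0 := by
      have h2 := congrArg (S.reebProj x) h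
      rw [map_sub, hS.reebProj_h, map_zero, zero_sub, neg_eq_zero,
        S.reebProj_eq_self (S.reebProj_mem_reebDist x v)] at h2
      exact h2
    exact ⟨by rw [← h, h1, sub_zero], h1⟩

/-- With $\eta^i=g(\cdot,\xi_i)$ and no torsion, $d\eta^i(v,w)=g(h_iv,w)-g(v,h_iw)$, and $h_i$ is
skew. This identifies $\ker d\eta^i$ with $\ker h_i$. -/
theorem Adapted.extDerivForm_apply (i : Fin s) (x : M) (v w : TangentSpace 𝓘(ℝ, E) x) :
    extDerivForm (S.η i) (S.η_smooth i) x v w = 2 * g.inner x (S.h i x v) w := by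
  obtain ⟨V, hV, rfl⟩ := exists_smooth_extension v
  obtain ⟨W, hW, rfl⟩ := exists_smooth_extension w
  rw [WeakNearlyC.extDerivForm_apply _ hV.mdiffAt hW.mdiffAt, extDerivAux]
  simp only [S.η_eq]
  rw [leviCivita_metric g hV.mdiffAt hW.mdiffAt (S.ξ_smooth i).mdiffAt,
    leviCivita_metric g hW.mdiffAt hV.mdiffAt (S.ξ_smooth i).mdiffAt,
    ← leviCivita_torsion_free g hV.mdiffAt hW.mdiffAt, map_sub, sub_apply]
  change _ + g.inner x (W x) (S.h i x (V x)) - (_ + g.inner x (V x) (S.h i x (W x))) - _ = _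
  have h1 := hS.h_skew i x (V x) (W x)
  have h2 := g.symm x (W x) (S.h i x (V x))
  linarith

theorem Adapted.kerDEta_eq (i : Fin s) (x : M) : S.kerDEta i x = (S.h i x).ker := by
  ext v
  constructor
  · intro hv
    have hv : extDerivForm (S.η i) (S.η_smooth i) x v = 0 := hv
    refine metric_ext g fun w => ?_
    have h1 := hS.extDerivForm_apply i x v w
    rw [hv] at h1
    simp at h1
    simp [h1]
  · intro hv
    have hv : S.h i x v = 0 := hv
    change extDerivForm (S.η i) (S.η_smooth i) x v = 0
    ext w
    rw [hS.extDerivForm_apply, hv]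
    simp

theorem Adapted.nullDist_ne_bot {i : Fin s} {x : M}
    (h : s < Module.finrank ℝ (S.kerDEta i x)) : S.nullDist i x ≠ ⊥ := by
  intro h0
  rw [hS.kerDEta_eq, hS.ker_h_eq, h0, sup_bot_eq] at h
  exact (S.finrank_reebDist_le x).not_gt h

theorem Adapted.mem_nullDist_iff {i : Fin s} {x : M} {v : TangentSpace 𝓘(ℝ, E) x} :
    v ∈ S.nullDist i x ↔ v ∈ S.kerDEta i x ∧ ∀ j, g.inner x v (S.ξ j x) = 0 := by
  rw [mem_nullDist, hS.h_h_eq_zero_iff, hS.kerDEta_eq]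
  rfl

theorem Adapted.nullDist_congr {i j : Fin s} {x : M} (h : S.kerDEta i x = S.kerDEta j x) :
    S.nullDist i x = S.nullDist j x := by
  ext v
  rw [hS.mem_nullDist_iff, hS.mem_nullDist_iff, h]

/-- When the kernels agree, every $h_j$ kills $v$, while $w$ is orthogonal to the $\xi_j$. This is
why $\mathcal D_{i,0}$ is totally geodesic without adding $\ker f$. -/
theorem Adapted.reebTwist_eq_zero {i : Fin s} {x : M} (h : ∀ i j, S.kerDEta i x = S.kerDEta j x)
    {v w : TangentSpace 𝓘(ℝ, E) x} (hv : v ∈ S.nullDist i x) (hw : w ∈ S.nullDist i x) :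
    S.reebTwist x v w = 0 := by
  rw [reebTwist_apply]
  refine Finset.sum_eq_zero fun j _ => ?_
  rw [hS.nullDist_congr (h i j), mem_nullDist, hS.h_h_eq_zero_iff] at hv
  rw [(S.mem_nullDist.1 hw).2, hv.1]
  simp

theorem Adapted.isTotallyGeodesicFoliation_eigenDist (i : Fin s) {μ : ℝ} (hμ : μ ≠ 0) :
    IsTotallyGeodesicFoliation g fun x => S.reebDist x ⊔ S.eigenDist i μ x := by
  refine HasParallelProjection.isTotallyGeodesicFoliation (τ := S.reebTwist)
    (.of_ker S.inner_reebTwist fun p => ⟨_, (((hS.isParallel_hSq i).sub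
      (IsParallel.id.smul μ)).comp hS.isParallel_contactProj), fun v w => ?_,
      .of_forall (hS.reebDist_sup_eigenDist_eq hμ)⟩)
    fun x v hv w _ => hS.reebTwist_mem_sup (fun j v hv => hS.h_mem_eigenDist j hv) hv w
  change g.inner p (S.h i p (S.h i p (v - S.reebProj p v)) - μ • (v - S.reebProj p v)) w =
    g.inner p v (S.h i p (S.h i p (w - S.reebProj p w)) - μ • (w - S.reebProj p w))
  simp [hS.h_reebProj, hS.hSq_selfAdjoint, S.reebProj_selfAdjoint]

theorem Adapted.isTotallyGeodesicFoliation_reebDist_sup_nullDist (i : Fin s) :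
    IsTotallyGeodesicFoliation g fun x => S.reebDist x ⊔ S.nullDist i x := by
  refine HasParallelProjection.isTotallyGeodesicFoliation (τ := S.reebTwist)
    (.of_ker S.inner_reebTwist fun p => ⟨_, hS.isParallel_hSq i, hS.hSq_selfAdjoint i p,
      .of_forall fun x => ?_⟩)
    fun x v hv w _ => hS.reebTwist_mem_sup (fun j v hv => hS.h_mem_nullDist j hv) hv w
  rw [← hS.ker_h_eq]
  ext v
  exact hS.h_h_eq_zero_iff.symm

theorem Adapted.hasParallelProjection_nullDist (i : Fin s) :
    HasParallelProjection g S.reebTwist (S.nullDist i) :=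
  .of_ker S.inner_reebTwist fun p => ⟨_, (hS.isParallel_hSq i).sub hS.isParallel_reebProj,
    fun v w => by simp [hS.hSq_selfAdjoint, S.reebProj_selfAdjoint],
    .of_forall fun x => hS.nullDist_eq_ker i x⟩

theorem Adapted.isTotallyGeodesicFoliation_nullDist (h : ∀ i j x, S.kerDEta i x = S.kerDEta j x)
    (i : Fin s) : IsTotallyGeodesicFoliation g (S.nullDist i) :=
  (hS.hasParallelProjection_nullDist i).isTotallyGeodesicFoliation fun x v hv w hw => by
    rw [hS.reebTwist_eq_zero (fun i j => h i j x) hv hw]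
    exact zero_mem _

theorem Adapted.iSup_eigenDist_eq_top (i : Fin s) (x : M) : ⨆ μ, S.eigenDist i μ x = ⊤ := by
  have : FiniteDimensional ℝ (TangentSpace 𝓘(ℝ, E) x) := inferInstanceAs (FiniteDimensional ℝ E)
  exact iSup_eigenspace_eq_top_of_selfAdjoint
    (ContinuousLinearMap.coeLM ℝ ∘ₗ (g.inner x).toLinearMap) (g.symm x)
    (fun v hv => g.pos x v hv) (hS.hSq_selfAdjoint i x)

/-- Here $r(h_i^2)$ is the projection onto $\ker h_i^2$; it kills the other eigenspaces. A vector
orthogonal to $\ker f$ that it kills has no null component, by the spectral decomposition. -/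
theorem Adapted.reebDist_sup_iSup_eigenDist_eq {i : Fin s} {x : M} {r : Polynomial ℝ}
    (hr : ∀ v, Polynomial.aeval (S.h i x ∘L S.h i x) r v ∈ (S.h i x ∘L S.h i x).ker)
    (hr' : ∀ v ∈ (S.h i x ∘L S.h i x).ker, Polynomial.aeval (S.h i x ∘L S.h i x) r v = v) :
    S.reebDist x ⊔ ⨆ (μ : ℝ) (_ : μ ≠ 0), S.eigenDist i μ x =
      (Polynomial.aeval (S.h i x ∘L S.h i x) r ∘L
        (ContinuousLinearMap.id ℝ (TangentSpace 𝓘(ℝ, E) x) - S.reebProj x)).ker := by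
  set R := Polynomial.aeval (S.h i x ∘L S.h i x) r with hR
  have hcomm : ∀ v, S.h i x (S.h i x (R v)) = R (S.h i x (S.h i x v)) := fun v => by
    have h1 := congrArg (Polynomial.aeval (S.h i x ∘L S.h i x)) (mul_comm Polynomial.X r)
    rw [map_mul, map_mul, Polynomial.aeval_X] at h1
    exact DFunLike.congr_fun h1 v
  have hne : (⨆ (μ : ℝ) (_ : μ ≠ 0), S.eigenDist i μ x) ≤ R.ker := by
    refine iSup₂_le fun μ hμ v hv => ?_
    have h1 := hcomm v
    rw [S.mem_eigenDist.1 hv, map_smul, show S.h i x (S.h i x (R v)) = 0 from hr v] at h1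
    exact (smul_eq_zero.1 h1.symm).resolve_left hμ
  have hP : (⨆ (μ : ℝ) (_ : μ ≠ 0), S.eigenDist i μ x) ≤ (S.reebProj x).ker :=
    iSup₂_le fun μ hμ v hv => hS.reebProj_eq_zero_of_mem_eigenDist hμ hv
  apply le_antisymm
  · refine sup_le (fun v hv => ?_) fun v hv => ?_
    · change R (v - S.reebProj x v) = 0
      rw [S.reebProj_eq_self hv, sub_self, map_zero]
    · change R (v - S.reebProj x v) = 0
      rw [show S.reebProj x v = 0 from hP hv, sub_zero]
      exact hne hv
  · intro v hv
    have hv : R (v - S.reebProj x v) = 0 := hv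
    refine Submodule.mem_sup.2 ⟨_, S.reebProj_mem_reebDist x v, v - S.reebProj x v, ?_,
      add_sub_cancel _ _⟩
    have hle : (⊤ : Submodule ℝ (TangentSpace 𝓘(ℝ, E) x)) ≤
        S.eigenDist i 0 x ⊔ ⨆ (μ : ℝ) (_ : μ ≠ 0), S.eigenDist i μ x := by
      rw [← hS.iSup_eigenDist_eq_top i x]
      refine iSup_le fun μ => ?_
      by_cases hμ : μ = 0
      · rw [hμ]; exact le_sup_left
      · exact (le_iSup₂ (f := fun (μ : ℝ) (_ : μ ≠ 0) => S.eigenDist i μ x) μ hμ).trans le_sup_right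
    obtain ⟨a, ha, b, hb, hab⟩ := Submodule.mem_sup.1 (hle (Submodule.mem_top (x := v - S.reebProj x v)))
    have ha' : R a = a := hr' a (by rw [mem_eigenDist, zero_smul] at ha; exact ha)
    rw [← hab, map_add, ha', show R b = 0 from hne hb, add_zero] at hv
    rw [← hab, hv, zero_add]
    exact hb

theorem Adapted.isTotallyGeodesicFoliation_iSup_eigenDist (i : Fin s) :
    IsTotallyGeodesicFoliation g fun x =>
      S.reebDist x ⊔ ⨆ (μ : ℝ) (_ : μ ≠ 0), S.eigenDist i μ x := by
  refine HasParallelProjection.isTotallyGeodesicFoliation (τ := S.reebTwist)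
    (.of_ker S.inner_reebTwist fun p => ?_)
    fun x v hv w _ => hS.reebTwist_mem_sup (fun j v hv => ?_) hv w
  · obtain ⟨r, hr⟩ := (hS.isParallel_hSq i).exists_polynomial S.inner_reebTwist
      (hS.hSq_selfAdjoint i p)
    refine ⟨_, ((hS.isParallel_hSq i).aeval r).comp hS.isParallel_contactProj, fun v w => ?_,
      hr.mono fun x hx => hS.reebDist_sup_iSup_eigenDist_eq hx.1 hx.2⟩
    -- The image of $P$ lies in $\ker h_i^2$, so $r(h_i^2)(1-P)=r(h_i^2)-P$, a difference of
    -- self-adjoint operators.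
    have h1 : ∀ v, Polynomial.aeval (S.h i p ∘L S.h i p) r (S.reebProj p v) = S.reebProj p v :=
      fun v => hr.self_of_nhds.2 _ (by
        change S.h i p (S.h i p _) = 0
        rw [hS.h_reebProj, map_zero])
    have h2 := aeval_selfAdjoint g (A := S.h i p ∘L S.h i p) (hS.hSq_selfAdjoint i p) r
    change g.inner p (Polynomial.aeval (S.h i p ∘L S.h i p) r (v - S.reebProj p v)) w =
      g.inner p v (Polynomial.aeval (S.h i p ∘L S.h i p) r (w - S.reebProj p w))
    have h3 : ∀ v, Polynomial.aeval (S.h i p ∘L S.h i p) r (v - S.reebProj p v) =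
        Polynomial.aeval (S.h i p ∘L S.h i p) r v - S.reebProj p v := fun v => by rw [map_sub, h1]
    rw [h3, h3, map_sub, map_sub, sub_apply, h2, S.reebProj_selfAdjoint]
  · have h : (⨆ (μ : ℝ) (_ : μ ≠ 0), S.eigenDist i μ x) ≤
        (⨆ (μ : ℝ) (_ : μ ≠ 0), S.eigenDist i μ x).comap (S.h j x).toLinearMap :=
      iSup₂_le fun μ hμ v hv =>
        (le_iSup₂ (f := fun (μ : ℝ) (_ : μ ≠ 0) => S.eigenDist i μ x) μ hμ)
          (hS.h_mem_eigenDist j hv)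
    exact h hv

end WeakMetricFStructure
end

/-! ### Immersions: extension of functions and fields, induced metric, Gauss formula. -/

section Submanifold

theorem exists_leftInverse_of_injective {V W : Type*} [NormedAddCommGroup V] [NormedSpace ℝ V]
    [NormedAddCommGroup W] [NormedSpace ℝ W] [FiniteDimensional ℝ W] {A : V →L[ℝ] W}
    (hA : Function.Injective A) : ∃ q : W →L[ℝ] V, ∀ v, q (A v) = v := by
  obtain ⟨q, hq⟩ := LinearMap.exists_leftInverse_of_injective A.toLinearMap
    (LinearMap.ker_eq_bot.2 hA)
  exact ⟨LinearMap.toContinuousLinearMap q, LinearMap.congr_fun hq⟩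

theorem exists_eventually_leftInverse {F : Type*} [NormedAddCommGroup F] [NormedSpace ℝ F]
    [CompleteSpace F] {θ : F → F} {a : F} (hθ : ∀ᶠ z in 𝓝 a, ContDiffAt ℝ ∞ θ z)
    (hd : HasFDerivAt θ (ContinuousLinearMap.id ℝ F) a) :
    ∃ ψ : F → F, (∀ᶠ z in 𝓝 a, ψ (θ z) = z) ∧ ContinuousAt ψ (θ a) ∧
      ∀ᶠ y in 𝓝 (θ a), ContDiffAt ℝ ∞ ψ y := by
  have hd' : HasFDerivAt θ ((ContinuousLinearEquiv.refl ℝ F : F ≃L[ℝ] F) : F →L[ℝ] F) a := hd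
  have ha := hθ.self_of_nhds
  set e := ha.toOpenPartialHomeomorph θ hd' (by simp) with he
  have hae : a ∈ e.source := ha.mem_toOpenPartialHomeomorph_source hd' (by simp)
  have hat : θ a ∈ e.target := ha.image_mem_toOpenPartialHomeomorph_target hd' (by simp)
  have hea : e.symm (θ a) = a := e.left_inv hae
  refine ⟨e.symm, e.eventually_left_inverse hae, e.continuousAt_symm hat, ?_⟩
  -- Invertibility of the derivative is an open condition, so the local inverse is smooth near
  -- $\theta(a)$ and not only at it.
  have h1 : ∀ᶠ z in 𝓝 a, ContDiffAt ℝ ∞ θ z ∧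
      ∃ L : F ≃L[ℝ] F, (L : F →L[ℝ] F) = fderiv ℝ θ z := by
    refine hθ.and ?_
    have hc : ContinuousAt (fderiv ℝ θ) a := ha.continuousAt_fderiv (by simp)
    have := (ContinuousLinearEquiv.refl ℝ F).nhds
    rw [ContinuousAt, hd.fderiv] at hc
    exact hc.eventually this
  have h2 : ∀ᶠ y in 𝓝 (θ a), y ∈ e.target := e.open_target.mem_nhds hat
  have h3 := e.continuousAt_symm hat
  rw [ContinuousAt, hea] at h3
  filter_upwards [h2, h3.eventually h1] with y hy ⟨hy1, L, hL⟩
  refine e.contDiffAt_symm (f₀' := L) hy ?_ hy1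
  rw [hL]
  exact (hy1.differentiableAt (by simp)).hasFDerivAt

variable {E : Type*} [NormedAddCommGroup E] [NormedSpace ℝ E] [FiniteDimensional ℝ E]
  {M : Type u} [TopologicalSpace M] [ChartedSpace E M] [IsManifold 𝓘(ℝ, E) ∞ M] [T2Space M]
  {F : Type*} [NormedAddCommGroup F] [NormedSpace ℝ F] [FiniteDimensional ℝ F]
  {L : Type w} [TopologicalSpace L] [ChartedSpace F L] [IsManifold 𝓘(ℝ, F) ∞ L]

theorem mvfderiv_comp_contMDiff {G : Type*} [NormedAddCommGroup G] [NormedSpace ℝ G]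
    {u : M → G} (hu : CMDiff ∞ u) {ι : L → M} (hι : ContMDiff 𝓘(ℝ, F) 𝓘(ℝ, E) ∞ ι) (y : L)
    (v : TangentSpace 𝓘(ℝ, F) y) :
    d% (u ∘ ι) y v = d% u (ι y) (mfderiv 𝓘(ℝ, F) 𝓘(ℝ, E) ι y v) := by
  have h1 := (hu.mdifferentiable (by simp) (ι y)).hasMFDerivAt
  have h2 := (hι.mdifferentiable (by simp) y).hasMFDerivAt
  exact congrArg (fun A => A v) (h1.comp y h2).mfderiv

theorem exists_contMDiff_injective_mvfderiv (p : M) :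
    ∃ φ : M → E, CMDiff ∞ φ ∧ Function.Injective (d% φ p) := by
  obtain ⟨φ, hφ, hφc⟩ := exists_contMDiff_eventuallyEq_extChartAt (E := E) p
  refine ⟨φ, hφ, fun v w hvw => ?_⟩
  have hx : φ =ᶠ[𝓝 p] extChartAt 𝓘(ℝ, E) p := hφc
  obtain ⟨e, he⟩ := isInvertible_mfderiv_extChartAt (I := 𝓘(ℝ, E)) (mem_extChartAt_source p)
  rw [mvfderiv, hx.mfderiv_eq] at hvw
  apply e.injective
  have h2 := congrArg (fun A => A v) he
  have h3 := congrArg (fun A => A w) he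
  exact h2.trans (Eq.trans hvw h3.symm)

/-- Along an immersion, smooth functions extend locally to the ambient manifold. -/
theorem exists_contMDiff_comp_eventuallyEq {ι : L → M}
    (hι : ContMDiff 𝓘(ℝ, F) 𝓘(ℝ, E) ∞ ι) {x : L}
    (hinj : Function.Injective (mfderiv 𝓘(ℝ, F) 𝓘(ℝ, E) ι x))
    {G : Type*} [NormedAddCommGroup G] [NormedSpace ℝ G] {u : L → G} (hu : CMDiff ∞ u) :
    ∃ w : M → G, CMDiff ∞ w ∧ ∀ᶠ y in 𝓝 x, w (ι y) = u y := by
  obtain ⟨φ, hφ, hφi⟩ := exists_contMDiff_injective_mvfderiv (E := E) (ι x)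
  set c := extChartAt 𝓘(ℝ, F) x with hc
  set J : F → E := fun z => φ (ι (c.symm z)) with hJ
  have hcx : c.symm (c x) = x := extChartAt_to_inv x
  have hsymm : ∀ z ∈ c.target, ContMDiffAt 𝓘(ℝ, F) 𝓘(ℝ, F) ∞ c.symm z := fun z hz =>
    (contMDiffOn_extChartAt_symm x).contMDiffAt ((isOpen_extChartAt_target x).mem_nhds hz)
  have hJs : ∀ z ∈ c.target, ContDiffAt ℝ ∞ J z := fun z hz =>
    ContMDiffAt.contDiffAt (((hφ.comp hι) _).comp z (hsymm z hz))
  have hxt : c x ∈ c.target := mem_extChartAt_target x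
  have hJi : Function.Injective (fderiv ℝ J (c x)) := by
    have h1 : MDifferentiableAt 𝓘(ℝ, F) 𝓘(ℝ, F) c.symm (c x) :=
      (hsymm _ hxt).mdifferentiableAt (by simp)
    have h2 : MDifferentiableAt 𝓘(ℝ, F) 𝓘(ℝ, E) (φ ∘ ι) (c.symm (c x)) :=
      (hφ.comp hι).mdifferentiable (by simp) _
    have h3 : MDifferentiableAt 𝓘(ℝ, F) 𝓘(ℝ, E) ι x := hι.mdifferentiable (by simp) _
    have h4 : MDifferentiableAt 𝓘(ℝ, E) 𝓘(ℝ, E) φ (ι x) := hφ.mdifferentiable (by simp) _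
    have h5 : ∀ v, fderiv ℝ J (c x) v = d% φ (ι x) (mfderiv 𝓘(ℝ, F) 𝓘(ℝ, E) ι x
        (mfderiv 𝓘(ℝ, F) 𝓘(ℝ, F) c.symm (c x) v)) := by
      intro v
      have h6 := mfderiv_comp_apply (c x) h2 h1 v
      rw [hcx] at h6
      have h7 := mfderiv_comp_apply x h4 h3 (mfderiv 𝓘(ℝ, F) 𝓘(ℝ, F) c.symm (c x) v)
      rw [← mfderiv_eq_fderiv]
      exact h6.trans h7
    obtain ⟨e, he⟩ := isInvertible_mfderivWithin_extChartAt_symm (I := 𝓘(ℝ, F)) hxt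
    rw [modelWithCornersSelf_coe, Set.range_id, mfderivWithin_univ] at he
    intro v w hvw
    rw [h5, h5] at hvw
    have h8 := hinj (hφi hvw)
    apply e.injective
    have h9 := congrArg (fun A => A v) he
    have h10 := congrArg (fun A => A w) he
    exact h9.trans (Eq.trans h8 h10.symm)
  -- With $q$ a left inverse of $DJ$, the map $q\circ J$ has derivative $1$ and a local inverse
  -- $\psi$. Then $\psi\circ q\circ\varphi$ recovers the chart coordinates of $y$ from $\iota(y)$,
  -- and $u$ is extended through it.
  obtain ⟨q, hq⟩ := exists_leftInverse_of_injective hJi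
  have hθd : HasFDerivAt (fun z => q (J z)) (ContinuousLinearMap.id ℝ F) (c x) := by
    refine (q.hasFDerivAt.comp (c x)
      ((hJs _ hxt).differentiableAt (by simp)).hasFDerivAt).congr_fderiv ?_
    ext1 v
    exact hq v
  have htn : ∀ᶠ z in 𝓝 (c x), z ∈ c.target := (isOpen_extChartAt_target x).mem_nhds hxt
  obtain ⟨ψ, hψ, hψc, hψs⟩ := exists_eventually_leftInverse
    (htn.mono fun z hz => q.contDiff.contDiffAt.comp z (hJs z hz)) hθd
  have hJx : J (c x) = φ (ι x) := by rw [hJ]; simp only [hcx]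
  rw [Function.comp_apply, hJx] at hψc hψs
  have hqc : ContinuousAt (fun z => q (φ z)) (ι x) :=
    (q.continuous.comp hφ.continuous).continuousAt
  have hψx : ψ (q (φ (ι x))) = c x := by rw [← hJx]; exact hψ.self_of_nhds
  have hψt : ∀ᶠ z in 𝓝 (ι x), ψ (q (φ z)) ∈ c.target := by
    have : ContinuousAt (fun z => ψ (q (φ z))) (ι x) :=
      ContinuousAt.comp (f := fun z => q (φ z)) hψc hqc
    rw [ContinuousAt, hψx] at this
    exact this.eventually htn
  obtain ⟨w, hw, hwe⟩ := exists_contMDiff_eventuallyEq (E := E) (p := ι x)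
    (c := fun z => u (c.symm (ψ (q (φ z))))) (by
      filter_upwards [hψt, hqc.eventually hψs] with z hz1 hz2
      have h1 : CMDiffAt ∞ (fun z : M => q (φ z)) z :=
        (q.contMDiff (n := ∞)).contMDiffAt.comp z (hφ z)
      have h2 : CMDiffAt ∞ (fun z : M => ψ (q (φ z))) z :=
        ContMDiffAt.comp (g := ψ) z hz2.contMDiffAt h1
      exact (hu _).comp z ((hsymm _ hz1).comp z h2))
  refine ⟨w, hw, ?_⟩
  have hcc : ContinuousAt c x := continuousAt_extChartAt x
  filter_upwards [hι.continuous.continuousAt.eventually hwe, hcc.eventually hψ,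
    (isOpen_extChartAt_source (I := 𝓘(ℝ, F)) x).mem_nhds (mem_extChartAt_source x)]
    with y hy1 hy2 hy3
  have h1 : J (c y) = φ (ι y) := by rw [hJ]; simp only [c.left_inv hy3]
  rw [Function.comp_apply] at hy2
  rw [hy1, ← h1, hy2, c.left_inv hy3]

theorem isSmoothDistribution_top (g : Metric 𝓘(ℝ, E) M) :
    IsSmoothDistribution fun x : M => (⊤ : Submodule ℝ (TangentSpace 𝓘(ℝ, E) x)) := by
  intro p
  obtain ⟨e, he, ho⟩ := exists_orthonormal_frame g p
  exact ⟨_, e, he, ho.mono fun x hx => ⟨hx.linearIndependent, hx.span_eq_top⟩⟩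

/-- Along an immersion, smooth vector fields extend locally to the ambient manifold. -/
theorem exists_smoothField_along (g : Metric 𝓘(ℝ, E) M) {ι : L → M}
    (hι : ContMDiff 𝓘(ℝ, F) 𝓘(ℝ, E) ∞ ι) {x : L}
    (hinj : Function.Injective (mfderiv 𝓘(ℝ, F) 𝓘(ℝ, E) ι x))
    {X : Π x : L, TangentSpace 𝓘(ℝ, F) x} (hX : SmoothField X) :
    ∃ X' : Π x : M, TangentSpace 𝓘(ℝ, E) x, SmoothField X' ∧
      ∀ᶠ y in 𝓝 x, X' (ι y) = mfderiv 𝓘(ℝ, F) 𝓘(ℝ, E) ι y (X y) := by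
  obtain ⟨φ, hφ, hφi⟩ := exists_contMDiff_injective_mvfderiv (E := E) (ι x)
  obtain ⟨k, Y, q, hY, hYq⟩ := (isSmoothDistribution_top g).exists_graph_frame hφ hφi
  -- The coordinates $d(\varphi\circ\iota)(X)$ form a function on $L$, which extends to $M$; the
  -- frame turns its extension back into a field.
  obtain ⟨w, hw, hwe⟩ := exists_contMDiff_comp_eventuallyEq hι hinj
    (contMDiff_mvfderiv_apply (hφ.comp hι) hX)
  refine ⟨fun z => ∑ j, (q (w z)) j • Y j z, .sum fun j => .smul ?_ (hY j), ?_⟩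
  · have h1 := ((EuclideanSpace.proj (𝕜 := ℝ) j).comp q).contMDiff (n := ∞)
    exact h1.comp hw
  · filter_upwards [hwe, hι.continuous.continuousAt.eventually hYq] with y hy1 hy2
    obtain ⟨a, ha⟩ := (Submodule.mem_span_range_iff_exists_fun ℝ).1
      (hy2.1 ▸ Submodule.mem_top : mfderiv 𝓘(ℝ, F) 𝓘(ℝ, E) ι y (X y) ∈ _)
    have h1 := frameMap_apply φ Y (ι y) (WithLp.toLp 2 a)
    rw [show ∑ j, (WithLp.toLp 2 a : EuclideanSpace ℝ (Fin k)) j • Y j (ι y) = _ from ha] at h1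
    have h2 : d% (φ ∘ ι) y (X y) = d% φ (ι y) (mfderiv 𝓘(ℝ, F) 𝓘(ℝ, E) ι y (X y)) :=
      mvfderiv_comp_contMDiff hφ hι y (X y)
    rw [hy1, h2, ← h1, hy2.2]
    exact ha

variable [T2Space L] {g : Metric 𝓘(ℝ, E) M}

theorem contMDiff_of_eventuallyEq_comp {ι : L → M} (hι : ContMDiff 𝓘(ℝ, F) 𝓘(ℝ, E) ∞ ι)
    {G : Type*} [NormedAddCommGroup G] [NormedSpace ℝ G] {u : L → G}
    (h : ∀ x, ∃ w : M → G, CMDiff ∞ w ∧ ∀ᶠ y in 𝓝 x, u y = w (ι y)) : CMDiff ∞ u := by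
  intro x
  obtain ⟨w, hw, hwu⟩ := h x
  exact ((hw.comp hι) x).congr_of_eventuallyEq hwu

/-- The first fundamental form of an immersion. -/
noncomputable def inducedMetric (g : Metric 𝓘(ℝ, E) M) {ι : L → M}
    (hι : ContMDiff 𝓘(ℝ, F) 𝓘(ℝ, E) ∞ ι)
    (hinj : ∀ x, Function.Injective (mfderiv 𝓘(ℝ, F) 𝓘(ℝ, E) ι x)) : Metric 𝓘(ℝ, F) L where
  inner x := ContinuousLinearMap.bilinearComp (E := E) (F := E) (E' := F) (F' := F) (G := ℝ)
    (g.inner (ι x)) (mfderiv 𝓘(ℝ, F) 𝓘(ℝ, E) ι x) (mfderiv 𝓘(ℝ, F) 𝓘(ℝ, E) ι x)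
  symm x v w := g.symm _ _ _
  pos x v hv := g.pos _ _ fun h => hv (hinj x (h.trans (map_zero _).symm))
  isVonNBounded x := by
    -- The unit ball of the induced form lies in the image, under a left inverse of $d\iota$, of the
    -- bounded unit ball of $g$.
    obtain ⟨q, hq⟩ := exists_leftInverse_of_injective (V := F) (W := E) (hinj x)
    have h1 := (g.isVonNBounded (ι x)).image q
    refine Bornology.IsVonNBounded.subset ?_ h1
    intro v hv
    exact ⟨mfderiv 𝓘(ℝ, F) 𝓘(ℝ, E) ι x v, hv, hq v⟩
  contMDiff := by
    refine contMDiff_hom_of_apply (F := F →L[ℝ] ℝ)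
      (V := fun x : L => TangentSpace 𝓘(ℝ, F) x →L[ℝ] ℝ) _ fun X hX => ?_
    refine contMDiff_hom_of_apply (F := ℝ) (V := Bundle.Trivial L ℝ) _ fun Y hY => ?_
    intro x
    rw [contMDiffAt_totalSpace]
    refine ⟨contMDiffAt_id, ?_⟩
    obtain ⟨X', hX', hXe⟩ := exists_smoothField_along g hι (hinj x) hX
    obtain ⟨Y', hY', hYe⟩ := exists_smoothField_along g hι (hinj x) hY
    refine (((hX'.inner g hY').comp hι) x).congr_of_eventuallyEq ?_
    filter_upwards [hXe, hYe] with y h1 h2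
    change g.inner (ι y) _ _ = g.inner (ι y) (X' (ι y)) (Y' (ι y))
    rw [h1, h2]
    rfl

theorem inducedMetric_inner {ι : L → M} (hι : ContMDiff 𝓘(ℝ, F) 𝓘(ℝ, E) ∞ ι)
    (hinj : ∀ x, Function.Injective (mfderiv 𝓘(ℝ, F) 𝓘(ℝ, E) ι x)) (x : L)
    (v w : TangentSpace 𝓘(ℝ, F) x) : (inducedMetric g hι hinj).inner x v w =
      g.inner (ι x) (mfderiv 𝓘(ℝ, F) 𝓘(ℝ, E) ι x v) (mfderiv 𝓘(ℝ, F) 𝓘(ℝ, E) ι x w) := rfl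

/-- The field `X'` extends the image of `X` under the immersion `ι` near `x`. -/
def RelatedNear (ι : L → M) (x : L) (X : Π x : L, TangentSpace 𝓘(ℝ, F) x)
    (X' : Π x : M, TangentSpace 𝓘(ℝ, E) x) : Prop :=
  ∀ᶠ y in 𝓝 x, X' (ι y) = mfderiv 𝓘(ℝ, F) 𝓘(ℝ, E) ι y (X y)

theorem mvfderiv_comp_related {G : Type*} [NormedAddCommGroup G] [NormedSpace ℝ G]
    {ι : L → M} (hι : ContMDiff 𝓘(ℝ, F) 𝓘(ℝ, E) ∞ ι) {x : L}
    {X : Π x : L, TangentSpace 𝓘(ℝ, F) x} {X' : Π x : M, TangentSpace 𝓘(ℝ, E) x}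
    (hX : RelatedNear ι x X X') {u : L → G} {w : M → G} (hw : CMDiff ∞ w)
    (h : ∀ᶠ y in 𝓝 x, u y = w (ι y)) : d% u x (X x) = d% w (ι x) (X' (ι x)) := by
  have h1 : u =ᶠ[𝓝 x] w ∘ ι := h
  rw [hX.self_of_nhds, ← mvfderiv_comp_contMDiff hw hι, mvfderiv, h1.mfderiv_eq]
  rfl

theorem RelatedNear.mlieBracket {ι : L → M} (hι : ContMDiff 𝓘(ℝ, F) 𝓘(ℝ, E) ∞ ι) {x : L}
    {X Y : Π x : L, TangentSpace 𝓘(ℝ, F) x} {X' Y' : Π x : M, TangentSpace 𝓘(ℝ, E) x}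
    (hXs : SmoothField X) (hYs : SmoothField Y) (hXs' : SmoothField X') (hYs' : SmoothField Y')
    (hX : RelatedNear ι x X X') (hY : RelatedNear ι x Y Y') :
    mlieBracket 𝓘(ℝ, E) X' Y' (ι x) =
      mfderiv 𝓘(ℝ, F) 𝓘(ℝ, E) ι x (mlieBracket 𝓘(ℝ, F) X Y x) := by
  -- Brackets are compared through their action on a vector-valued function whose differential is
  -- injective at $\iota(x)$.
  obtain ⟨φ, hφ, hφi⟩ := exists_contMDiff_injective_mvfderiv (E := E) (ι x)
  apply hφi
  have h1 : CMDiffAt 2 φ (ι x) := (hφ _).of_le ENat.LEInfty.out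
  have h2 : CMDiffAt 2 (φ ∘ ι) x := ((hφ.comp hι) x).of_le ENat.LEInfty.out
  have h3 : ∀ {Z : Π x : L, TangentSpace 𝓘(ℝ, F) x} {Z' : Π x : M, TangentSpace 𝓘(ℝ, E) x},
      RelatedNear ι x Z Z' →
      ∀ᶠ y in 𝓝 x, d% (φ ∘ ι) y (Z y) = d% φ (ι y) (Z' (ι y)) := fun hZ => by
    filter_upwards [hZ] with y hy
    rw [hy]
    exact mvfderiv_comp_contMDiff hφ hι y _
  rw [mvfderiv_mlieBracket h1 hXs'.mdiffAt hYs'.mdiffAt,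
    ← mvfderiv_comp_contMDiff hφ hι, mvfderiv_mlieBracket h2 hXs.mdiffAt hYs.mdiffAt,
    mvfderiv_comp_related hι hX (contMDiff_mvfderiv_apply hφ hYs') (h3 hY),
    mvfderiv_comp_related hι hY (contMDiff_mvfderiv_apply hφ hXs') (h3 hX)]

/-- Koszul's expression uses only inner products, their derivatives along the fields, and brackets,
all compatible with $\iota$. -/
theorem koszul_inducedMetric {ι : L → M} (hι : ContMDiff 𝓘(ℝ, F) 𝓘(ℝ, E) ∞ ι)
    (hinj : ∀ x, Function.Injective (mfderiv 𝓘(ℝ, F) 𝓘(ℝ, E) ι x)) {x : L}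
    {X Y Z : Π x : L, TangentSpace 𝓘(ℝ, F) x} {X' Y' Z' : Π x : M, TangentSpace 𝓘(ℝ, E) x}
    (hXs : SmoothField X) (hYs : SmoothField Y) (hZs : SmoothField Z)
    (hXs' : SmoothField X') (hYs' : SmoothField Y') (hZs' : SmoothField Z')
    (hX : RelatedNear ι x X X') (hY : RelatedNear ι x Y Y') (hZ : RelatedNear ι x Z Z') :
    koszul (inducedMetric g hι hinj) X Y Z x = koszul g X' Y' Z' (ι x) := by
  have h1 : ∀ {V W : Π x : L, TangentSpace 𝓘(ℝ, F) x} {V' W' : Π x : M, TangentSpace 𝓘(ℝ, E) x},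
      RelatedNear ι x V V' → RelatedNear ι x W W' →
      ∀ᶠ y in 𝓝 x, (inducedMetric g hι hinj).inner y (V y) (W y) =
        (fun z => g.inner z (V' z) (W' z)) (ι y) := fun hV hW => by
    filter_upwards [hV, hW] with y hy hy'
    rw [inducedMetric_inner, hy, hy']
  simp only [koszul, inducedMetric_inner _ _ x]
  rw [mvfderiv_comp_related hι hX (hYs'.inner g hZs') (h1 hY hZ),
    mvfderiv_comp_related hι hY (hXs'.inner g hZs') (h1 hX hZ),
    mvfderiv_comp_related hι hZ (hXs'.inner g hYs') (h1 hX hY),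
    RelatedNear.mlieBracket hι hXs hYs hXs' hYs' hX hY,
    RelatedNear.mlieBracket hι hXs hZs hXs' hZs' hX hZ,
    RelatedNear.mlieBracket hι hYs hZs hYs' hZs' hY hZ,
    hX.self_of_nhds, hY.self_of_nhds, hZ.self_of_nhds]

/-- The Gauss formula for a submanifold whose second fundamental form vanishes. -/
theorem mfderiv_leviCivita_inducedMetric {ι : L → M} (hι : ContMDiff 𝓘(ℝ, F) 𝓘(ℝ, E) ∞ ι)
    (hinj : ∀ x, Function.Injective (mfderiv 𝓘(ℝ, F) 𝓘(ℝ, E) ι x)) {x : L}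
    {X Y : Π x : L, TangentSpace 𝓘(ℝ, F) x} {X' Y' : Π x : M, TangentSpace 𝓘(ℝ, E) x}
    (hXs : SmoothField X) (hYs : SmoothField Y) (hXs' : SmoothField X') (hYs' : SmoothField Y')
    (hX : RelatedNear ι x X X') (hY : RelatedNear ι x Y Y')
    (ht : leviCivita g Y' (ι x) (X' (ι x)) ∈ (mfderiv 𝓘(ℝ, F) 𝓘(ℝ, E) ι x).range) :
    mfderiv 𝓘(ℝ, F) 𝓘(ℝ, E) ι x (leviCivita (inducedMetric g hι hinj) Y x (X x)) =
      leviCivita g Y' (ι x) (X' (ι x)) := by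
  obtain ⟨v, hv⟩ := ht
  have hv : mfderiv 𝓘(ℝ, F) 𝓘(ℝ, E) ι x v = leviCivita g Y' (ι x) (X' (ι x)) := hv
  rw [← hv]
  congr 1
  refine metric_ext (inducedMetric g hι hinj) fun z => ?_
  obtain ⟨Z, hZs, rfl⟩ := exists_smooth_extension z
  obtain ⟨Z', hZs', hZ⟩ := exists_smoothField_along g hι (hinj x) hZs
  have h1 := leviCivita_koszul (inducedMetric g hι hinj) (hXs.mdiffAt (x := x)) hYs.mdiffAt
    hZs.mdiffAt
  have h2 := leviCivita_koszul g (hXs'.mdiffAt (x := ι x)) hYs'.mdiffAt hZs'.mdiffAt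
  rw [koszul_inducedMetric hι hinj hXs hYs hZs hXs' hYs' hZs' hX hY hZ, ← h2, hZ.self_of_nhds] at h1
  rw [inducedMetric_inner (v := v), hv]
  linarith

end Submanifold

/-- A nondegenerate skew matrix $N$ satisfies $\det N=(-1)^{\dim V}\det N\ne0$. -/
theorem even_finrank_of_skew {V : Type*} [AddCommGroup V] [Module ℝ V] [FiniteDimensional ℝ V]
    (B : V →ₗ[ℝ] V →ₗ[ℝ] ℝ) (hB : ∀ v w, B v w = - B w v)
    (hnd : ∀ v, (∀ w, B v w = 0) → v = 0) : Even (finrank ℝ V) := by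
  set b := Module.finBasis ℝ V
  set N := LinearMap.toMatrix₂ b b B with hN
  have hdet : N.det ≠ 0 := (LinearMap.separatingLeft_iff_det_ne_zero b).1 hnd
  have hT : N.transpose = -N := by
    ext i j
    simp only [hN, Matrix.transpose_apply, Matrix.neg_apply, LinearMap.toMatrix₂_apply]
    exact hB _ _
  have h1 := N.det_transpose
  rw [hT, Matrix.det_neg, Fintype.card_fin] at h1
  have h2 : ((-1 : ℝ)) ^ finrank ℝ V = 1 := mul_right_cancel₀ hdet (h1.trans (one_mul _).symm)
  exact (neg_one_pow_eq_one_iff_even (by norm_num)).1 h2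

/-! ### The weak nearly Kähler structure on the integral manifolds of $\mathcal D_{i,0}$. -/

section

variable {E : Type*} [NormedAddCommGroup E] [NormedSpace ℝ E] [FiniteDimensional ℝ E]
  {M : Type u} [TopologicalSpace M] [ChartedSpace E M] [IsManifold 𝓘(ℝ, E) ∞ M] [T2Space M]
  {g : Metric 𝓘(ℝ, E) M}

namespace WeakMetricFStructure

variable {n s : ℕ} {S : WeakMetricFStructure g n s} (hS : S.Adapted)
include hS

theorem Adapted.f_mem_nullDist {i : Fin s} {x : M} {v : TangentSpace 𝓘(ℝ, E) x}
    (hv : v ∈ S.nullDist i x) : S.f x v ∈ S.nullDist i x := by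
  rw [mem_nullDist, hS.h_h_eq_zero_iff] at hv ⊢
  refine ⟨?_, fun j => ?_⟩
  · rw [← neg_eq_zero, ← hS.f_h, hv.1, map_zero]
  · rw [S.f_skew, S.f_ξ, map_zero, neg_zero]

theorem f_eq_zero_iff_of_mem_nullDist {i : Fin s} {x : M} {v : TangentSpace 𝓘(ℝ, E) x}
    (hv : v ∈ S.nullDist i x) : S.f x v = 0 ↔ v = 0 := by
  refine ⟨fun h => ?_, fun h => by rw [h, map_zero]⟩
  rw [← S.reebProj_eq_self (show v ∈ S.reebDist x from h), S.reebProj_eq_zero_iff]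
  exact (S.mem_nullDist.1 hv).2

theorem f_f_eq_of_mem_nullDist {i : Fin s} {x : M} {v : TangentSpace 𝓘(ℝ, E) x}
    (hv : v ∈ S.nullDist i x) : S.f x (S.f x v) = - S.Q x v := by
  rw [S.Q_eq, (S.reebProj_apply x v).symm, S.reebProj_eq_zero_iff.2 (S.mem_nullDist.1 hv).2]
  simp

theorem Adapted.inducesWeakNearlyKahler {i : Fin s}
    (hf : IsTotallyGeodesicFoliation g (S.nullDist i)) {k : ℕ} {L : Type u} [TopologicalSpace L]
    [ChartedSpace (EuclideanSpace ℝ (Fin k)) L] [IsManifold (𝓡 k) ∞ L] {ι : L → M}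
    (hι : IsIntegralManifold (k := k) (S.nullDist i) ι) :
    InducesWeakNearlyKahler (k := k) g S.f ι := by
  have hT2 : T2Space L := .of_injective_continuous hι.injective hι.contMDiff.continuous
  have htg := hf.totallyGeodesic k L ι hι
  set g' := inducedMetric g hι.contMDiff hι.injective_mfderiv with hg'
  set D : ∀ x, TangentSpace (𝓡 k) x →L[ℝ] TangentSpace 𝓘(ℝ, E) (ι x) :=
    fun x => mfderiv (𝓡 k) 𝓘(ℝ, E) ι x with hD
  have hDinj : ∀ x, Function.Injective (D x) := hι.injective_mfderiv
  have hmem : ∀ x v, D x v ∈ S.nullDist i (ι x) := fun x v => by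
    rw [← hι.range_mfderiv]; exact ⟨v, rfl⟩
  have hex : ∀ x w, w ∈ S.nullDist i (ι x) → ∃ v, D x v = w := fun x w hw => by
    rw [← hι.range_mfderiv] at hw; exact hw
  have hleft : ∀ x, ∃ q : TangentSpace 𝓘(ℝ, E) (ι x) →L[ℝ] TangentSpace (𝓡 k) x,
      ∀ v, q (D x v) = v := fun x =>
    exists_leftInverse_of_injective (V := EuclideanSpace ℝ (Fin k)) (W := E) (hDinj x)
  choose q hq using hleft
  -- The left inverses are chosen point by point with no regularity. Smoothness of $f'$ comes from
  -- `hDf`, which determines it through the injective $d\iota$.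
  set f' : Π x : L, TangentSpace (𝓡 k) x →L[ℝ] TangentSpace (𝓡 k) x :=
    fun x => q x ∘L S.f (ι x) ∘L D x with hf'
  have hDf : ∀ x v, D x (f' x v) = S.f (ι x) (D x v) := by
    intro x v
    obtain ⟨w, hw⟩ := hex x _ (hS.f_mem_nullDist (hmem x v))
    change D x (q x (S.f (ι x) (D x v))) = _
    rw [← hw, hq]
  have hin : ∀ x v w, g'.inner x v w = g.inner (ι x) (D x v) (D x w) := fun x v w => rfl
  have hext : ∀ {X : Π x : L, TangentSpace (𝓡 k) x}, SmoothField X → ∀ x,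
      ∃ X' : Π x : M, TangentSpace 𝓘(ℝ, E) x, SmoothField X' ∧ RelatedNear ι x X X' :=
    fun hX x => exists_smoothField_along g hι.contMDiff (hDinj x) hX
  have hrel : ∀ {X : Π x : L, TangentSpace (𝓡 k) x} {X' : Π x : M, TangentSpace 𝓘(ℝ, E) x} {x : L},
      RelatedNear ι x X X' → RelatedNear ι x (fun y => f' y (X y)) fun y => S.f y (X' y) :=
    fun hX => hX.mono fun y hy => (congrArg (S.f (ι y)) hy).trans (hDf y _).symm
  have hsm : SmoothEnd f' := .of_apply fun X hX => .of_inner g' fun Z hZ =>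
    contMDiff_of_eventuallyEq_comp hι.contMDiff fun x => by
      obtain ⟨X', hX', hXX'⟩ := hext hX x
      obtain ⟨Z', hZ', hZZ'⟩ := hext hZ x
      refine ⟨_, (S.f_smooth.apply hX').inner g hZ', ?_⟩
      filter_upwards [hrel hXX', hZZ'] with y hy1 hy2
      rw [hin, hy1, hy2]
  have hgauss : ∀ {X Y : Π x : L, TangentSpace (𝓡 k) x} {X' Y' : Π x : M, TangentSpace 𝓘(ℝ, E) x}
      {x : L}, SmoothField X → SmoothField Y → SmoothField X' → SmoothField Y' →
      RelatedNear ι x X X' → RelatedNear ι x Y Y' →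
      D x (leviCivita g' Y x (X x)) = leviCivita g Y' (ι x) (X' (ι x)) := by
    intro X Y X' Y' x hX hY hX' hY' hXX' hYY'
    refine mfderiv_leviCivita_inducedMetric hι.contMDiff hι.injective_mfderiv hX hY hX' hY' hXX'
      hYY' (htg X' Y' hX' hY' x ?_)
    filter_upwards [hXX', hYY'] with y h1 h2
    rw [h1, h2]
    exact ⟨⟨_, rfl⟩, ⟨_, rfl⟩⟩
  have hskew : ∀ (x : L) (v w : TangentSpace (𝓡 k) x),
      g'.inner x (f' x v) w = - g'.inner x v (f' x w) := fun x v w => by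
    rw [hin, hin, hDf, hDf, S.f_skew]
  have hker : ∀ (x : L) (v : TangentSpace (𝓡 k) x), f' x v = 0 → v = 0 := fun x v hv => by
    have h1 := hDf x v
    rw [hv, map_zero] at h1
    exact hDinj x (((f_eq_zero_iff_of_mem_nullDist hS (hmem x v)).1 h1.symm).trans (map_zero _).symm)
  refine ⟨g', f', hin, hDf, ⟨?_, hsm, hskew, fun x v hv => ?_, fun X Y hX hY x => ?_⟩,
    fun X Y hX hY x => ?_⟩
  -- At any point $g'(f'\cdot,\cdot)$ is a nondegenerate skew form, so the dimension is even.
  · obtain ⟨x⟩ := hι.connected.toNonempty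
    refine even_finrank_of_skew (V := EuclideanSpace ℝ (Fin k))
      (ContinuousLinearMap.coeLM ℝ ∘ₗ (g'.inner x ∘L f' x).toLinearMap) (fun v w => ?_) fun v hv => ?_
    · exact (hskew x v w).trans (congrArg Neg.neg (g'.symm x v (f' x w)))
    · exact hker x v (metric_ext g' fun z => (hv z).trans (by rw [map_zero]; rfl))
  · have h1 := metric_self_pos g' fun h => hv (hker x v h)
    rw [hskew]
    linarith
  · obtain ⟨X', hX', hXX'⟩ := hext hX x
    obtain ⟨Y', hY', hYY'⟩ := hext hY x
    have key : ∀ {X Y : Π x : L, TangentSpace (𝓡 k) x}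
        {X' Y' : Π x : M, TangentSpace 𝓘(ℝ, E) x}, SmoothField X → SmoothField Y →
        SmoothField X' → SmoothField Y' → RelatedNear ι x X X' → RelatedNear ι x Y Y' →
        D x (covEnd g' f' X Y x) = covEnd g S.f X' Y' (ι x) := by
      intro X Y X' Y' hX hY hX' hY' hXX' hYY'
      rw [covEnd, covEnd, map_sub, hDf, hgauss hX hY hX' hY' hXX' hYY',
        hgauss hX (hsm.apply hY) hX' (S.f_smooth.apply hY') hXX' (hrel hYY')]
    apply hDinj x
    rw [map_add, key hX hY hX' hY' hXX' hYY', key hY hX hY' hX' hYY' hXX', map_zero]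
    exact hS.nearly X' Y' hX' hY' (ι x)
  · obtain ⟨X', hX', hXX'⟩ := hext hX x
    obtain ⟨Y', hY', hYY'⟩ := hext hY x
    have hff : SmoothField fun y => S.f y (S.f y (Y' y)) := S.f_smooth.apply (S.f_smooth.apply hY')
    have hQ : SmoothField fun y => S.Q y (Y' y) := S.Q_smooth.apply hY'
    have h1 := hgauss hX (hsm.apply (hsm.apply hY)) hX' hff hXX' (hrel (hrel hYY'))
    have h2 := hgauss hX hY hX' hY' hXX' hYY'
    -- Along $\iota$ the field $Y'$ lies in $\mathcal D_{i,0}$, where $f^2=-Q$, so $f^2Y'+QY'$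
    -- vanishes there. Combined with $\nabla Q=0$ this gives
    -- $\nabla_X(f^2Y)=-Q\nabla_XY=f^2\nabla_XY$.
    have h3 : leviCivita g (fun y => S.f y (S.f y (Y' y)) + S.Q y (Y' y)) (ι x) (X' (ι x)) = 0 := by
      rw [hXX'.self_of_nhds]
      refine leviCivita_eq_zero_of_along (hι.contMDiff.mdifferentiable (by simp) x) (hff.add hQ) ?_ _
      filter_upwards [hYY'] with y hy
      rw [hy, f_f_eq_of_mem_nullDist hS (hmem y _), neg_add_cancel]
    rw [leviCivita_add g hff.mdiffAt hQ.mdiffAt, add_apply] at h3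
    have h4 := hS.covEnd_Q hX' hY' (ι x)
    rw [covEnd, sub_eq_zero] at h4
    rw [h4, ← h2, ← neg_neg (S.Q (ι x) _), ← f_f_eq_of_mem_nullDist hS (hmem x _), h2] at h3
    apply hDinj x
    rw [covEnd, map_sub, map_zero]
    change D x (leviCivita g' (fun y => f' y (f' y (Y y))) x (X x)) - D x (f' x (f' x _)) = 0
    rw [h1, hDf, hDf, h2, sub_eq_add_neg]
    exact h3

end WeakMetricFStructure
end

end WeakNearlyC

open WeakNearlyC
theorem mainTheorem4 {n s : ℕ} {M : Type u} [TopologicalSpace M] [T2Space M]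
    [SecondCountableTopology M] [ChartedSpace (EuclideanSpace ℝ (Fin (2 * n + s))) M]
    [IsManifold (𝓡 (2 * n + s)) ∞ M] (g : Metric (𝓡 (2 * n + s)) M)
    (S : WeakMetricFStructure g n s) (hC : S.IsWeakNearlyC) (hξ : S.ReebCommute)
    (hξ' : S.ReebConnectionFlat) (hQ : S.QParallelOnContact) (hR : S.CurvatureCondition) :
    (∀ (i : Fin s) (μ : ℝ), μ ≠ 0 → (∃ x, (S.hSq i x).HasEigenvalue μ) →
      IsTotallyGeodesicFoliation g fun x => S.reebDist x ⊔ S.eigenDist i μ x) ∧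
    ((∀ i x, s < Module.finrank ℝ (S.kerDEta i x)) →
      (∀ i, (∀ x, S.nullDist i x ≠ ⊥) ∧
        IsTotallyGeodesicFoliation g fun x => S.reebDist x ⊔ S.nullDist i x) ∧
      ((∀ i j x, S.kerDEta i x = S.kerDEta j x) →
        (∀ i j x, S.nullDist i x = S.nullDist j x) ∧
        ∀ i, IsTotallyGeodesicFoliation g (S.nullDist i) ∧
          ∀ (k : ℕ) (L : Type u) [TopologicalSpace L]
            [ChartedSpace (EuclideanSpace ℝ (Fin k)) L] [IsManifold (𝓡 k) ∞ L] (ι : L → M),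
            IsIntegralManifold (k := k) (S.nullDist i) ι → InducesWeakNearlyKahler (k := k) g S.f ι) ∧
      ∀ i, IsTotallyGeodesicFoliation g fun x =>
        S.reebDist x ⊔ ⨆ (μ : ℝ) (_ : μ ≠ 0), S.eigenDist i μ x) := by
  have hS : S.Adapted := ⟨hC, hξ, hξ', hQ, hR⟩
  refine ⟨fun i μ hμ _ => hS.isTotallyGeodesicFoliation_eigenDist i hμ, fun hdim =>
    ⟨fun i => ⟨fun x => hS.nullDist_ne_bot (hdim i x),
      hS.isTotallyGeodesicFoliation_reebDist_sup_nullDist i⟩, fun hker =>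
      ⟨fun i j x => hS.nullDist_congr (hker i j x), fun i => ?_⟩,
      hS.isTotallyGeodesicFoliation_iSup_eigenDist⟩⟩
  have hf := hS.isTotallyGeodesicFoliation_nullDist hker i
  exact ⟨hf, fun k L _ _ _ ι hι => hS.inducesWeakNearlyKahler hf hι⟩
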